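/- Fix integers $q$ and $k\ge 2$, and write $[q]$ for an alphabet of $q$ letters. An operation is a map $p:[q]^k\to[q]$; it is applied to $x^{(1)},\dots,x^{(k)}\in[q]^n$ coordinatewise. A fractional polymorphism of $f:[q]^n\to\mathbb R$ is a probability distribution $\mathcal P$ over operations such that for all $x^{(1)},\dots,x^{(k)}\in[q]^n$, $$\mathbb E_{p\sim\mathcal P}\big[f(p(x^{(1)},\dots,x^{(k)}))\big]\le \frac1k\sum_{j=1}^k f(x^{(j)}).$$ It is *measure preserving* if for every $x\in[q]^k$ and $a\in[q]$, $\Pr_{p\sim\mathcal P}[p(x)=a]=\frac1k|\{j: x_j=a\}|$, and *transitive symmetric* if for every $p$ in its support and all $i,j\in[k]$ there is a permutation $\sigma$ of $[k]$ with $\sigma(i)=j$ and $p(x\circ\sigma)=p(x)$ for all $x\in[q]^k$. For $w=(w_1,\dots,w_n)$, each $w_i$ a probability distribution on $[q]$, the convex extension of $f$ is $$\hat f(w)=\min\Big\{\mathbb E_{x\sim\mu}[f(x)] \;:\; \mu \text{ a probability distribution on } [q]^n \text{ with marginals } \mu_i=w_i \text{ for all } i\Big\},$$ and $\|f\|_\infty=\max_x|f(x)|$.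 **Theorem.** For all $q$ and $k\ge2$ there are a randomized algorithm and constants $C,d$, depending only on $q$ and $k$, such that the following holds for every $n$, every $f:[q]^n\to\mathbb R$, every fractional polymorphism $\mathcal P$ of $f$ of arity $k$ that is transitive symmetric and measure preserving, every $\epsilon>0$ and every $w$ as above. Given $n$, $\epsilon$, $w$, the table of probabilities of $\mathcal P$, and access to a value oracle for $f$, the algorithm always halts within $C\,(n+1/\epsilon+1)^d$ steps, and with probability at least $1-2^{-(n+2)}$ its output $v$ satisfies $$|v-\hat f(w)|\le\epsilon\,\|f\|_\infty .$$ Here an algorithm is a program for a real RAM (integer and real memory cells, indirect addressing, rational constants) in which every arithmetic operation on real cells, every addition, subtraction or assignment of a constant on integer cells, every comparison, every fair coin flip, every oracle query and every control step has unit cost. -/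

import Mathlib

open scoped BigOperators ENNReal

noncomputable section

/-! ### Operations, fractional polymorphisms, convex extension

The alphabet `[q]` is `Fin q`, an assignment is a map `Fin n → Fin q`, and probability distributions
on a finite type `A` are the points of `stdSimplex ℝ A`. -/

/-- Operations of arity `k` on the alphabet `[q]`. -/
abbrev Operation (q k : ℕ) : Type := (Fin k → Fin q) → Fin q

/-- Coordinatewise application of an operation to `k` assignments. -/
def Operation.apply {q k n : ℕ} (p : Operation q k) (X : Fin k → Fin n → Fin q) : Fin n → Fin q :=
  fun i => p (fun j => X j i)

/-- Every input position can be moved to every other one by a permutation of the inputs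
that leaves the operation unchanged. -/
def Operation.TransitiveSymmetric {q k : ℕ} (p : Operation q k) : Prop :=
  ∀ i j : Fin k, ∃ σ : Equiv.Perm (Fin k), σ i = j ∧ ∀ x : Fin k → Fin q, p (x ∘ σ) = p x

/-- `P` is a probability distribution over `k`-ary operations such that, for any `k` assignments,
the expected value of `f` at the output is at most the average value of `f` over the inputs. -/
def IsFractionalPolymorphism {q k n : ℕ} (P : Operation q k → ℝ) (f : (Fin n → Fin q) → ℝ) : Prop :=
  P ∈ stdSimplex ℝ (Operation q k) ∧
    ∀ X : Fin k → Fin n → Fin q, ∑ p, P p * f (p.apply X) ≤ (1 / (k : ℝ)) * ∑ j, f (X j)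

/-- For every input tuple `x` and every letter `a`, the probability that the output is `a` is the
fraction of the inputs that equal `a`. -/
def IsMeasurePreserving {q k : ℕ} (P : Operation q k → ℝ) : Prop :=
  ∀ (x : Fin k → Fin q) (a : Fin q),
    ∑ p : Operation q k with p x = a, P p = ((Finset.univ.filter fun j => x j = a).card : ℝ) / k

/-- Every operation in the support is transitive symmetric. -/
def IsTransitiveSymmetric {q k : ℕ} (P : Operation q k → ℝ) : Prop :=
  ∀ p : Operation q k, P p ≠ 0 → p.TransitiveSymmetric

/-- The probability distributions on `[q]^n` whose `i`-th marginal is `w i` for every `i`. -/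
def couplings {q n : ℕ} (w : Fin n → Fin q → ℝ) : Set ((Fin n → Fin q) → ℝ) :=
  {μ | μ ∈ stdSimplex ℝ (Fin n → Fin q) ∧
    ∀ (i : Fin n) (a : Fin q), ∑ x : Fin n → Fin q with x i = a, μ x = w i a}

/-- The convex extension: the least expectation of `f` over the distributions with marginals `w`
(a minimum, see `convexExtension_isLeast`). -/
def convexExtension {q n : ℕ} (f : (Fin n → Fin q) → ℝ) (w : Fin n → Fin q → ℝ) : ℝ :=
  sInf ((fun μ : (Fin n → Fin q) → ℝ => ∑ x, μ x * f x) '' couplings w)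

theorem couplings_nonempty {q n : ℕ} {w : Fin n → Fin q → ℝ}
    (hw : ∀ i, w i ∈ stdSimplex ℝ (Fin q)) : (couplings w).Nonempty := by
  refine ⟨fun x => ∏ i, w i (x i), ⟨fun x => Finset.prod_nonneg fun i _ => (hw i).1 _, ?_⟩, ?_⟩
  · rw [← Fintype.prod_sum]
    exact Finset.prod_eq_one fun i _ => (hw i).2
  · intro i a
    have h1 : ∀ x : Fin n → Fin q, (if x i = a then ∏ j, w j (x j) else 0)
        = ∏ j, (if j = i then (if x j = a then w j (x j) else 0) else w j (x j)) := by
      intro x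
      by_cases h : x i = a
      · rw [if_pos h]
        refine Finset.prod_congr rfl fun j _ => ?_
        by_cases hj : j = i
        · subst hj; simp [h]
        · simp [hj]
      · rw [if_neg h]
        exact (Finset.prod_eq_zero (Finset.mem_univ i) (by simp [h])).symm
    rw [Finset.sum_filter, Finset.sum_congr rfl fun x _ => h1 x,
      ← Fintype.prod_sum (fun j b => if j = i then (if b = a then w j b else 0) else w j b),
      Finset.prod_eq_single i]
    · simp
    · intro j _ hj
      simp only [hj, if_false]
      exact (hw j).2
    · simp

theorem convexExtension_isLeast {q n : ℕ} (f : (Fin n → Fin q) → ℝ) {w : Fin n → Fin q → ℝ}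
    (hw : ∀ i, w i ∈ stdSimplex ℝ (Fin q)) :
    IsLeast ((fun μ : (Fin n → Fin q) → ℝ => ∑ x, μ x * f x) '' couplings w)
      (convexExtension f w) := by
  have hc : IsCompact (couplings w) := by
    have : couplings w = stdSimplex ℝ (Fin n → Fin q) ∩
        {μ | ∀ (i : Fin n) (a : Fin q), ∑ x : Fin n → Fin q with x i = a, μ x = w i a} := rfl
    rw [this]
    refine (isCompact_stdSimplex ℝ _).inter_right ?_
    simp only [Set.ofPred_forall]
    exact isClosed_iInter fun i => isClosed_iInter fun a =>
      isClosed_eq (by fun_prop) continuous_const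
  exact (hc.image (by fun_prop)).isLeast_sInf ((couplings_nonempty hw).image _)

/-! ### Randomized real RAM with an oracle

Memory consists of integer cells (used for counters, indices and query points) and real cells. Every
elementary instruction and every test has unit cost. Programs are while programs; they contain no
constants other than natural and rational numbers. -/

namespace RealRAM

/-- Operands: `dir a` is the cell with number `a` (direct addressing), `ind a` is the cell whose
number is stored in the integer cell `a` (indirect addressing). -/
inductive Addr where
  | dir (a : ℕ)
  | ind (a : ℕ)

/-- Contents of the memory. -/
structure Store where
  int : ℕ → ℕ
  real : ℕ → ℝ

/-- The number of the cell an operand refers to. -/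
def Addr.loc (s : Store) : Addr → ℕ
  | dir a => a
  | ind a => s.int a

/-- The integer cell an operand refers to. -/
def Store.getInt (s : Store) (a : Addr) : ℕ := s.int (a.loc s)

/-- The real cell an operand refers to. -/
def Store.getReal (s : Store) (a : Addr) : ℝ := s.real (a.loc s)

/-- Overwrite an integer cell. -/
def Store.setInt (s : Store) (a : Addr) (v : ℕ) : Store :=
  { s with int := Function.update s.int (a.loc s) v }

/-- Overwrite a real cell. -/
def Store.setReal (s : Store) (a : Addr) (v : ℝ) : Store :=
  { s with real := Function.update s.real (a.loc s) v }

/-- Elementary instructions; the first operand is the destination. -/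
inductive Instr where
  | constInt (d : Addr) (c : ℕ)
  | addInt (d a b : Addr)
  | subInt (d a b : Addr)
  | constReal (d : Addr) (c : ℚ)
  | addReal (d a b : Addr)
  | subReal (d a b : Addr)
  | mulReal (d a b : Addr)
  | divReal (d a b : Addr)
  /-- store a fair random bit in an integer cell -/
  | flip (d : Addr)
  /-- query the oracle at the string written in consecutive integer cells, starting at the cell whose
  number is the content of `b`; the answer is stored in a real cell -/
  | query (d b : Addr)

/-- Tests: `a < b` for integer cells, `a < b` for real cells. -/
inductive Test where
  | ltInt (a b : Addr)
  | ltReal (a b : Addr)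

/-- The truth value of a test. -/
def Test.holds (s : Store) : Test → Prop
  | ltInt a b => s.getInt a < s.getInt b
  | ltReal a b => s.getReal a < s.getReal b

/-- While programs. -/
inductive Program where
  | instr (i : Instr)
  | seq (p₁ p₂ : Program)
  | branch (t : Test) (p₁ p₂ : Program)
  | loop (t : Test) (p : Program)

/-- An oracle answers with a real number when given a string of letters, of which it reads the
initial part it needs. -/
abbrev Oracle : Type := (ℕ → ℕ) → ℝ

/-- Effect of an elementary instruction: the law of the new memory. -/
def Instr.exec (O : Oracle) (s : Store) : Instr → PMF Store
  | constInt d c => PMF.pure (s.setInt d c)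
  | addInt d a b => PMF.pure (s.setInt d (s.getInt a + s.getInt b))
  | subInt d a b => PMF.pure (s.setInt d (s.getInt a - s.getInt b))
  | constReal d c => PMF.pure (s.setReal d (c : ℝ))
  | addReal d a b => PMF.pure (s.setReal d (s.getReal a + s.getReal b))
  | subReal d a b => PMF.pure (s.setReal d (s.getReal a - s.getReal b))
  | mulReal d a b => PMF.pure (s.setReal d (s.getReal a * s.getReal b))
  | divReal d a b => PMF.pure (s.setReal d (s.getReal a / s.getReal b))
  | flip d => (PMF.uniformOfFintype (Fin 2)).map fun b => s.setInt d b
  | query d b => PMF.pure (s.setReal d (O fun i => s.int (s.getInt b + i)))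

/-- A configuration: the programs that remain to be executed, in this order, and the memory.
The machine has halted when nothing remains. -/
structure Config where
  todo : List Program
  store : Store

open Classical in
/-- One step of computation. -/
def step (O : Oracle) : Config → PMF Config
  | ⟨[], s⟩ => PMF.pure ⟨[], s⟩
  | ⟨.instr i :: K, s⟩ => (i.exec O s).map fun s₁ => ⟨K, s₁⟩
  | ⟨.seq p₁ p₂ :: K, s⟩ => PMF.pure ⟨p₁ :: p₂ :: K, s⟩
  | ⟨.branch t p₁ p₂ :: K, s⟩ => PMF.pure (if t.holds s then ⟨p₁ :: K, s⟩ else ⟨p₂ :: K, s⟩)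
  | ⟨.loop t p :: K, s⟩ => PMF.pure (if t.holds s then ⟨p :: .loop t p :: K, s⟩ else ⟨K, s⟩)

/-- The law of the configuration after `T` steps. -/
def run (O : Oracle) : ℕ → Config → PMF Config
  | 0, c => PMF.pure c
  | T + 1, c => (step O c).bind (run O T)

/-- Initial memory: the integer input `n` is in integer cell `0`, the real input is in the first real
cells, all other cells contain `0`. -/
def load (n : ℕ) (input : List ℝ) : Store where
  int := fun a => if a = 0 then n else 0
  real := fun a => input.getD a 0

/-- The law of the configuration reached by the program `M` after `T` steps on the given input. -/
def runOn (M : Program) (O : Oracle) (n : ℕ) (input : List ℝ) (T : ℕ) : PMF Config :=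
  run O T ⟨[M], load n input⟩

/-- The output is read off real cell `0`. -/
def Config.output (c : Config) : ℝ := c.store.real 0

end RealRAM

/-- The value oracle of `f`. (Strings with a letter outside the alphabet get the answer `0`.) -/
def valueOracle {q n : ℕ} (f : (Fin n → Fin q) → ℝ) : RealRAM.Oracle := fun x =>
  if h : ∀ i : Fin n, x i < q then f fun i => ⟨x i, h i⟩ else 0

/-- The numbering of the `k`-ary operations by their value tables, read in base `q`. -/
def opEquiv (q k : ℕ) : Operation q k ≃ Fin (q ^ q ^ k) :=
  (Equiv.arrowCongr finFunctionFinEquiv (Equiv.refl (Fin q))).trans finFunctionFinEquiv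

/-- The real input: `ε`, then the table of probabilities of `P`, then the table
`w 0 0, …, w 0 (q-1), w 1 0, …` of marginals. -/
def realInput {q k n : ℕ} (ε : ℝ) (P : Operation q k → ℝ) (w : Fin n → Fin q → ℝ) : List ℝ :=
  [ε] ++ List.ofFn (fun j => P ((opEquiv q k).symm j)) ++
    List.ofFn (fun m : Fin (n * q) => w m.divNat m.modNat)

end

/-! The algorithm is a random walk on the marginals. Replace a law μ on assignments by the law of p
applied to k independent samples of μ, with p drawn from P. The polymorphism inequality says that
the expectation of f does not increase on average. The marginals of the new law depend only on the
old marginals (`marg_opLaw`), so the walk can be run on w alone, without knowing μ. After r steps an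
assignment is drawn from the product of the current marginals and f is queried there; the output is
the mean of N such answers.

Upper bound (`val_le`). Start at an optimal coupling μ for w and track α, the squared maximal
correlation of a coordinate with all the others. Passing to independent copies does not increase α,
and the part of a function that mixes the first copy with the remaining ones is contracted by α²
instead of α (`MaxCorr.pair`). Transitive symmetry forces every g ∘ p to have a mixed part
comparable with its variance (`Operation.exists_mixed`), so one step lowers α to α - α(1-α)c
(`MaxCorr.operation`). Mixing a fraction δ of the product law into μ at the start keeps 1-α ≥ δ,
which makes the decay geometric. Once α is tiny, passing to the product of the marginals raises the
expectation of f by at most n q √α B, where B bounds |f| (`RestCorr.ev_prodLaw_le`).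

Lower bound (`le_val`). Measure preservation makes each row of marginals a martingale under the
operation step, the convex extension is convex, and a product law is one of the competitors in the
minimum. Hence the convex extension at w is at most the expected final value, up to the cost of
merging described next.

The constant c deteriorates with the smallest nonzero weight. Before every step the letters lighter
than a threshold η are therefore merged into a heavy letter of the same row. A merge removes letters
from the support and conservative operations never create any, so the costs telescope to order η n q
B (an extra factor q+1 in the lower bound), however long the walk is.

The machine tosses fair bits only, so it draws from laws perturbed by about 2^-L (`exists_selLaw`);
an exponential moment bound controls the mean of N samples (`concentration`). All parameters are
polynomial in s = 1 + n + ⌈1/ε⌉. Programs are verified with `Spec`, which bounds an expected badness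
that is infinite for an unfinished run: a single inequality then yields both halting and the error
probability (`runOn_of_spec`). -/

noncomputable section

namespace RealRAM

/-! ### Expected badness and Hoare triples -/

/-- Badness of a configuration: infinite unless the machine has halted. -/
def badness (bad : Store → ℝ≥0∞) : Config → ℝ≥0∞
  | ⟨[], s⟩ => bad s
  | ⟨_ :: _, _⟩ => ⊤

/-- Expected badness after `T` steps. -/
def expBad (O : Oracle) (bad : Store → ℝ≥0∞) : ℕ → Config → ℝ≥0∞
  | 0, c => badness bad c
  | T + 1, c => ∑' c', step O c c' * expBad O bad T c'

theorem tsum_pure_mul {α : Type*} (a : α) (F : α → ℝ≥0∞) :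
    ∑' x, (PMF.pure a : PMF α) x * F x = F a := by
  rw [tsum_eq_single a]
  · simp
  · intro b hb; simp [PMF.pure_apply, hb]

theorem tsum_bind_mul {α β : Type*} (p : PMF α) (g : α → PMF β) (F : β → ℝ≥0∞) :
    ∑' x, (p.bind g) x * F x = ∑' a, p a * ∑' x, g a x * F x := by
  simp only [PMF.bind_apply, ← ENNReal.tsum_mul_right, ← ENNReal.tsum_mul_left]
  rw [ENNReal.tsum_comm]
  simp only [mul_assoc]

theorem tsum_map_mul {α β : Type*} (p : PMF α) (g : α → β) (F : β → ℝ≥0∞) :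
    ∑' x, (p.map g) x * F x = ∑' a, p a * F (g a) := by
  rw [← PMF.bind_pure_comp, tsum_bind_mul]
  simp only [Function.comp, tsum_pure_mul]

theorem expBad_eq (O : Oracle) (bad : Store → ℝ≥0∞) (T : ℕ) (c : Config) :
    expBad O bad T c = ∑' c', run O T c c' * badness bad c' := by
  induction T generalizing c with
  | zero => simp only [expBad, run, tsum_pure_mul]
  | succ T ih => simp only [expBad, run, tsum_bind_mul, ih]

theorem expBad_halted (O : Oracle) (bad : Store → ℝ≥0∞) (T : ℕ) (s : Store) :
    expBad O bad T ⟨[], s⟩ = bad s := by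
  induction T with
  | zero => rfl
  | succ T ih => simp only [expBad, step, tsum_pure_mul, ih]

/-- An unfinished configuration already has badness ⊤ and a halted one never changes, so extra time
can only help. This is what lets time bounds be rounded up in `Spec.mono` and `DSpec.mono`. -/
theorem expBad_succ_le (O : Oracle) (bad : Store → ℝ≥0∞) (T : ℕ) (c : Config) :
    expBad O bad (T + 1) c ≤ expBad O bad T c := by
  induction T generalizing c with
  | zero =>
    rcases c with ⟨_ | ⟨p, K⟩, s⟩
    · rw [expBad_halted, expBad_halted]
    · simp [expBad, badness]
  | succ T ih =>
    rw [expBad, expBad]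
    exact ENNReal.tsum_le_tsum fun c' => by gcongr; exact ih c'

theorem expBad_anti (O : Oracle) (bad : Store → ℝ≥0∞) (c : Config) :
    Antitone fun T => expBad O bad T c :=
  antitone_nat_of_succ_le fun T => expBad_succ_le O bad T c

/-- `Spec O p T s U Post`: started in `s`, the program `p` takes at most `T` steps and ends in a
store satisfying `Post ω`, where `ω` has law `U`. -/
def Spec (O : Oracle) (p : Program) (T : ℕ) (s : Store) {Ω : Type} (U : PMF Ω)
    (Post : Ω → Store → Prop) : Prop :=
  ∀ (bad : Store → ℝ≥0∞) (K : List Program) (T' : ℕ) (φ : Ω → ℝ≥0∞),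
    (∀ ω s', Post ω s' → expBad O bad T' ⟨K, s'⟩ ≤ φ ω) →
      expBad O bad (T + T') ⟨p :: K, s⟩ ≤ ∑' ω, U ω * φ ω

/-- The deterministic case of `Spec`. -/
def DSpec (O : Oracle) (p : Program) (T : ℕ) (s : Store) (Post : Store → Prop) : Prop :=
  ∀ (bad : Store → ℝ≥0∞) (K : List Program) (T' : ℕ) (v : ℝ≥0∞),
    (∀ s', Post s' → expBad O bad T' ⟨K, s'⟩ ≤ v) → expBad O bad (T + T') ⟨p :: K, s⟩ ≤ v

variable {O : Oracle} {p p₁ p₂ : Program} {T T₁ T₂ : ℕ} {s : Store} {Ω Ω' : Type}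

theorem DSpec.spec {U : PMF Ω} {Post : Ω → Store → Prop} {ω : Ω} (hU : U = PMF.pure ω)
    (h : DSpec O p T s (Post ω)) : Spec O p T s U Post := by
  intro bad K T' φ hφ
  rw [hU, tsum_pure_mul]
  exact h bad K T' _ fun s' hs' => hφ ω s' hs'

theorem Spec.dspec {Post : Unit → Store → Prop} (h : Spec O p T s (PMF.pure ()) Post) :
    DSpec O p T s (Post ()) := by
  intro bad K T' v hv
  simpa only [tsum_pure_mul] using h bad K T' (fun _ => v) fun _ s' hs' => hv s' hs'

theorem DSpec.mono {Post Post' : Store → Prop} (h : DSpec O p T₁ s Post) (hT : T₁ ≤ T)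
    (hP : ∀ s', Post s' → Post' s') : DSpec O p T s Post' := by
  intro bad K T' v hv
  exact (expBad_anti O bad _ (by omega : T₁ + T' ≤ T + T')).trans
    (h bad K T' v fun s' hs' => hv s' (hP s' hs'))

theorem Spec.mono {U : PMF Ω} {Post Post' : Ω → Store → Prop} (h : Spec O p T₁ s U Post)
    (hT : T₁ ≤ T) (hP : ∀ ω s', Post ω s' → Post' ω s') : Spec O p T s U Post' := by
  intro bad K T' v hv
  exact (expBad_anti O bad _ (by omega : T₁ + T' ≤ T + T')).trans
    (h bad K T' v fun ω s' hs' => hv ω s' (hP ω s' hs'))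

theorem Spec.map {U : PMF Ω} {Post : Ω → Store → Prop} {Post' : Ω' → Store → Prop} (g : Ω → Ω')
    (h : Spec O p T s U Post) (hP : ∀ ω s', Post ω s' → Post' (g ω) s') :
    Spec O p T s (U.map g) Post' := by
  intro bad K T' φ hφ
  rw [tsum_map_mul]
  exact h bad K T' (fun ω => φ (g ω)) fun ω s' hs' => hφ _ s' (hP ω s' hs')

theorem expBad_seq (bad : Store → ℝ≥0∞) (K : List Program) (T : ℕ) :
    expBad O bad (T + 1) ⟨.seq p₁ p₂ :: K, s⟩ = expBad O bad T ⟨p₁ :: p₂ :: K, s⟩ := by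
  simp only [expBad, step, tsum_pure_mul]

/-- Because a triple quantifies over the programs `K` that remain, `p₂` simply joins the
continuation of `p₁`, and the laws compose by `bind`. The additional step is the unfolding of `seq`.
-/
theorem Spec.seq {U : PMF Ω} {U' : Ω → PMF Ω'} {R : Ω → Store → Prop} {Post : Ω' → Store → Prop}
    (h₁ : Spec O p₁ T₁ s U R) (h₂ : ∀ ω s', R ω s' → Spec O p₂ T₂ s' (U' ω) Post) :
    Spec O (.seq p₁ p₂) (T₁ + T₂ + 1) s (U.bind U') Post := by
  intro bad K T' φ hφ
  rw [show T₁ + T₂ + 1 + T' = T₁ + (T₂ + T') + 1 by ring, expBad_seq, tsum_bind_mul]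
  exact h₁ bad _ _ _ fun ω s' hs' => h₂ ω s' hs' bad K T' φ hφ

theorem DSpec.seq {R Post : Store → Prop} (h₁ : DSpec O p₁ T₁ s R)
    (h₂ : ∀ s', R s' → DSpec O p₂ T₂ s' Post) : DSpec O (.seq p₁ p₂) (T₁ + T₂ + 1) s Post := by
  intro bad K T' φ hφ
  rw [show T₁ + T₂ + 1 + T' = T₁ + (T₂ + T') + 1 by ring, expBad_seq]
  exact h₁ bad _ _ _ fun s' hs' => h₂ s' hs' bad K T' φ hφ

theorem DSpec.seq_spec {U : PMF Ω} {R : Store → Prop} {Post : Ω → Store → Prop}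
    (h₁ : DSpec O p₁ T₁ s R) (h₂ : ∀ s', R s' → Spec O p₂ T₂ s' U Post) :
    Spec O (.seq p₁ p₂) (T₁ + T₂ + 1) s U Post := by
  intro bad K T' φ hφ
  rw [show T₁ + T₂ + 1 + T' = T₁ + (T₂ + T') + 1 by ring, expBad_seq]
  exact h₁ bad _ _ _ fun s' hs' => h₂ s' hs' bad K T' φ hφ

theorem Spec.seq_dspec {U : PMF Ω} {R Post : Ω → Store → Prop}
    (h₁ : Spec O p₁ T₁ s U R) (h₂ : ∀ ω s', R ω s' → DSpec O p₂ T₂ s' (Post ω)) :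
    Spec O (.seq p₁ p₂) (T₁ + T₂ + 1) s U Post := by
  intro bad K T' φ hφ
  rw [show T₁ + T₂ + 1 + T' = T₁ + (T₂ + T') + 1 by ring, expBad_seq]
  exact h₁ bad _ _ _ fun ω s' hs' => h₂ ω s' hs' bad K T' _ fun s'' hs'' => hφ ω s'' hs''

theorem DSpec.branch {t : Test} {Post : Store → Prop} (h₁ : t.holds s → DSpec O p₁ T s Post)
    (h₂ : ¬ t.holds s → DSpec O p₂ T s Post) : DSpec O (.branch t p₁ p₂) (T + 1) s Post := by
  intro bad K T' v hv
  rw [show T + 1 + T' = T + T' + 1 by ring, expBad]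
  simp only [step, tsum_pure_mul]
  by_cases h : t.holds s
  · rw [if_pos h]; exact h₁ h bad K T' v hv
  · rw [if_neg h]; exact h₂ h bad K T' v hv

/-- Iterated kernels; the argument `j` of `κ` is the number of iterations that remain afterwards. -/
def iterK (κ : ℕ → Ω → PMF Ω) : ℕ → Ω → PMF Ω
  | 0, ω => PMF.pure ω
  | m + 1, ω => (κ m ω).bind (iterK κ m)

/-- The invariant is indexed by the number of passes still to come, so the number of passes is fixed
although the data are random. Each pass pays one step for its test, and the final 1 pays for the
test that fails. -/
theorem Spec.loop {t : Test} {κ : ℕ → Ω → PMF Ω} {I : ℕ → Ω → Store → Prop}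
    (h0 : ∀ ω s, I 0 ω s → ¬ t.holds s)
    (hs : ∀ j ω s, I (j + 1) ω s → t.holds s ∧ Spec O p T s (κ j ω) (I j))
    (m : ℕ) (ω : Ω) (s : Store) (hI : I m ω s) :
    Spec O (.loop t p) (m * (T + 1) + 1) s (iterK κ m ω) (I 0) := by
  induction m generalizing ω s with
  | zero =>
    intro bad K T' φ hφ
    rw [show 0 * (T + 1) + 1 + T' = T' + 1 by ring, expBad]
    simp only [step, tsum_pure_mul, iterK]
    rw [if_neg (h0 ω s hI)]
    exact hφ ω s hI
  | succ m ih =>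
    intro bad K T' φ hφ
    obtain ⟨ht, hb⟩ := hs m ω s hI
    rw [show (m + 1) * (T + 1) + 1 + T' = T + (m * (T + 1) + 1 + T') + 1 by ring, expBad]
    simp only [step, tsum_pure_mul, iterK, tsum_bind_mul]
    rw [if_pos ht]
    exact hb bad _ _ _ fun ω' s' hs' => ih ω' s' hs' bad K T' φ hφ

theorem DSpec.loop {t : Test} {I : ℕ → Store → Prop} (h0 : ∀ s, I 0 s → ¬ t.holds s)
    (hs : ∀ j s, I (j + 1) s → t.holds s ∧ DSpec O p T s (I j))
    (m : ℕ) (s : Store) (hI : I m s) :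
    DSpec O (.loop t p) (m * (T + 1) + 1) s (I 0) := by
  have hk : ∀ m, iterK (fun _ (_ : Unit) => PMF.pure ()) m () = PMF.pure () := by
    intro m
    induction m with
    | zero => rfl
    | succ m ih => simp [iterK, ih]
  have := Spec.loop (O := O) (p := p) (T := T) (t := t) (κ := fun _ (_ : Unit) => PMF.pure ())
    (I := fun j _ => I j) (fun _ => h0) (fun j _ s h => ⟨(hs j s h).1, (hs j s h).2.spec rfl⟩) m () s hI
  rw [hk] at this
  exact this.dspec

/-! ### Rules for instructions and straight-line code -/

/-- Effect of an instruction other than a coin flip. -/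
def Instr.det (O : Oracle) (s : Store) : Instr → Store
  | constInt d c => s.setInt d c
  | addInt d a b => s.setInt d (s.getInt a + s.getInt b)
  | subInt d a b => s.setInt d (s.getInt a - s.getInt b)
  | constReal d c => s.setReal d (c : ℝ)
  | addReal d a b => s.setReal d (s.getReal a + s.getReal b)
  | subReal d a b => s.setReal d (s.getReal a - s.getReal b)
  | mulReal d a b => s.setReal d (s.getReal a * s.getReal b)
  | divReal d a b => s.setReal d (s.getReal a / s.getReal b)
  | flip _ => s
  | query d b => s.setReal d (O fun i => s.int (s.getInt b + i))

/-- The instruction does not toss a coin. -/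
def Instr.IsDet : Instr → Prop
  | flip _ => False
  | _ => True

theorem DSpec.instr {i : Instr} (hi : i.IsDet) {Post : Store → Prop} (h : Post (i.det O s)) :
    DSpec O (.instr i) 1 s Post := by
  intro bad K T' v hv
  have : i.exec O s = PMF.pure (i.det O s) := by cases i <;> first | rfl | exact hi.elim
  rw [show 1 + T' = T' + 1 by ring, expBad]
  simp only [step, this, PMF.pure_map, tsum_pure_mul]
  exact hv _ h

theorem Spec.flip {d : Addr} {Post : Fin 2 → Store → Prop}
    (h : ∀ b : Fin 2, Post b (s.setInt d (b : ℕ))) :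
    Spec O (.instr (.flip d)) 1 s (PMF.uniformOfFintype (Fin 2)) Post := by
  intro bad K T' φ hφ
  rw [show 1 + T' = T' + 1 by ring, expBad]
  simp only [step, Instr.exec, PMF.map_comp, tsum_map_mul]
  change ∑' a, ((PMF.uniformOfFintype (Fin 2)).bind fun b => PMF.pure (b : ℕ)) a * _ ≤ _
  simp only [tsum_bind_mul, tsum_pure_mul, Function.comp]
  exact ENNReal.tsum_le_tsum fun b => mul_le_mul_right (hφ b _ (h b)) _

/-- A sequence of programs. -/
def seqs : List Program → Program
  | [] => .instr (.constInt (.dir 1) 1)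
  | p :: l => .seq p (seqs l)

/-- Straight-line code. -/
def block : List Instr → Program
  | [] => .instr (.constInt (.dir 1) 1)
  | [i] => .instr i
  | i :: l => .seq (.instr i) (block l)

/-- Reduces straight-line code to a fold of `Instr.det`, which `simp` can evaluate. The factor 2
covers each instruction together with its `seq` node. -/
theorem DSpec.block {l : List Instr} (hne : l ≠ []) (hl : ∀ i ∈ l, i.IsDet) {Post : Store → Prop}
    (h : Post (l.foldl (fun s i => i.det O s) s)) : DSpec O (block l) (2 * l.length) s Post := by
  induction l generalizing s with
  | nil => exact absurd rfl hne
  | cons i l ih =>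
    cases l with
    | nil => exact (DSpec.instr (hl i (by simp)) h).mono (by simp) fun _ h => h
    | cons j l =>
      refine DSpec.mono (T₁ := 1 + 2 * (j :: l).length + 1)
        (DSpec.seq (R := fun s' => s' = i.det O s)
        (DSpec.instr (hl i (by simp)) rfl) fun s' hs' => ?_) ?_ fun _ h => h
      · subst hs'
        exact ih (by simp) (fun i hi => hl i (by simp [hi])) h
      · simp; omega

/-- The no-op writes 1 into integer cell 1. It is harmless only where that cell already holds 1, so
every later invariant carries this fact. -/
theorem DSpec.skip {Post : Store → Prop} (h1 : s.int 1 = 1) (h : Post s) :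
    DSpec O (.instr (.constInt (.dir 1) 1)) 1 s Post := by
  refine DSpec.instr (by trivial) ?_
  have : Instr.det O s (.constInt (.dir 1) 1) = s := by
    simp only [Instr.det, Store.setInt, Addr.loc]
    have := Function.update_eq_self 1 s.int
    rw [h1] at this
    rw [this]
  rwa [this]

theorem DSpec.seqs {I : ℕ → Store → Prop} {n : ℕ} {f : Fin n → Program}
    (h1 : ∀ j s, I j s → s.int 1 = 1) (h : ∀ (j : Fin n) s, I j s → DSpec O (f j) T s (I (j + 1)))
    (hI : I 0 s) : DSpec O (seqs (List.ofFn f)) (n * (T + 1) + 1) s (I n) := by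
  induction n generalizing s I with
  | zero => simpa [RealRAM.seqs] using DSpec.skip (h1 0 s hI) hI
  | succ n ih =>
    rw [List.ofFn_succ, RealRAM.seqs]
    refine DSpec.mono (DSpec.seq (h 0 s (by simpa using hI)) fun s' hs' =>
      ih (I := fun j => I (j + 1)) (fun j s hj => h1 (j + 1) s hj)
        (fun j s hj => ?_) (by simpa using hs')) ?_ fun _ h => h
    · simpa using h j.succ s (by simpa using hj)
    · exact le_of_eq (by ring)

theorem DSpec.seqs_list {ι : Type*} {I : List ι → Store → Prop} {f : ι → Program}
    (h1 : ∀ l s, I l s → s.int 1 = 1)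
    (h : ∀ l j s, I l s → DSpec O (f j) T s (I (l ++ [j]))) (l : List ι) (l₀ : List ι)
    (hI : I l₀ s) : DSpec O (RealRAM.seqs (l.map f)) (l.length * (T + 1) + 1) s (I (l₀ ++ l)) := by
  induction l generalizing s l₀ with
  | nil => simpa [RealRAM.seqs] using DSpec.skip (h1 _ s hI) hI
  | cons j l ih =>
    rw [List.map_cons, RealRAM.seqs]
    refine DSpec.mono (DSpec.seq (h l₀ j s hI) fun s' hs' => ih (l₀ ++ [j]) hs') ?_ ?_
    · exact le_of_eq (by simp; ring)
    · intro s h; simpa using h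

/-- From the expected badness of the initial configuration to the law of the halted machine. -/
theorem runOn_of_spec {M : Program} {O : Oracle} {n : ℕ} {input : List ℝ} {T : ℕ} {U : PMF Ω}
    {Post : Ω → Store → Prop} (h : Spec O M T (load n input) U Post) (good : Set ℝ)
    (badΩ : Ω → Prop) (hgood : ∀ ω s, Post ω s → ¬ badΩ ω → s.real 0 ∈ good) {δ : ℝ≥0∞}
    (hδ : U.toOuterMeasure {ω | badΩ ω} ≤ δ) :
    (∀ c ∈ (runOn M O n input T).support, c.todo = []) ∧
      1 - δ ≤ (runOn M O n input T).toOuterMeasure {c | c.output ∈ good} := by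
  classical
  -- The badness chosen is the indicator of a wrong output.
  have hle : ∑' c, runOn M O n input T c * badness (fun s => if s.real 0 ∈ good then 0 else 1) c
      ≤ U.toOuterMeasure {ω | badΩ ω} := by
    rw [runOn, ← expBad_eq]
    have := h (fun s => if s.real 0 ∈ good then 0 else 1) [] 0 (fun ω => if badΩ ω then 1 else 0)
      (fun ω s hs => by
        rw [expBad_halted]
        by_cases hb : badΩ ω
        · rw [if_pos hb]; split_ifs <;> simp
        · rw [if_pos (hgood ω s hs hb)]; simp)
    refine this.trans (le_of_eq ?_)
    rw [PMF.toOuterMeasure_apply]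
    exact tsum_congr fun ω => by simp [Set.indicator_apply]
  have hfin : U.toOuterMeasure {ω | badΩ ω} ≠ ⊤ := by
    refine ne_top_of_le_ne_top ENNReal.one_ne_top ?_
    rw [PMF.toOuterMeasure_apply]
    exact (ENNReal.tsum_le_tsum fun ω => Set.indicator_le_self _ _ ω).trans U.tsum_coe.le
  -- An unfinished configuration of positive probability would make the expectation infinite.
  have htodo : ∀ c ∈ (runOn M O n input T).support, c.todo = [] := by
    intro c hc
    by_contra hne
    have hb : badness (fun s => if s.real 0 ∈ good then 0 else 1) c = ⊤ := by
      rcases c with ⟨_ | ⟨p, K⟩, s⟩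
      · exact absurd rfl hne
      · rfl
    have := (ENNReal.le_tsum c).trans hle
    rw [hb, ENNReal.mul_top ((PMF.mem_support_iff _ _).1 hc)] at this
    exact hfin (top_le_iff.1 this)
  refine ⟨htodo, ?_⟩
  rw [tsub_le_iff_right]
  have hone : (1 : ℝ≥0∞) = ∑' c, runOn M O n input T c := (PMF.tsum_coe _).symm
  rw [hone, PMF.toOuterMeasure_apply]
  refine le_trans ?_ (add_le_add le_rfl (hle.trans hδ))
  rw [← ENNReal.tsum_add]
  refine ENNReal.tsum_le_tsum fun c => ?_
  by_cases hc : c ∈ (runOn M O n input T).support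
  · have h0 := htodo c hc
    rcases c with ⟨l, s⟩
    simp only at h0
    subst h0
    by_cases hg : s.real 0 ∈ good
    · simp [Config.output, hg]
    · simp [Config.output, hg, badness]
  · rw [PMF.mem_support_iff, not_not] at hc
    rw [hc]; exact zero_le

end RealRAM

/-! ### Expectations over finite laws -/

section Expectation

variable {Ω Ω' A B : Type*} [Fintype Ω] [Fintype Ω']

/-- Expectation of `F` under the weights `μ`. -/
def ev (μ F : Ω → ℝ) : ℝ := ∑ x, μ x * F x

theorem ev_add (μ F G : Ω → ℝ) : ev μ (fun x => F x + G x) = ev μ F + ev μ G := by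
  simp [ev, mul_add, Finset.sum_add_distrib]

theorem ev_sub (μ F G : Ω → ℝ) : ev μ (fun x => F x - G x) = ev μ F - ev μ G := by
  simp [ev, mul_sub, Finset.sum_sub_distrib]

theorem ev_const_mul (μ F : Ω → ℝ) (c : ℝ) : ev μ (fun x => c * F x) = c * ev μ F := by
  simp only [ev, Finset.mul_sum]; exact Finset.sum_congr rfl fun _ _ => by ring

theorem ev_mul_const (μ F : Ω → ℝ) (c : ℝ) : ev μ (fun x => F x * c) = ev μ F * c := by
  simp only [ev, Finset.sum_mul]; exact Finset.sum_congr rfl fun _ _ => by ring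

theorem ev_const {μ : Ω → ℝ} (hμ : μ ∈ stdSimplex ℝ Ω) (c : ℝ) : ev μ (fun _ => c) = c := by
  rw [ev, ← Finset.sum_mul, hμ.2, one_mul]

theorem ev_mono {μ F G : Ω → ℝ} (hμ : ∀ x, 0 ≤ μ x) (h : ∀ x, F x ≤ G x) : ev μ F ≤ ev μ G :=
  Finset.sum_le_sum fun x _ => mul_le_mul_of_nonneg_left (h x) (hμ x)

theorem ev_nonneg {μ F : Ω → ℝ} (hμ : ∀ x, 0 ≤ μ x) (h : ∀ x, 0 ≤ F x) : 0 ≤ ev μ F :=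
  Finset.sum_nonneg fun x _ => mul_nonneg (hμ x) (h x)

theorem ev_comm (μ : Ω → ℝ) (ν : Ω' → ℝ) (F : Ω → Ω' → ℝ) :
    ev μ (fun x => ev ν (F x)) = ev ν (fun y => ev μ fun x => F x y) := by
  simp only [ev, Finset.mul_sum]
  rw [Finset.sum_comm]
  exact Finset.sum_congr rfl fun _ _ => Finset.sum_congr rfl fun _ _ => by ring

theorem ev_sum {ι : Type*} (s : Finset ι) (μ : Ω → ℝ) (F : ι → Ω → ℝ) :
    ev μ (fun x => ∑ i ∈ s, F i x) = ∑ i ∈ s, ev μ (F i) := by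
  simp only [ev, Finset.mul_sum]
  rw [Finset.sum_comm]

theorem ev_sum_left {ι : Type*} (s : Finset ι) (c : ι → ℝ) (μ : ι → Ω → ℝ) (F : Ω → ℝ) :
    ev (fun x => ∑ i ∈ s, c i * μ i x) F = ∑ i ∈ s, c i * ev (μ i) F := by
  simp only [ev, Finset.mul_sum, Finset.sum_mul]
  rw [Finset.sum_comm]
  exact Finset.sum_congr rfl fun _ _ => Finset.sum_congr rfl fun _ _ => by ring

theorem ev_sq_le {μ : Ω → ℝ} (hμ : μ ∈ stdSimplex ℝ Ω) (F : Ω → ℝ) :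
    ev μ F ^ 2 ≤ ev μ fun x => F x ^ 2 := by
  have h : 0 ≤ ev μ (fun x => (F x - ev μ F) ^ 2) := ev_nonneg hμ.1 fun x => sq_nonneg _
  have e : ev μ (fun x => (F x - ev μ F) ^ 2) = ev μ (fun x => F x ^ 2) - ev μ F ^ 2 := by
    have : ∀ x, (F x - ev μ F) ^ 2 = F x ^ 2 - 2 * ev μ F * F x + ev μ F ^ 2 := fun x => by ring
    simp only [this]
    rw [ev_add, ev_sub, ev_const_mul, ev_const hμ]; ring
  linarith

theorem ev_le_of_le {μ : Ω → ℝ} (hμ : μ ∈ stdSimplex ℝ Ω) {F : Ω → ℝ} {c : ℝ}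
    (h : ∀ x, F x ≤ c) : ev μ F ≤ c :=
  (ev_mono hμ.1 h).trans (ev_const hμ c).le

theorem le_ev_of_le {μ : Ω → ℝ} (hμ : μ ∈ stdSimplex ℝ Ω) {F : Ω → ℝ} {c : ℝ}
    (h : ∀ x, c ≤ F x) : c ≤ ev μ F :=
  (ev_const hμ c).ge.trans (ev_mono hμ.1 h)

/-- Push-forward of weights. -/
def push [DecidableEq Ω'] (T : Ω → Ω') (μ : Ω → ℝ) : Ω' → ℝ := fun y => ∑ x with T x = y, μ x

theorem ev_push [DecidableEq Ω'] (T : Ω → Ω') (μ : Ω → ℝ) (F : Ω' → ℝ) :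
    ev (push T μ) F = ev μ fun x => F (T x) := by
  simp only [ev, push, Finset.sum_mul, Finset.sum_filter]
  rw [Finset.sum_comm]
  exact Finset.sum_congr rfl fun x _ => by simp

theorem push_mem [DecidableEq Ω'] (T : Ω → Ω') {μ : Ω → ℝ} (hμ : μ ∈ stdSimplex ℝ Ω) :
    push T μ ∈ stdSimplex ℝ Ω' := by
  refine ⟨fun y => Finset.sum_nonneg fun x _ => hμ.1 x, ?_⟩
  have := ev_push T μ fun _ => 1
  simpa [ev, hμ.2] using this

theorem ev_indicator {Ω Ω' : Type*} [Fintype Ω] [DecidableEq Ω'] (T : Ω → Ω') (μ : Ω → ℝ) (y : Ω') :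
    ev μ (fun x => if T x = y then 1 else 0) = push T μ y := by
  simp [ev, push, Finset.sum_filter]

/-- Law of `k` independent samples. -/
def powLaw (k : ℕ) (μ : Ω → ℝ) : (Fin k → Ω) → ℝ := fun v => ∏ j, μ (v j)

theorem powLaw_mem (k : ℕ) {μ : Ω → ℝ} (hμ : μ ∈ stdSimplex ℝ Ω) :
    powLaw k μ ∈ stdSimplex ℝ (Fin k → Ω) := by
  classical
  refine ⟨fun v => Finset.prod_nonneg fun j _ => hμ.1 _, ?_⟩
  simp only [powLaw]
  rw [← Fintype.prod_sum]
  exact Finset.prod_eq_one fun _ _ => hμ.2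

theorem ev_powLaw_succ (k : ℕ) (μ : Ω → ℝ) (F : (Fin (k + 1) → Ω) → ℝ) :
    ev (powLaw (k + 1) μ) F = ev μ fun x => ev (powLaw k μ) fun v => F (Fin.cons x v) := by
  simp only [ev, Finset.mul_sum]
  rw [← Fintype.sum_prod_type', ← (Fin.consEquiv fun _ => Ω).sum_comp]
  refine Finset.sum_congr rfl fun v _ => ?_
  simp [powLaw, Fin.prod_univ_succ, Fin.consEquiv, mul_assoc]

theorem ev_powLaw_apply {k : ℕ} {μ : Ω → ℝ} (hμ : μ ∈ stdSimplex ℝ Ω) (j : Fin k) (F : Ω → ℝ) :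
    ev (powLaw k μ) (fun v => F (v j)) = ev μ F := by
  induction k with
  | zero => exact j.elim0
  | succ k ih =>
    rw [ev_powLaw_succ]
    refine Fin.cases ?_ (fun j => ?_) j
    · simp only [Fin.cons_zero, ev_const (powLaw_mem k hμ)]
    · simp only [Fin.cons_succ, ih, ev_const hμ]

theorem ev_powLaw_prod {k : ℕ} (μ : Ω → ℝ) (F : Fin k → Ω → ℝ) :
    ev (powLaw k μ) (fun v => ∏ j, F j (v j)) = ∏ j, ev μ (F j) := by
  classical
  simp only [ev, powLaw, ← Finset.prod_mul_distrib]
  rw [← Fintype.prod_sum fun j x => μ x * F j x]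

/-- Conditional expectations exist. -/
theorem exists_condExp {μ : Ω → ℝ} (hμ : ∀ x, 0 ≤ μ x) (Y : Ω → B) (F : Ω → ℝ) :
    ∃ L : B → ℝ, ∀ ψ : B → ℝ, ev μ (fun x => F x * ψ (Y x)) = ev μ fun x => L (Y x) * ψ (Y x) := by
  classical
  refine ⟨fun y => (∑ x with Y x = y, μ x * F x) / ∑ x with Y x = y, μ x, fun ψ => ?_⟩
  simp only [ev]
  rw [← Finset.sum_fiberwise_of_maps_to (t := Finset.univ.image Y) (g := Y) (by simp),
    ← Finset.sum_fiberwise_of_maps_to (s := Finset.univ) (t := Finset.univ.image Y) (g := Y) (by simp)]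
  refine Finset.sum_congr rfl fun y _ => ?_
  have e1 : ∀ x ∈ Finset.univ.filter (fun x => Y x = y), μ x * (F x * ψ (Y x)) = μ x * F x * ψ y := by
    intro x hx; rw [(Finset.mem_filter.1 hx).2]; ring
  rw [Finset.sum_congr rfl e1, ← Finset.sum_mul]
  have e3 : ∀ x ∈ Finset.univ.filter (fun x => Y x = y),
      μ x * ((∑ x' with Y x' = Y x, μ x' * F x') / (∑ x' with Y x' = Y x, μ x') * ψ (Y x)) =
      μ x * ((∑ x' with Y x' = y, μ x' * F x') / (∑ x' with Y x' = y, μ x') * ψ y) := by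
    intro x hx; rw [(Finset.mem_filter.1 hx).2]
  rw [Finset.sum_congr rfl e3, ← Finset.sum_mul]
  -- On a fibre of mass zero the quotient takes the default value 0, but all weights there vanish as
  -- well.
  by_cases hm : ∑ x with Y x = y, μ x = 0
  · have h0 := (Finset.sum_eq_zero_iff_of_nonneg fun x _ => hμ x).1 hm
    rw [hm, zero_mul, Finset.sum_eq_zero fun x hx => by rw [h0 x hx, zero_mul], zero_mul]
  · field_simp

end Expectation

/-! ### Maximal correlation -/

section MaxCorr

variable {Ω Ω₁ Ω₂ A B A₁ A₂ B₁ B₂ : Type*} [Fintype Ω] [Fintype Ω₁] [Fintype Ω₂]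

/-- The squared maximal correlation of `X` and `Y` is at most `α`, in the linearised form
`2 E[g(X) h(Y)] ≤ E[h(Y)²] + α E[g(X)²] + (1 - α) (E g(X))²`. -/
def MaxCorr (μ : Ω → ℝ) (X : Ω → A) (Y : Ω → B) (α : ℝ) : Prop :=
  ∀ (g : A → ℝ) (h : B → ℝ), 2 * ev μ (fun x => g (X x) * h (Y x)) ≤
    ev μ (fun x => h (Y x) ^ 2) + α * ev μ (fun x => g (X x) ^ 2) +
      (1 - α) * ev μ (fun x => g (X x)) ^ 2

/-- Raising α trades the squared mean of g for its second moment, which is larger by `ev_sq_le`. -/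
theorem MaxCorr.mono {μ : Ω → ℝ} (hμ : μ ∈ stdSimplex ℝ Ω) {X : Ω → A} {Y : Ω → B} {α α' : ℝ}
    (h : MaxCorr μ X Y α) (hα : α ≤ α') : MaxCorr μ X Y α' := by
  intro g k
  have := h g k
  have := ev_sq_le hμ fun x => g (X x)
  nlinarith

/-- Data processing. The linearised form quantifies over all test functions, so the proof is a
substitution. -/
theorem MaxCorr.comp {μ : Ω → ℝ} {X : Ω → A} {Y : Ω → B} {α : ℝ} (h : MaxCorr μ X Y α)
    (φ : A → A₁) (ψ : B → B₁) : MaxCorr μ (fun x => φ (X x)) (fun x => ψ (Y x)) α :=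
  fun g k => h (fun a => g (φ a)) fun b => k (ψ b)

theorem MaxCorr.of_push [DecidableEq Ω₁] {T : Ω → Ω₁} {μ : Ω → ℝ} {X : Ω₁ → A} {Y : Ω₁ → B} {α : ℝ}
    (h : MaxCorr μ (fun x => X (T x)) (fun x => Y (T x)) α) : MaxCorr (push T μ) X Y α := by
  intro g k
  simp only [ev_push]
  exact h g k

/-- Tensorisation that keeps the gain. Decompose G into its mean, two functions of one variable, and
a mixed remainder. The one-variable parts contract by α and the mixed part by α², which is the
subtracted term α(1-α). The estimate conditions first on the second pair and then on the first. -/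
theorem MaxCorr.pair {μ₁ : Ω₁ → ℝ} {μ₂ : Ω₂ → ℝ} (h₁ : μ₁ ∈ stdSimplex ℝ Ω₁)
    (h₂ : μ₂ ∈ stdSimplex ℝ Ω₂) {X₁ : Ω₁ → A₁} {Y₁ : Ω₁ → B₁} {X₂ : Ω₂ → A₂} {Y₂ : Ω₂ → B₂} {α : ℝ}
    (hα : 0 ≤ α) (hα1 : α ≤ 1) (m₁ : MaxCorr μ₁ X₁ Y₁ α) (m₂ : MaxCorr μ₂ X₂ Y₂ α)
    (G : A₁ → A₂ → ℝ) (H : B₁ → B₂ → ℝ) :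
    2 * ev μ₁ (fun x => ev μ₂ fun y => G (X₁ x) (X₂ y) * H (Y₁ x) (Y₂ y)) ≤
      ev μ₁ (fun x => ev μ₂ fun y => H (Y₁ x) (Y₂ y) ^ 2) +
      α * ev μ₁ (fun x => ev μ₂ fun y => G (X₁ x) (X₂ y) ^ 2) +
      (1 - α) * ev μ₁ (fun x => ev μ₂ fun y => G (X₁ x) (X₂ y)) ^ 2 -
      α * (1 - α) * ev μ₁ (fun x => ev μ₂ fun y => (G (X₁ x) (X₂ y) -
        ev μ₂ (fun y' => G (X₁ x) (X₂ y')) - ev μ₁ (fun x' => G (X₁ x') (X₂ y)) +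
        ev μ₁ (fun x' => ev μ₂ fun y' => G (X₁ x') (X₂ y'))) ^ 2) := by
  -- L a z is the conditional expectation of G a X₂ given Y₂ = z.
  choose L hL using fun a : A₁ => exists_condExp h₂.1 Y₂ fun y => G a (X₂ y)
  set c := ev μ₁ (fun x => ev μ₂ fun y => G (X₁ x) (X₂ y)) with hc
  set a : Ω₁ → ℝ := fun x => ev μ₂ fun y => G (X₁ x) (X₂ y) with ha
  set b : A₂ → ℝ := fun z => ev μ₁ fun x => G (X₁ x) z with hb
  have hcb : ev μ₂ (fun y => b (X₂ y)) = c := by rw [hc, ev_comm]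
  have hca : ev μ₁ a = c := rfl
  -- expansion of the mixed part
  have hQ : ev μ₁ (fun x => ev μ₂ fun y => (G (X₁ x) (X₂ y) - a x - b (X₂ y) + c) ^ 2) =
      ev μ₁ (fun x => ev μ₂ fun y => G (X₁ x) (X₂ y) ^ 2) - ev μ₁ (fun x => a x ^ 2) -
        ev μ₂ (fun y => b (X₂ y) ^ 2) + c ^ 2 := by
    have e : ∀ x y, (G (X₁ x) (X₂ y) - a x - b (X₂ y) + c) ^ 2 =
        G (X₁ x) (X₂ y) ^ 2 + b (X₂ y) ^ 2 - 2 * (G (X₁ x) (X₂ y) * b (X₂ y)) +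
          (2 * (c - a x)) * G (X₁ x) (X₂ y) - (2 * (c - a x)) * b (X₂ y) + (c - a x) ^ 2 := by
      intro x y; ring
    simp only [e, ev_add, ev_sub, ev_const_mul, ev_const h₂, hcb]
    have e2 : ev μ₁ (fun x => ev μ₂ fun y => G (X₁ x) (X₂ y) * b (X₂ y)) =
        ev μ₂ fun y => b (X₂ y) ^ 2 := by
      rw [ev_comm]
      congr 1; funext y
      rw [ev_mul_const, sq]
    have e3 : ev μ₁ (fun x => 2 * (c - a x) * ev μ₂ (fun y => G (X₁ x) (X₂ y))) =
        2 * c * c - 2 * ev μ₁ (fun x => a x ^ 2) := by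
      have : ∀ x, 2 * (c - a x) * ev μ₂ (fun y => G (X₁ x) (X₂ y)) = 2 * c * a x - 2 * a x ^ 2 := by
        intro x; simp only [ha]; ring
      simp only [this, ev_sub, ev_const_mul, hca]
    have e4 : ev μ₁ (fun x => 2 * (c - a x) * c) = 0 := by
      simp only [ev_mul_const, ev_const_mul, ev_sub, ev_const h₁, hca]; ring
    have e5 : ev μ₁ (fun x => (c - a x) ^ 2) = ev μ₁ (fun x => a x ^ 2) - c ^ 2 := by
      have : ∀ x, (c - a x) ^ 2 = a x ^ 2 - 2 * c * a x + c ^ 2 := fun x => by ring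
      simp only [this, ev_add, ev_sub, ev_const_mul, ev_const h₁, hca]; ring
    rw [e2, e3, e4, e5, ev_const h₁]; ring
  -- first pair, for each value of the second
  have s1 : 2 * ev μ₁ (fun x => ev μ₂ fun y => G (X₁ x) (X₂ y) * H (Y₁ x) (Y₂ y)) ≤
      ev μ₁ (fun x => ev μ₂ fun y => H (Y₁ x) (Y₂ y) ^ 2) +
      α * ev μ₁ (fun x => ev μ₂ fun y => L (X₁ x) (Y₂ y) ^ 2) +
      (1 - α) * ev μ₂ (fun y => ev μ₁ (fun x => L (X₁ x) (Y₂ y)) ^ 2) := by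
    have e : ev μ₁ (fun x => ev μ₂ fun y => G (X₁ x) (X₂ y) * H (Y₁ x) (Y₂ y)) =
        ev μ₂ (fun y => ev μ₁ fun x => L (X₁ x) (Y₂ y) * H (Y₁ x) (Y₂ y)) := by
      rw [ev_comm μ₂]
      congr 1; funext x
      exact hL (X₁ x) fun z => H (Y₁ x) z
    rw [e, ev_comm μ₁, ev_comm μ₁, ← ev_const_mul, ← ev_const_mul, ← ev_const_mul, ← ev_add, ← ev_add]
    exact ev_mono h₂.1 fun y => m₁ (fun z => L z (Y₂ y)) fun z => H z (Y₂ y)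
  -- Testing against h = L z turns the linearised inequality into a bound on the second moment of
  -- the conditional expectation itself.
  have s2 : ∀ z : A₁, ev μ₂ (fun y => L z (Y₂ y) ^ 2) ≤ α * ev μ₂ (fun y => G z (X₂ y) ^ 2) +
      (1 - α) * ev μ₂ (fun y => G z (X₂ y)) ^ 2 := by
    intro z
    have e := hL z (L z)
    have := m₂ (G z) (L z)
    rw [e] at this
    simp only [← sq] at this
    linarith
  -- The average of L over the first variable is the conditional expectation of b(X₂) given Y₂, so
  -- the same device applies to b.
  have s3 : ev μ₂ (fun y => ev μ₁ (fun x => L (X₁ x) (Y₂ y)) ^ 2) ≤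
      α * ev μ₂ (fun y => b (X₂ y) ^ 2) + (1 - α) * c ^ 2 := by
    have := m₂ b fun z => ev μ₁ fun x => L (X₁ x) z
    have e : ev μ₂ (fun y => b (X₂ y) * ev μ₁ fun x => L (X₁ x) (Y₂ y)) =
        ev μ₂ (fun y => ev μ₁ (fun x => L (X₁ x) (Y₂ y)) ^ 2) := by
      simp only [hb, sq, ← ev_mul_const]
      rw [ev_comm μ₂, ev_comm μ₂]
      congr 1; funext x
      exact hL (X₁ x) fun z => ev μ₁ fun x => L (X₁ x) z
    rw [e, hcb] at this
    linarith
  have s4 : ev μ₁ (fun x => ev μ₂ fun y => L (X₁ x) (Y₂ y) ^ 2) ≤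
      α * ev μ₁ (fun x => ev μ₂ fun y => G (X₁ x) (X₂ y) ^ 2) +
      (1 - α) * ev μ₁ (fun x => a x ^ 2) := by
    rw [← ev_const_mul, ← ev_const_mul, ← ev_add]
    exact ev_mono h₁.1 fun x => s2 _
  rw [hQ]
  nlinarith [mul_le_mul_of_nonneg_left s4 hα, mul_le_mul_of_nonneg_left s3 (sub_nonneg.2 hα1)]

/-- Induction on the number of copies through `MaxCorr.pair`, discarding the mixed term, which has a
favourable sign. -/
theorem MaxCorr.power {μ : Ω → ℝ} (hμ : μ ∈ stdSimplex ℝ Ω) {X : Ω → A} {Y : Ω → B} {α : ℝ}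
    (hα : 0 ≤ α) (hα1 : α ≤ 1) (m : MaxCorr μ X Y α) (k : ℕ) :
    MaxCorr (powLaw k μ) (fun v j => X (v j)) (fun v j => Y (v j)) α := by
  induction k with
  | zero =>
    intro g h
    have e : ∀ F : (Fin 0 → Ω) → ℝ, ev (powLaw 0 μ) F = F default := by
      intro F; simp [ev, powLaw]
    simp only [e]
    have hX : (fun j : Fin 0 => X ((default : Fin 0 → Ω) j)) = default := Subsingleton.elim _ _
    nlinarith [sq_nonneg (g (fun j : Fin 0 => X ((default : Fin 0 → Ω) j)) -
      h (fun j : Fin 0 => Y ((default : Fin 0 → Ω) j)))]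
  | succ k ih =>
    intro g h
    simp only [ev_powLaw_succ]
    have hX : ∀ x (v : Fin k → Ω), (fun j => X ((Fin.cons x v : Fin (k + 1) → Ω) j)) =
        Fin.cons (X x) fun j => X (v j) := by
      intro x v; funext j; refine Fin.cases ?_ (fun j => ?_) j <;> simp
    have hY : ∀ x (v : Fin k → Ω), (fun j => Y ((Fin.cons x v : Fin (k + 1) → Ω) j)) =
        Fin.cons (Y x) fun j => Y (v j) := by
      intro x v; funext j; refine Fin.cases ?_ (fun j => ?_) j <;> simp
    simp only [hX, hY]
    have := MaxCorr.pair hμ (powLaw_mem k hμ) hα hα1 m ih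
      (fun a v => g (Fin.cons a v)) fun a v => h (Fin.cons a v)
    refine this.trans (sub_le_self _ (mul_nonneg (mul_nonneg hα (sub_nonneg.2 hα1)) ?_))
    exact ev_nonneg hμ.1 fun x => ev_nonneg (powLaw_mem k hμ).1 fun y => sq_nonneg _

end MaxCorr

/-! ### Contraction of the maximal correlation under a transitive symmetric operation -/

/-- The output is always one of the inputs. -/
def Operation.Conservative {q k : ℕ} (p : Operation q k) : Prop := ∀ x, ∃ j, p x = x j

/-- On words in u and v, a conservative and transitive symmetric p cannot be the sum of a function
of the first input and a function of the others. If a lone u wins against v in the first position,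
it wins in the second too, and both effects cannot add up. If it loses, the first input has no
influence next to a background of v, yet it must have some influence elsewhere. -/
theorem Operation.exists_mixed {q k : ℕ} (p : Operation q (k + 2)) (hc : p.Conservative)
    (ht : p.TransitiveSymmetric) (u v : Fin q) :
    ∃ y y' : Fin (k + 1) → Fin q, (∀ j, y j = u ∨ y j = v) ∧ (∀ j, y' j = u ∨ y' j = v) ∧
      ∀ g : Fin q → ℝ, |g u - g v| ≤ |g (p (Fin.cons u y)) - g (p (Fin.cons v y)) -
        g (p (Fin.cons u y')) + g (p (Fin.cons v y'))| := by
  rcases eq_or_ne u v with huv | huv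
  · subst huv
    exact ⟨fun _ => u, fun _ => u, fun _ => Or.inl rfl, fun _ => Or.inl rfl, fun g => by simp⟩
  have hcons : ∀ c (y : Fin (k + 1) → Fin q), (c = u ∨ c = v) → (∀ j, y j = u ∨ y j = v) →
      p (Fin.cons c y) = u ∨ p (Fin.cons c y) = v := by
    intro c y h hy
    obtain ⟨j, hj⟩ := hc (Fin.cons c y)
    rw [hj]
    refine Fin.cases ?_ (fun j => ?_) j
    · simpa using h
    · simpa using hy j
  have hvv : p (Fin.cons v fun _ => v) = v := by
    obtain ⟨j, hj⟩ := hc (Fin.cons v fun _ => v)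
    rw [hj]; refine Fin.cases ?_ (fun j => ?_) j <;> simp
  rcases hcons u (fun _ => v) (Or.inl rfl) (fun _ => Or.inr rfl) with ha | ha
  · refine ⟨fun _ => v, Function.update (fun _ => v) 0 u, fun _ => Or.inr rfl, fun j => ?_, fun g => ?_⟩
    · by_cases hj : j = 0 <;> simp [hj]
    -- The permutation moves the lone u from position 0 to position 1 without changing the output.
    obtain ⟨σ, hσ, hp⟩ := ht 1 0
    have h1 : p (Fin.cons v (Function.update (fun _ => v) 0 u)) = u := by
      have h := hp (Fin.cons u fun _ => v)
      rw [ha] at h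
      refine Eq.trans (congrArg p (funext fun i => ?_)) h
      have key : σ i = 0 ↔ i = 1 := by rw [← hσ]; exact σ.injective.eq_iff
      have hval : ∀ j : Fin (k + 2), (Fin.cons u (fun _ => v) : Fin (k + 2) → Fin q) j =
          if j = 0 then u else v := by
        intro j; refine Fin.cases ?_ (fun j => ?_) j <;> simp
      rw [Function.comp_apply, hval]
      refine Fin.cases (motive := fun i => (σ i = 0 ↔ i = 1) → (Fin.cons v
        (Function.update (fun _ => v) 0 u) : Fin (k + 2) → Fin q) i = if σ i = 0 then u else v)
        (fun key => ?_) (fun i key => ?_) i key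
      · rw [if_neg]; · simp
        rw [key]; exact fun h => absurd h (by simp)
      · rw [Fin.cons_succ, Function.update_apply]
        refine if_congr ?_ rfl rfl
        rw [key, ← Fin.succ_zero_eq_one, Fin.succ_inj]
    rw [ha, hvv, h1]
    have h2 : p (Fin.cons u (Function.update (fun _ => v) 0 u)) = u ∨
        p (Fin.cons u (Function.update (fun _ => v) 0 u)) = v := by
      refine hcons _ _ (Or.inl rfl) fun j => ?_
      by_cases hj : j = 0 <;> simp [hj]
    rcases h2 with h2 | h2 <;> rw [h2]
    · rw [show g u - g v - g u + g u = g u - g v by ring]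
    · rw [show g u - g v - g v + g u = 2 * (g u - g v) by ring, abs_mul, abs_two]
      linarith [abs_nonneg (g u - g v)]
  · obtain ⟨y, hy, hne⟩ : ∃ y : Fin (k + 1) → Fin q, (∀ j, y j = u ∨ y j = v) ∧
        p (Fin.cons u y) ≠ p (Fin.cons v y) := by
      by_contra! hcon
      -- If the first input never mattered on words in u and v, then by transitivity no input would.
      -- Letters could be changed from v to u one by one with output v throughout, contradicting the
      -- value u on the constant word u.
      have hall : ∀ A : Finset (Fin (k + 2)), p (fun i => if i ∈ A then u else v) = v := by
        intro A
        induction A using Finset.induction_on with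
        | empty =>
          obtain ⟨j, hj⟩ := hc fun _ => v
          simpa using hj
        | insert j A hj ih =>
          obtain ⟨σ, hσ, hp⟩ := ht 0 j
          have h1 : ∀ i : Fin (k + 1), σ i.succ ≠ j := fun i h =>
            absurd (σ.injective (h.trans hσ.symm)) (Fin.succ_ne_zero i)
          rw [← hp] at ih ⊢
          have e1 : (fun i => if i ∈ insert j A then u else v) ∘ σ =
              Fin.cons u fun i : Fin (k + 1) => if σ i.succ ∈ A then u else v := by
            funext i
            refine Fin.cases ?_ (fun i => ?_) i
            · simp [hσ]
            · simp [h1]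
          have e2 : (fun i => if i ∈ A then u else v) ∘ σ =
              Fin.cons v fun i : Fin (k + 1) => if σ i.succ ∈ A then u else v := by
            funext i
            refine Fin.cases ?_ (fun i => ?_) i
            · simp [hσ, hj]
            · simp
          rw [e1, hcon _ fun i => by split_ifs <;> simp, ← e2, ih]
      obtain ⟨j, hj⟩ := hc fun _ => u
      have h2 := hall Finset.univ
      simp only [Finset.mem_univ, if_true] at h2
      exact huv (by rw [← h2, hj])
    refine ⟨y, fun _ => v, hy, fun _ => Or.inr rfl, fun g => ?_⟩
    rw [ha, hvv]
    rcases hcons u y (Or.inl rfl) hy with h1 | h1 <;> rcases hcons v y (Or.inr rfl) hy with h2 | h2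
    · exact absurd (h1.trans h2.symm) hne
    · rw [h1, h2]; simp
    · rw [h1, h2, show g v - g u - g v + g v = -(g u - g v) by ring, abs_neg]
    · exact absurd (h1.trans h2.symm) hne

theorem Operation.Conservative.mem_support {q k : ℕ} {p : Operation q k} (hc : p.Conservative)
    {S : Fin q → Prop} {x : Fin k → Fin q} (hx : ∀ j, S (x j)) : S (p x) := by
  obtain ⟨j, hj⟩ := hc x
  rw [hj]; exact hx j

theorem ev_sub_sq_le {Ω : Type*} [Fintype Ω] {μ : Ω → ℝ} (hμ : μ ∈ stdSimplex ℝ Ω) (F : Ω → ℝ)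
    (c : ℝ) : ev μ (fun x => F x ^ 2) - ev μ F ^ 2 ≤ ev μ fun x => (F x - c) ^ 2 := by
  have e : ev μ (fun x => (F x - c) ^ 2) = ev μ (fun x => F x ^ 2) - 2 * c * ev μ F + c ^ 2 := by
    have : ∀ x, (F x - c) ^ 2 = F x ^ 2 - 2 * c * F x + c ^ 2 := fun x => by ring
    simp only [this]
    rw [ev_add, ev_sub, ev_const_mul, ev_const hμ]
  nlinarith [sq_nonneg (ev μ F - c)]

/-- The expectation of a nonnegative function is at least the contribution of one atom of the
independent letters. -/
theorem push_le_ev {Ω : Type*} [Fintype Ω] {q k : ℕ} {μ : Ω → ℝ} (hμ : μ ∈ stdSimplex ℝ Ω)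
    (X : Ω → Fin q) (F : Fin q → (Fin k → Fin q) → ℝ) (hF : ∀ a b, 0 ≤ F a b) (a : Fin q)
    (b : Fin k → Fin q) :
    push X μ a * (∏ j, push X μ (b j)) * F a b ≤
      ev μ fun x => ev (powLaw k μ) fun v => F (X x) fun j => X (v j) := by
  have e : push X μ a * (∏ j, push X μ (b j)) * F a b =
      ev μ fun x => ev (powLaw k μ) fun v =>
        (if X x = a then 1 else 0) * (∏ j, if X (v j) = b j then 1 else 0) * F a b := by
    simp only [ev_mul_const, ev_const_mul]
    rw [ev_powLaw_prod μ fun j x => if X x = b j then (1 : ℝ) else 0]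
    simp only [ev_indicator]
  rw [e]
  refine ev_mono hμ.1 fun x => ev_mono (powLaw_mem k hμ).1 fun v => ?_
  by_cases h1 : X x = a
  · by_cases h2 : ∀ j, X (v j) = b j
    · have : (fun j => X (v j)) = b := funext h2
      simp [h1, h2]
    · obtain ⟨j, hj⟩ := not_forall.1 h2
      rw [Finset.prod_eq_zero (Finset.mem_univ j) (by simp [hj])]
      simpa using hF _ _
  · simpa [h1] using hF _ _

theorem mixed_sq_le (a b c d : ℝ) :
    (a - b - c + d) ^ 2 ≤ 4 * (a ^ 2 + b ^ 2 + c ^ 2 + d ^ 2) := by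
  have : 4 * (a ^ 2 + b ^ 2 + c ^ 2 + d ^ 2) - (a - b - c + d) ^ 2 = (a + b) ^ 2 + (a + c) ^ 2 +
    (a - d) ^ 2 + (b - c) ^ 2 + (b + d) ^ 2 + (c + d) ^ 2 := by ring
  have : 0 ≤ 4 * (a ^ 2 + b ^ 2 + c ^ 2 + d ^ 2) - (a - b - c + d) ^ 2 := by rw [this]; positivity
  linarith

/-- The contraction. `MaxCorr.pair` is applied with the first copy against the remaining k+1. Its
gain is bounded below by the variance of g ∘ p, because `Operation.exists_mixed` supplies four
points with a large mixed difference and each has probability at least η^(k+2). -/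
theorem MaxCorr.operation {Ω B : Type*} [Fintype Ω] {q k : ℕ} {μ : Ω → ℝ}
    (hμ : μ ∈ stdSimplex ℝ Ω) {X : Ω → Fin q} {Y : Ω → B} {α η : ℝ} (hα : 0 ≤ α) (hα1 : α ≤ 1)
    (hη : 0 < η) (m : MaxCorr μ X Y α) (hX : ∀ a, push X μ a = 0 ∨ η ≤ push X μ a)
    {p : Operation q (k + 2)} (hc : p.Conservative) (ht : p.TransitiveSymmetric) :
    MaxCorr (powLaw (k + 2) μ) (fun v => p fun j => X (v j)) (fun v j => Y (v j))
      (α - α * (1 - α) * (η ^ (k + 2) / 16)) := by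
  classical
  intro g h
  have hpow := powLaw_mem (k + 2) hμ
  have hpow1 := powLaw_mem (k + 1) hμ
  -- the alive letters
  set S : Finset (Fin q) := Finset.univ.filter fun a => push X μ a ≠ 0 with hS
  have hSη : ∀ a ∈ S, η ≤ push X μ a := fun a ha =>
    (hX a).resolve_left (Finset.mem_filter.1 ha).2
  have hSμ : ∀ x, μ x ≠ 0 → X x ∈ S := by
    intro x hx
    refine Finset.mem_filter.2 ⟨Finset.mem_univ _, fun h0 => hx ?_⟩
    exact (Finset.sum_eq_zero_iff_of_nonneg fun x _ => hμ.1 x).1 h0 x (by simp)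
  have hne : S.Nonempty := by
    by_contra hS0
    rw [Finset.not_nonempty_iff_eq_empty] at hS0
    have : ∀ x, μ x = 0 := fun x => by
      by_contra hx; have := hSμ x hx; rw [hS0] at this; simp at this
    have h1 := hμ.2
    simp [this] at h1
  -- With u and v extremal for g among the letters that occur, the variance of g ∘ p is at most (g u
  -- - g v)².
  obtain ⟨u, hu, hmax⟩ := S.exists_max_image g hne
  obtain ⟨v, hv, hmin⟩ := S.exists_min_image g hne
  obtain ⟨y, y', hy, hy', hmix⟩ := p.exists_mixed hc ht u v
  have hyS : ∀ j, y j ∈ S := fun j => by rcases hy j with h | h <;> rw [h] <;> assumption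
  have hyS' : ∀ j, y' j ∈ S := fun j => by rcases hy' j with h | h <;> rw [h] <;> assumption
  -- variance bound
  have hvar : ev (powLaw (k + 2) μ) (fun v => g (p fun j => X (v j)) ^ 2) -
      ev (powLaw (k + 2) μ) (fun v => g (p fun j => X (v j))) ^ 2 ≤ (g u - g v) ^ 2 := by
    refine (ev_sub_sq_le hpow _ (g v)).trans ((Finset.sum_le_sum fun z _ => ?_).trans
      (ev_const hpow ((g u - g v) ^ 2)).le)
    by_cases hz : powLaw (k + 2) μ z = 0
    · simp [hz]
    · refine mul_le_mul_of_nonneg_left ?_ (hpow.1 z)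
      have : p (fun j => X (z j)) ∈ S := hc.mem_support (S := fun a => a ∈ S) fun j =>
        hSμ _ fun h0 => hz (Finset.prod_eq_zero (Finset.mem_univ j) h0)
      have h1 := hmax _ this
      have h2 := hmin _ this
      exact pow_le_pow_left₀ (by linarith) (by linarith) 2
  have hXc : ∀ x (v : Fin (k + 1) → Ω), (fun j => X ((Fin.cons x v : Fin (k + 2) → Ω) j)) =
      Fin.cons (X x) fun j => X (v j) := by
    intro x v; funext j; refine Fin.cases ?_ (fun j => ?_) j <;> simp
  have hYc : ∀ x (v : Fin (k + 1) → Ω), (fun j => Y ((Fin.cons x v : Fin (k + 2) → Ω) j)) =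
      Fin.cons (Y x) fun j => Y (v j) := by
    intro x v; funext j; refine Fin.cases ?_ (fun j => ?_) j <;> simp
  simp only [ev_powLaw_succ (k + 1), hXc, hYc] at hvar ⊢
  have hpair := MaxCorr.pair hμ hpow1 hα hα1 m (m.power hμ hα hα1 (k + 1))
    (fun a b => g (p (Fin.cons a b))) fun a b => h (Fin.cons a b)
  set G : Fin q → (Fin (k + 1) → Fin q) → ℝ := fun a b => g (p (Fin.cons a b)) with hG
  set Q : Fin q → (Fin (k + 1) → Fin q) → ℝ := fun a b => G a b -
    ev (powLaw (k + 1) μ) (fun v => G a fun j => X (v j)) - ev μ (fun x => G (X x) b) +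
    ev μ (fun x => ev (powLaw (k + 1) μ) fun v => G (X x) fun j => X (v j)) with hQ
  set D := ev μ (fun x => ev (powLaw (k + 1) μ) fun v => Q (X x) (fun j => X (v j)) ^ 2)
    with hD
  have hlow : ∀ a ∈ S, ∀ b : Fin (k + 1) → Fin q, (∀ j, b j ∈ S) → η ^ (k + 2) * Q a b ^ 2 ≤ D := by
    intro a ha b hb
    refine le_trans (mul_le_mul_of_nonneg_right ?_ (sq_nonneg _))
      (push_le_ev hμ X (fun a b => Q a b ^ 2) (fun _ _ => sq_nonneg _) a b)
    rw [pow_succ']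
    refine mul_le_mul (hSη a ha) ?_ (by positivity) (hη.le.trans (hSη a ha))
    calc η ^ (k + 1) = ∏ _j : Fin (k + 1), η := by simp
      _ ≤ _ := Finset.prod_le_prod (fun _ _ => hη.le) fun j _ => hSη _ (hb j)
  -- 16 = 4 · 4: a factor 4 from `mixed_sq_le`, and four points that each contribute at most D.
  have hgap : η ^ (k + 2) / 16 * (g u - g v) ^ 2 ≤ D := by
    have h1 := hlow u hu y hyS
    have h2 := hlow v hv y hyS
    have h3 := hlow u hu y' hyS'
    have h4 := hlow v hv y' hyS'
    -- G and Q differ by functions of a single argument, which cancel in a mixed difference.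
    have e : G u y - G v y - G u y' + G v y' = Q u y - Q v y - Q u y' + Q v y' := by
      simp only [hQ]; ring
    have h5 : (g u - g v) ^ 2 ≤ 4 * (Q u y ^ 2 + Q v y ^ 2 + Q u y' ^ 2 + Q v y' ^ 2) := by
      have := sq_le_sq.2 (hmix g)
      change _ ≤ (G u y - G v y - G u y' + G v y') ^ 2 at this
      rw [e] at this
      exact this.trans (mixed_sq_le _ _ _ _)
    have hη' : 0 < η ^ (k + 2) := by positivity
    have h6 := mul_le_mul_of_nonneg_left h5 hη'.le
    generalize η ^ (k + 2) = t at *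
    linarith
  have hDv := (mul_le_mul_of_nonneg_left hvar (by positivity : 0 ≤ η ^ (k + 2) / 16)).trans hgap
  have := mul_le_mul_of_nonneg_left hDv (mul_nonneg hα (sub_nonneg.2 hα1))
  refine hpair.trans ?_
  change _ - α * (1 - α) * D ≤ _
  linarith

/-! ### Marginals, operations on laws, and removal of rare letters -/

theorem powLaw_push {Ω Ω' : Type*} [Fintype Ω] [DecidableEq Ω'] {k : ℕ}
    (X : Ω → Ω') (μ : Ω → ℝ) :
    powLaw k (push X μ) = push (fun v j => X (v j)) (powLaw k μ) := by
  funext b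
  rw [← ev_indicator, powLaw]
  simp only [← ev_indicator X μ]
  rw [← ev_powLaw_prod μ fun j x => if X x = b j then (1 : ℝ) else 0]
  congr 1; funext v
  rw [Finset.prod_ite_zero]
  simp [funext_iff]

/-! ### Merging rare letters into a heavy letter -/

section Kill

variable {q : ℕ}

/-- The law of `p` at independent inputs with law `v`. -/
def opRow {k : ℕ} (p : Operation q k) (v : Fin q → ℝ) : Fin q → ℝ := push p (powLaw k v)

/-- The letter `a` is the first one with weight at least `1 / (q + 1)`. -/
def FirstHeavy (v : Fin q → ℝ) (a : Fin q) : Prop :=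
  1 / ((q : ℝ) + 1) ≤ v a ∧ ∀ b < a, v b < 1 / ((q : ℝ) + 1)

/-- Total weight of the letters with weight below `η`. -/
def lightMass (η : ℝ) (v : Fin q → ℝ) : ℝ := ∑ a, if v a < η then v a else 0

open Classical in
/-- Move the weight of the letters with weight below `η` to the first heavy letter. -/
def killRow (η : ℝ) (v : Fin q → ℝ) : Fin q → ℝ := fun a =>
  (if v a < η then 0 else v a) + if FirstHeavy v a then lightMass η v else 0

/-- Number of letters of nonzero weight. -/
def nz (v : Fin q → ℝ) : ℕ := (Finset.univ.filter fun a => v a ≠ 0).card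

theorem exists_firstHeavy {v : Fin q → ℝ} (hv : v ∈ stdSimplex ℝ (Fin q)) :
    ∃ a, FirstHeavy v a := by
  classical
  have hne : (Finset.univ.filter fun a => 1 / ((q : ℝ) + 1) ≤ v a).Nonempty := by
    by_contra h
    rw [Finset.not_nonempty_iff_eq_empty, Finset.filter_eq_empty_iff] at h
    have h1 : ∑ a, v a ≤ ∑ _a : Fin q, 1 / ((q : ℝ) + 1) :=
      Finset.sum_le_sum fun a ha => (not_le.1 (h ha)).le
    rw [hv.2] at h1
    have : (0 : ℝ) < q + 1 := by positivity
    simp only [Finset.sum_const, Finset.card_univ, Fintype.card_fin, nsmul_eq_mul] at h1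
    rw [mul_one_div, le_div_iff₀ this] at h1
    linarith
  refine ⟨Finset.min' _ hne, (Finset.mem_filter.1 (Finset.min'_mem _ hne)).2, fun b hb => ?_⟩
  by_contra h
  exact absurd (Finset.min'_le _ b (by simpa using h)) (not_le.2 hb)

theorem FirstHeavy.unique {v : Fin q → ℝ} {a b : Fin q} (ha : FirstHeavy v a)
    (hb : FirstHeavy v b) : a = b := by
  rcases lt_trichotomy a b with h | h | h
  · exact absurd ha.1 (not_le.2 (hb.2 a h))
  · exact h
  · exact absurd hb.1 (not_le.2 (ha.2 b h))

variable {η : ℝ}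

/-- Moving mass from light letters to one heavy letter is a deterministic relabelling. It can
therefore be applied to whole assignments, and it does not increase correlation. -/
theorem exists_killMap {v : Fin q → ℝ}
    (hv : v ∈ stdSimplex ℝ (Fin q)) :
    ∃ φ : Fin q → Fin q, (∀ a, φ a ≠ a → v a < η) ∧ killRow η v = push φ v := by
  classical
  obtain ⟨b, hb⟩ := exists_firstHeavy hv
  refine ⟨fun a => if v a < η then b else a, fun a ha => ?_, ?_⟩
  · by_contra h; simp [h] at ha
  · funext a
    have hfb : FirstHeavy v a ↔ b = a := ⟨fun h => hb.unique h, fun h => h ▸ hb⟩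
    simp only [killRow, push, lightMass, hfb, Finset.sum_filter]
    have e : ∀ c, (if (if v c < η then b else c) = a then v c else 0) =
        (if c = a then (if v a < η then 0 else v a) else 0) +
          if b = a then (if v c < η then v c else 0) else 0 := by
      intro c
      by_cases h3 : c = a
      · subst h3
        by_cases h1 : v c < η <;> simp [h1]
      · by_cases h1 : v c < η <;> simp [h1, h3]
    simp only [e, Finset.sum_add_distrib, Finset.sum_ite_eq', Finset.mem_univ, if_true]
    split_ifs <;> simp

theorem killRow_mem {v : Fin q → ℝ}
    (hv : v ∈ stdSimplex ℝ (Fin q)) : killRow η v ∈ stdSimplex ℝ (Fin q) := by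
  obtain ⟨φ, -, h⟩ := exists_killMap (η := η) hv
  rw [h]; exact push_mem φ hv

theorem lightMass_nonneg {v : Fin q → ℝ} (hv : v ∈ stdSimplex ℝ (Fin q)) : 0 ≤ lightMass η v :=
  Finset.sum_nonneg fun a _ => by split_ifs; exacts [hv.1 a, le_rfl]

/-- Since η ≤ 1/(q+1), the letter that receives the mass is not itself light. The resulting gap
between 0 and η is the hypothesis that the contraction needs. -/
theorem killRow_gap (hη : η ≤ 1 / ((q : ℝ) + 1)) {v : Fin q → ℝ}
    (hv : v ∈ stdSimplex ℝ (Fin q)) (a : Fin q) :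
    (killRow η v a = 0 ∧ v a < η) ∨ (η ≤ killRow η v a ∧ η ≤ v a) := by
  have h0 := lightMass_nonneg (η := η) hv
  rcases lt_or_ge (v a) η with h | h
  · left
    have : ¬ FirstHeavy v a := fun hf => absurd hf.1 (not_le.2 (h.trans_le hη))
    simp [killRow, h, this]
  · right
    refine ⟨?_, h⟩
    simp only [killRow, if_neg (not_lt.2 h)]
    split_ifs <;> linarith

/-- Each light letter of nonzero weight brings mass below η and disappears from the support.
Charging the mass to lost letters makes the total cost telescope along the walk. -/
theorem lightMass_le (hη0 : 0 < η) (hη : η ≤ 1 / ((q : ℝ) + 1)) {v : Fin q → ℝ}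
    (hv : v ∈ stdSimplex ℝ (Fin q)) : lightMass η v ≤ η * (nz v - nz (killRow η v)) := by
  classical
  have h1 : nz (killRow η v) + (Finset.univ.filter fun a => v a ≠ 0 ∧ v a < η).card ≤ nz v := by
    rw [nz, nz, ← Finset.card_union_of_disjoint]
    · refine Finset.card_le_card fun a ha => ?_
      simp only [Finset.mem_union, Finset.mem_filter, Finset.mem_univ, true_and] at ha ⊢
      rcases ha with ha | ha
      · rcases killRow_gap hη hv a with h | h
        · exact absurd h.1 ha
        · linarith [h.2]
      · exact ha.1
    · rw [Finset.disjoint_left]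
      intro a ha hb
      simp only [Finset.mem_filter, Finset.mem_univ, true_and] at ha hb
      rcases killRow_gap hη hv a with h | h
      · exact ha h.1
      · linarith [h.2, hb.2]
  have h2 : lightMass η v ≤ η * (Finset.univ.filter fun a => v a ≠ 0 ∧ v a < η).card := by
    rw [mul_comm, ← nsmul_eq_mul, ← Finset.sum_const, Finset.sum_filter, lightMass]
    refine Finset.sum_le_sum fun a _ => ?_
    by_cases h : v a < η <;> by_cases h0 : v a = 0 <;> simp [h, h0]
    exact h.le
  refine h2.trans (mul_le_mul_of_nonneg_left ?_ hη0.le)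
  have : (nz (killRow η v) : ℝ) + (Finset.univ.filter fun a => v a ≠ 0 ∧ v a < η).card ≤ nz v := by
    exact_mod_cast h1
  linarith

theorem nz_killRow_le (hη0 : 0 < η) (hη : η ≤ 1 / ((q : ℝ) + 1)) {v : Fin q → ℝ}
    (hv : v ∈ stdSimplex ℝ (Fin q)) : (nz (killRow η v) : ℝ) ≤ nz v := by
  have := (lightMass_nonneg hv).trans (lightMass_le hη0 hη hv)
  nlinarith

theorem opRow_mem {k : ℕ} (p : Operation q k) {v : Fin q → ℝ} (hv : v ∈ stdSimplex ℝ (Fin q)) :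
    opRow p v ∈ stdSimplex ℝ (Fin q) := push_mem _ (powLaw_mem k hv)

/-- A conservative operation outputs only letters present among its inputs, so supports never grow.
-/
theorem nz_opRow_le {k : ℕ} {p : Operation q k} (hc : p.Conservative) (v : Fin q → ℝ) :
    nz (opRow p v) ≤ nz v := by
  refine Finset.card_le_card fun a ha => ?_
  simp only [Finset.mem_filter, Finset.mem_univ, true_and] at ha ⊢
  intro h0
  refine ha (Finset.sum_eq_zero fun x hx => ?_)
  obtain ⟨j, hj⟩ := hc x
  refine Finset.prod_eq_zero (Finset.mem_univ j) ?_
  rw [← hj, (Finset.mem_filter.1 hx).2, h0]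

end Kill

/-! ### Laws on assignments under operations and merging -/

section Assignments

variable {q n : ℕ}

/-- The marginals of a law on assignments. -/
def marg (μ : (Fin n → Fin q) → ℝ) : Fin n → Fin q → ℝ := fun i => push (fun x => x i) μ

theorem mem_couplings {μ : (Fin n → Fin q) → ℝ} {w : Fin n → Fin q → ℝ} :
    μ ∈ couplings w ↔ μ ∈ stdSimplex ℝ (Fin n → Fin q) ∧ marg μ = w := by
  simp only [couplings, Set.mem_ofPred_eq, funext_iff]
  rfl

theorem marg_mem {μ : (Fin n → Fin q) → ℝ} (hμ : μ ∈ stdSimplex ℝ (Fin n → Fin q)) (i : Fin n) :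
    marg μ i ∈ stdSimplex ℝ (Fin q) := push_mem _ hμ

theorem ev_marg (μ : (Fin n → Fin q) → ℝ) (i : Fin n) (F : Fin q → ℝ) :
    ev (marg μ i) F = ev μ fun x => F (x i) := ev_push _ _ _

theorem push_push {Ω Ω' Ω'' : Type*} [Fintype Ω] [Fintype Ω'] [DecidableEq Ω'] [DecidableEq Ω'']
    (S : Ω' → Ω'') (T : Ω → Ω') (μ : Ω → ℝ) : push S (push T μ) = push (fun x => S (T x)) μ := by
  funext y
  rw [← ev_indicator, ev_push, ev_indicator (fun x => S (T x))]

/-- The law of the coordinatewise application of `p` to independent samples. -/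
def opLaw {k : ℕ} (p : Operation q k) (μ : (Fin n → Fin q) → ℝ) : (Fin n → Fin q) → ℝ :=
  push p.apply (powLaw k μ)

/-- Operations act coordinatewise, so the marginals evolve autonomously. The algorithm can follow
them exactly although the joint law is never available to it. -/
theorem marg_opLaw {k : ℕ} (p : Operation q k) (μ : (Fin n → Fin q) → ℝ) (i : Fin n) :
    marg (opLaw p μ) i = opRow p (marg μ i) := by
  rw [marg, opLaw, push_push, opRow, marg, powLaw_push, push_push]
  rfl

theorem opLaw_mem {k : ℕ} (p : Operation q k) {μ : (Fin n → Fin q) → ℝ}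
    (hμ : μ ∈ stdSimplex ℝ (Fin n → Fin q)) : opLaw p μ ∈ stdSimplex ℝ (Fin n → Fin q) :=
  push_mem _ (powLaw_mem k hμ)

/-- Every coordinate has squared maximal correlation at most `α` with the remaining ones. -/
def RestCorr (μ : (Fin n → Fin q) → ℝ) (α : ℝ) : Prop :=
  ∀ i : Fin n, MaxCorr μ (fun x => x i) (fun x (j : {j // j ≠ i}) => x j) α

theorem RestCorr.map {μ : (Fin n → Fin q) → ℝ} {α : ℝ} (h : RestCorr μ α)
    (φ : Fin n → Fin q → Fin q) : RestCorr (push (fun x i => φ i (x i)) μ) α :=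
  fun i => MaxCorr.of_push ((h i).comp (φ i)
    fun (y : {j // j ≠ i} → Fin q) (j : {j // j ≠ i}) => φ j (y j))

/-- The other output coordinates are a function of the k+2 copies of the other input coordinates, so
data processing reduces this to `MaxCorr.operation`. -/
theorem RestCorr.opLaw {μ : (Fin n → Fin q) → ℝ} (hμ : μ ∈ stdSimplex ℝ (Fin n → Fin q))
    {α η : ℝ} (h : RestCorr μ α) (hα : 0 ≤ α) (hα1 : α ≤ 1) (hη : 0 < η)
    (hgap : ∀ i a, marg μ i a = 0 ∨ η ≤ marg μ i a) {k : ℕ} {p : Operation q (k + 2)}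
    (hc : p.Conservative) (ht : p.TransitiveSymmetric) :
    RestCorr (opLaw p μ) (α - α * (1 - α) * (η ^ (k + 2) / 16)) := by
  intro i
  refine MaxCorr.of_push ?_
  exact ((h i).operation hμ hα hα1 hη (hgap i) hc ht).comp (fun a => a)
    fun (u : Fin (k + 2) → {j // j ≠ i} → Fin q) j' => p fun j => u j j'

/-- Either the relabelling changes nothing, or at least one coordinate carries a light letter, and
then 2B pays for any change of f. -/
theorem le_add_card_light {η B : ℝ} {w : Fin n → Fin q → ℝ} {f : (Fin n → Fin q) → ℝ}
    (hf : ∀ x, |f x| ≤ B) {φ : Fin n → Fin q → Fin q} (hφ : ∀ i a, φ i a ≠ a → w i a < η)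
    (x : Fin n → Fin q) : f (fun i => φ i (x i)) ≤
      f x + 2 * B * ∑ i, if w i (x i) < η then 1 else 0 := by
  have hB : 0 ≤ B := (abs_nonneg _).trans (hf x)
  have h0 : ∀ i, (0 : ℝ) ≤ if w i (x i) < η then 1 else 0 := fun i => by split_ifs <;> norm_num
  have h1 : (0 : ℝ) ≤ ∑ i, if w i (x i) < η then 1 else 0 := Finset.sum_nonneg fun i _ => h0 i
  by_cases hx : ∀ i, φ i (x i) = x i
  · rw [funext hx]
    exact le_add_of_nonneg_right (by positivity)
  · obtain ⟨i, hi⟩ := not_forall.1 hx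
    have h2 : (1 : ℝ) ≤ ∑ i, if w i (x i) < η then 1 else 0 := by
      refine le_trans ?_ (Finset.single_le_sum (f := fun i => if w i (x i) < η then (1 : ℝ) else 0)
        (fun i _ => h0 i) (Finset.mem_univ i))
      simp [hφ i (x i) hi]
    have h3 := (abs_le.1 (hf fun i => φ i (x i))).2
    have h4 := (abs_le.1 (hf x)).1
    have := mul_le_mul_of_nonneg_left h2 hB
    linarith

/-- The expected number of light letters in a random assignment is the sum of the light masses of
the rows, hence bounded by the number of letters lost. -/
theorem exists_killLaw {η B : ℝ} (hη0 : 0 < η) (hη : η ≤ 1 / ((q : ℝ) + 1))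
    {μ : (Fin n → Fin q) → ℝ} (hμ : μ ∈ stdSimplex ℝ (Fin n → Fin q)) {f : (Fin n → Fin q) → ℝ}
    (hf : ∀ x, |f x| ≤ B) :
    ∃ μ' ∈ stdSimplex ℝ (Fin n → Fin q), (∀ i, marg μ' i = killRow η (marg μ i)) ∧
      (∀ α, RestCorr μ α → RestCorr μ' α) ∧
      ev μ' f ≤ ev μ f + 2 * B * (η * ∑ i, ((nz (marg μ i) : ℝ) - nz (marg μ' i))) := by
  choose φ hφ hφ' using fun i => exists_killMap (η := η) (marg_mem hμ i)
  have hm : ∀ i, marg (push (fun x i => φ i (x i)) μ) i = killRow η (marg μ i) := by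
    intro i
    rw [hφ' i, marg, push_push, marg, push_push]
  have hmem : push (fun x i => φ i (x i)) μ ∈ stdSimplex ℝ (Fin n → Fin q) := push_mem _ hμ
  have hev : ev (push (fun x i => φ i (x i)) μ) f ≤
      ev μ f + 2 * B * ∑ i, lightMass η (marg μ i) := by
    rw [ev_push]
    refine (ev_mono hμ.1 fun x => le_add_card_light hf hφ x).trans (le_of_eq ?_)
    rw [ev_add, ev_const_mul, ev_sum]
    congr 2
    refine Finset.sum_congr rfl fun i _ => ?_
    rw [← ev_marg μ i fun a => if marg μ i a < η then (1 : ℝ) else 0]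
    simp only [ev, lightMass, mul_ite, mul_one, mul_zero]
  have hcorr : ∀ α, RestCorr μ α → RestCorr (push (fun x i => φ i (x i)) μ) α := fun α h => h.map φ
  generalize push (fun x i => φ i (x i)) μ = μ' at hm hmem hev hcorr
  refine ⟨μ', hmem, hm, hcorr, hev.trans (add_le_add le_rfl ?_)⟩
  -- With no assignments at all B could be negative, but then no probability law exists.
  have hB : 0 ≤ B := by
    rcases isEmpty_or_nonempty (Fin n → Fin q) with he | ⟨⟨x⟩⟩
    · have h1 := hμ.2; simp at h1
    · exact (abs_nonneg _).trans (hf x)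
  refine mul_le_mul_of_nonneg_left ?_ (by linarith)
  rw [Finset.mul_sum]
  refine Finset.sum_le_sum fun i _ => ?_
  rw [hm i]
  exact lightMass_le hη0 hη (marg_mem hμ i)

/-! ### Product laws and averaging of one coordinate -/

/-- The product law with marginals `w`. -/
def prodLaw (w : Fin n → Fin q → ℝ) : (Fin n → Fin q) → ℝ := fun x => ∏ i, w i (x i)

theorem prodLaw_mem {w : Fin n → Fin q → ℝ} (hw : ∀ i, w i ∈ stdSimplex ℝ (Fin q)) :
    prodLaw w ∈ stdSimplex ℝ (Fin n → Fin q) := by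
  refine ⟨fun x => Finset.prod_nonneg fun i _ => (hw i).1 _, ?_⟩
  simp only [prodLaw]
  rw [← Fintype.prod_sum]
  exact Finset.prod_eq_one fun i _ => (hw i).2

/-- Average of `f` over the `i`-th coordinate. -/
def avg (w : Fin n → Fin q → ℝ) (i : Fin n) (f : (Fin n → Fin q) → ℝ) : (Fin n → Fin q) → ℝ :=
  fun x => ev (w i) fun a => f (Function.update x i a)

/-- Average of `f` over the coordinates in a list. -/
def avgs (w : Fin n → Fin q → ℝ) (l : List (Fin n)) (f : (Fin n → Fin q) → ℝ) :
    (Fin n → Fin q) → ℝ := l.foldr (avg w) f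

/-- Exchanging the i-th letter with a fresh independent one is an involution that preserves the
joint weight. -/
theorem ev_prodLaw_avg {w : Fin n → Fin q → ℝ} (hw : ∀ i, w i ∈ stdSimplex ℝ (Fin q)) (i : Fin n)
    (f : (Fin n → Fin q) → ℝ) : ev (prodLaw w) (avg w i f) = ev (prodLaw w) f := by
  classical
  let e : (Fin n → Fin q) × Fin q ≃ (Fin n → Fin q) × Fin q :=
    { toFun := fun z => (Function.update z.1 i z.2, z.1 i)
      invFun := fun z => (Function.update z.1 i z.2, z.1 i)
      left_inv := fun z => by simp
      right_inv := fun z => by simp }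
  have h1 : ev (prodLaw w) (avg w i f) =
      ∑ z : (Fin n → Fin q) × Fin q, prodLaw w z.1 * w i z.2 * f (Function.update z.1 i z.2) := by
    rw [Fintype.sum_prod_type]
    simp only [ev, avg, Finset.mul_sum, mul_assoc]
  have h2 : ev (prodLaw w) f =
      ∑ z : (Fin n → Fin q) × Fin q, prodLaw w z.1 * w i z.2 * f z.1 := by
    rw [Fintype.sum_prod_type]
    refine Finset.sum_congr rfl fun x _ => ?_
    simp only [mul_right_comm _ _ (f x), ← Finset.mul_sum, (hw i).2, mul_one]
  rw [h1, h2, ← e.sum_comp]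
  refine Finset.sum_congr rfl fun z _ => ?_
  obtain ⟨x, a⟩ := z
  have h3 : prodLaw w (Function.update x i a) * w i (x i) = prodLaw w x * w i a := by
    simp only [prodLaw]
    rw [← Finset.mul_prod_erase _ _ (Finset.mem_univ i), ← Finset.mul_prod_erase (a := i)
      Finset.univ (fun j => w j (x j)) (Finset.mem_univ i)]
    have : ∀ j ∈ Finset.univ.erase i, w j (Function.update x i a j) = w j (x j) := fun j hj => by
      rw [Function.update_of_ne (Finset.ne_of_mem_erase hj)]
    rw [Finset.prod_congr rfl this, Function.update_self]; ring
  simp only [e, Equiv.coe_fn_mk, Function.update_idem, Function.update_eq_self]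
  rw [h3]

theorem marg_prodLaw {w : Fin n → Fin q → ℝ} (hw : ∀ i, w i ∈ stdSimplex ℝ (Fin q)) :
    marg (prodLaw w) = w := by
  classical
  funext i a
  rw [marg, ← ev_indicator, ← ev_prodLaw_avg hw i]
  have : avg w i (fun x => if x i = a then 1 else 0) = fun _ => w i a := by
    funext x; simp [avg, ev]
  rw [this, ev_const (prodLaw_mem hw)]

theorem avg_le {w : Fin n → Fin q → ℝ} (hw : ∀ i, w i ∈ stdSimplex ℝ (Fin q)) {B : ℝ}
    {f : (Fin n → Fin q) → ℝ} (hf : ∀ x, |f x| ≤ B) (i : Fin n) (x : Fin n → Fin q) :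
    |avg w i f x| ≤ B :=
  abs_le.2 ⟨le_ev_of_le (hw i) fun _ => (abs_le.1 (hf _)).1,
    ev_le_of_le (hw i) fun _ => (abs_le.1 (hf _)).2⟩

theorem avgs_le {w : Fin n → Fin q → ℝ} (hw : ∀ i, w i ∈ stdSimplex ℝ (Fin q)) {B : ℝ}
    {f : (Fin n → Fin q) → ℝ} (hf : ∀ x, |f x| ≤ B) (l : List (Fin n)) (x : Fin n → Fin q) :
    |avgs w l f x| ≤ B := by
  induction l generalizing x with
  | nil => exact hf x
  | cons i l ih => exact avg_le hw ih i x

theorem ev_prodLaw_avgs {w : Fin n → Fin q → ℝ} (hw : ∀ i, w i ∈ stdSimplex ℝ (Fin q))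
    (l : List (Fin n)) (f : (Fin n → Fin q) → ℝ) : ev (prodLaw w) (avgs w l f) = ev (prodLaw w) f := by
  induction l with
  | nil => rfl
  | cons i l ih => rw [avgs, List.foldr_cons, ev_prodLaw_avg hw]; exact ih

theorem avgs_update {w : Fin n → Fin q → ℝ} (l : List (Fin n)) (f : (Fin n → Fin q) → ℝ) {i : Fin n}
    (hi : i ∈ l) (x : Fin n → Fin q) (a : Fin q) :
    avgs w l f (Function.update x i a) = avgs w l f x := by
  induction l generalizing x with
  | nil => simp at hi
  | cons j l ih =>
    simp only [avgs, List.foldr_cons, avg]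
    congr 1; funext b
    by_cases hij : i = j
    · subst hij; rw [Function.update_idem]
    · rw [Function.update_comm hij]
      exact ih ((List.mem_cons.1 hi).resolve_left hij) _

/-- Once every coordinate has been averaged, the function no longer depends on any coordinate. It is
constant, and averaging has preserved its mean. -/
theorem avgs_finRange {w : Fin n → Fin q → ℝ} (hw : ∀ i, w i ∈ stdSimplex ℝ (Fin q))
    (f : (Fin n → Fin q) → ℝ) (x : Fin n → Fin q) :
    avgs w (List.finRange n) f x = ev (prodLaw w) f := by
  classical
  have hc : ∀ y, avgs w (List.finRange n) f y = avgs w (List.finRange n) f x := by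
    intro y
    have : ∀ S : Finset (Fin n), avgs w (List.finRange n) f (S.piecewise y x) =
        avgs w (List.finRange n) f x := by
      intro S
      induction S using Finset.induction_on with
      | empty => simp
      | insert j S _ ih =>
        rw [Finset.piecewise_insert, avgs_update _ _ (List.mem_finRange j), ih]
    simpa using this Finset.univ
  rw [← ev_prodLaw_avgs hw (List.finRange n), funext hc, ev_const (prodLaw_mem hw)]

/-! ### Comparing a weakly correlated law with the product of its marginals -/

/-- Scaling h by √α / b balances the two terms of the linearised inequality and recovers the usual
covariance bound. -/
theorem MaxCorr.ev_mul_le {Ω A B : Type*} [Fintype Ω] {μ : Ω → ℝ} (hμ : μ ∈ stdSimplex ℝ Ω)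
    {X : Ω → A} {Y : Ω → B} {α : ℝ} (hα : 0 < α) (m : MaxCorr μ X Y α) {g : A → ℝ} {h : B → ℝ}
    {b : ℝ} (hg0 : ev μ (fun x => g (X x)) = 0) (hg : ∀ a, |g a| ≤ 1) (hh : ∀ y, |h y| ≤ b)
    (hb : 0 < b) : ev μ (fun x => g (X x) * h (Y x)) ≤ √α * b := by
  have hs : 0 < √α := Real.sqrt_pos.2 hα
  have := m g fun y => (√α / b) * h y
  have e1 : ∀ x, g (X x) * (√α / b * h (Y x)) = √α / b * (g (X x) * h (Y x)) := fun x => by ring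
  simp only [e1, ev_const_mul, hg0] at this
  have h1 : ev μ (fun x => (√α / b * h (Y x)) ^ 2) ≤ α := by
    refine ev_le_of_le hμ fun x => ?_
    rw [mul_pow, div_pow, Real.sq_sqrt hα.le]
    have : h (Y x) ^ 2 ≤ b ^ 2 := sq_le_sq.2 ((hh _).trans (le_abs_self b))
    rw [div_mul_eq_mul_div, div_le_iff₀ (by positivity)]
    exact mul_le_mul_of_nonneg_left this hα.le
  have h2 : ev μ (fun x => g (X x) ^ 2) ≤ 1 := by
    refine ev_le_of_le hμ fun x => ?_
    rw [← sq_abs]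
    exact pow_le_one₀ (abs_nonneg _) (hg _)
  have h3 : √α / b * ev μ (fun x => g (X x) * h (Y x)) ≤ α := by nlinarith
  rw [div_mul_eq_mul_div, div_le_iff₀ hb] at h3
  have h4 : √α * √α = α := Real.mul_self_sqrt hα.le
  refine le_of_mul_le_mul_left (a := √α) ?_ hs
  nlinarith

/-- The change caused by resampling coordinate i is a sum over the q letters a. Each term is a
mean-zero function of x i times a function of the other coordinates, a covariance controlled by √α.
-/
theorem RestCorr.ev_avg_le {μ : (Fin n → Fin q) → ℝ} (hμ : μ ∈ stdSimplex ℝ (Fin n → Fin q)) {α : ℝ}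
    (hα : 0 < α) (h : RestCorr μ α) {f : (Fin n → Fin q) → ℝ} {B : ℝ} (hB : 0 < B)
    (hf : ∀ x, |f x| ≤ B) (i : Fin n) : ev μ (avg (marg μ) i f) ≤ ev μ f + q * (√α * B) := by
  classical
  have e : ∀ x, avg (marg μ) i f x = f x +
      ∑ a, (marg μ i a - if x i = a then 1 else 0) * f (Function.update x i a) := by
    intro x
    simp only [sub_mul, Finset.sum_sub_distrib, ite_mul, one_mul, zero_mul, Finset.sum_ite_eq,
      Finset.mem_univ, if_true, Function.update_eq_self, avg, ev]
    ring
  rw [funext e, ev_add, ev_sum]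
  refine add_le_add le_rfl ?_
  have : ∀ a : Fin q, ev μ (fun x => (marg μ i a - if x i = a then 1 else 0) *
      f (Function.update x i a)) ≤ √α * B := by
    intro a
    have hm := marg_mem hμ i
    have := (h i).ev_mul_le hμ hα (g := fun c => marg μ i a - if c = a then 1 else 0)
      (h := fun y => f fun j => if hj : j = i then a else y ⟨j, hj⟩) (b := B) ?_ ?_
      (fun y => hf _) hB
    · convert this using 4 with x
      congr 1; funext j
      by_cases hj : j = i
      · subst hj; simp
      · simp [hj]
    · rw [ev_sub, ev_const hμ, ev_indicator]; exact sub_self _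
    · intro c
      have h0 := hm.1 a
      have h1 : marg μ i a ≤ 1 := by
        rw [← hm.2]; exact Finset.single_le_sum (fun a _ => hm.1 a) (Finset.mem_univ a)
      rw [abs_le]; split_ifs <;> constructor <;> linarith
  refine (Finset.sum_le_sum fun a _ => this a).trans (le_of_eq ?_)
  simp

/-- A hybrid argument under the fixed law μ: the coordinates of f are averaged one at a time. The
averaged functions stay bounded by B, so the same correlation bound serves at all n stages. -/
theorem RestCorr.ev_prodLaw_le {μ : (Fin n → Fin q) → ℝ} (hμ : μ ∈ stdSimplex ℝ (Fin n → Fin q))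
    {α : ℝ} (hα : 0 < α) (h : RestCorr μ α) {f : (Fin n → Fin q) → ℝ} {B : ℝ} (hB : 0 ≤ B)
    (hf : ∀ x, |f x| ≤ B) : ev (prodLaw (marg μ)) f ≤ ev μ f + n * (q * (√α * B)) := by
  rcases hB.eq_or_lt with rfl | hB
  · have : f = fun _ => 0 := funext fun x => abs_eq_zero.1 (le_antisymm (hf x) (abs_nonneg _))
    simp [this, ev]
  have key : ∀ l : List (Fin n), ev μ (avgs (marg μ) l f) ≤ ev μ f + l.length * (q * (√α * B)) := by
    intro l
    induction l with
    | nil => simp [avgs]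
    | cons i l ih =>
      have := h.ev_avg_le hμ hα hB (avgs_le (marg_mem hμ) hf l) i
      rw [avgs, List.foldr_cons, List.length_cons]
      push_cast
      refine (this.trans (add_le_add ih le_rfl)).trans (le_of_eq (by ring))
  have := key (List.finRange n)
  rw [funext (avgs_finRange (marg_mem hμ) f), ev_const hμ, List.length_finRange] at this
  exact this

end Assignments

/-! ### The expected value along a random path of operations -/

section Dynamics

variable {q n k : ℕ}

/-- A letter absent from the inputs is output with probability 0, so no operation in the support can
output it. -/
theorem IsMeasurePreserving.conservative {P : Operation q k → ℝ} (hm : IsMeasurePreserving P)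
    (h0 : ∀ p, 0 ≤ P p) {p : Operation q k} (hp : P p ≠ 0) : p.Conservative := by
  intro x
  by_contra! hne
  have h := hm x (p x)
  rw [Finset.filter_false_of_mem fun j _ => (hne j).symm, Finset.card_empty, Nat.cast_zero,
    zero_div] at h
  exact hp ((Finset.sum_eq_zero_iff_of_nonneg fun p _ => h0 p).1 h p (by simp))

/-- The martingale property of the rows: given the inputs, the output is distributed like a
uniformly chosen input. -/
theorem IsMeasurePreserving.sum_opRow {P : Operation q k → ℝ} (hm : IsMeasurePreserving P)
    (hk : k ≠ 0) {v : Fin q → ℝ} (hv : v ∈ stdSimplex ℝ (Fin q)) (a : Fin q) :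
    ∑ p, P p * opRow p v a = v a := by
  have e : ∀ x : Fin k → Fin q, ∑ p, P p * (if p x = a then 1 else 0) =
      (1 / k : ℝ) * ∑ j, if x j = a then 1 else 0 := by
    intro x
    have := hm x a
    rw [Finset.sum_filter] at this
    simp only [mul_ite, mul_one, mul_zero, this, Finset.sum_boole]
    ring
  have h1 : ∀ p : Operation q k, P p * opRow p v a =
      ev (powLaw k v) fun x => P p * if p x = a then 1 else 0 := by
    intro p; rw [ev_const_mul, ev_indicator, opRow]
  simp only [h1]
  rw [← ev_sum, funext e, ev_const_mul, ev_sum]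
  have h2 : ∀ j : Fin k, ev (powLaw k v) (fun x => if x j = a then 1 else 0) = v a := by
    intro j
    rw [ev_powLaw_apply hv j fun b => if b = a then (1 : ℝ) else 0]
    simp [ev]
  simp only [h2, Finset.sum_const, Finset.card_univ, Fintype.card_fin, nsmul_eq_mul]
  have : (k : ℝ) ≠ 0 := by exact_mod_cast hk
  field_simp

/-- Remove the rare letters, then apply `p`, in every row. -/
def stepMarg (η : ℝ) (p : Operation q k) (w : Fin n → Fin q → ℝ) : Fin n → Fin q → ℝ :=
  fun i => opRow p (killRow η (w i))

/-- Expectation of `F` after `t` random steps. -/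
def val (P : Operation q k → ℝ) (η : ℝ) (F : (Fin n → Fin q → ℝ) → ℝ) :
    ℕ → (Fin n → Fin q → ℝ) → ℝ
  | 0, w => F w
  | t + 1, w => ∑ p, P p * val P η F t (stepMarg η p w)

/-- Number of nonzero entries. -/
def nzs (w : Fin n → Fin q → ℝ) : ℝ := ∑ i, (nz (w i) : ℝ)

theorem stepMarg_mem {η : ℝ} (p : Operation q k) {w : Fin n → Fin q → ℝ}
    (hw : ∀ i, w i ∈ stdSimplex ℝ (Fin q)) (i : Fin n) : stepMarg η p w i ∈ stdSimplex ℝ (Fin q) :=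
  opRow_mem p (killRow_mem (hw i))

theorem nzs_nonneg (w : Fin n → Fin q → ℝ) : 0 ≤ nzs w := Finset.sum_nonneg fun _ _ => by positivity

theorem nzs_le (w : Fin n → Fin q → ℝ) : nzs w ≤ n * q := by
  refine (Finset.sum_le_sum fun i _ => Nat.cast_le.2 ((Finset.card_le_univ _).trans
    (Fintype.card_fin q).le)).trans (le_of_eq ?_)
  simp

theorem nzs_opRow_le {p : Operation q k} (hc : p.Conservative) (w : Fin n → Fin q → ℝ) :
    nzs (fun i => opRow p (w i)) ≤ nzs w :=
  Finset.sum_le_sum fun i _ => Nat.cast_le.2 (nz_opRow_le hc (w i))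

/-- The polymorphism inequality averaged over k independent samples, each of which has law μ. -/
theorem sum_ev_opLaw_le {P : Operation q k → ℝ} {f : (Fin n → Fin q) → ℝ} (hk : k ≠ 0)
    (hP : IsFractionalPolymorphism P f) {μ : (Fin n → Fin q) → ℝ}
    (hμ : μ ∈ stdSimplex ℝ (Fin n → Fin q)) : ∑ p, P p * ev (opLaw p μ) f ≤ ev μ f := by
  simp only [opLaw, ev_push, ← ev_const_mul]
  rw [← ev_sum]
  refine (ev_mono (powLaw_mem k hμ).1 hP.2).trans (le_of_eq ?_)
  rw [ev_const_mul, ev_sum]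
  simp only [ev_powLaw_apply hμ _ f, Finset.sum_const, Finset.card_univ, Fintype.card_fin,
    nsmul_eq_mul]
  have : (k : ℝ) ≠ 0 := by exact_mod_cast hk
  field_simp

/-- Induction on the number of steps with two potentials: the count of nonzero weights pays for
merging, and α records the correlation still left. The law μ exists only in the analysis. -/
theorem val_le {P : Operation q (k + 2) → ℝ} {f : (Fin n → Fin q) → ℝ}
    (hP : IsFractionalPolymorphism P f) (ht : IsTransitiveSymmetric P) (hm : IsMeasurePreserving P)
    {η δ B : ℝ} (hη0 : 0 < η) (hη : η ≤ 1 / ((q : ℝ) + 1)) (hδ : 0 < δ) (hB : 0 ≤ B)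
    (hf : ∀ x, |f x| ≤ B) (t : ℕ) {μ : (Fin n → Fin q) → ℝ}
    (hμ : μ ∈ stdSimplex ℝ (Fin n → Fin q)) {α : ℝ} (hα : 0 < α) (hαδ : α ≤ 1 - δ)
    (hc : RestCorr μ α) :
    val P η (fun w => ev (prodLaw w) f) t (marg μ) ≤ ev μ f + 2 * B * (η * nzs (marg μ)) +
      n * (q * (√(α * (1 - δ * (η ^ (k + 2) / 16)) ^ t) * B)) := by
  have hη1 : η ≤ 1 := hη.trans ((div_le_one (by positivity)).2 (by linarith [Nat.cast_nonneg (α := ℝ) q]))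
  induction t generalizing μ α with
  | zero =>
    have := hc.ev_prodLaw_le hμ hα hB hf
    have h0 : 0 ≤ 2 * B * (η * nzs (marg μ)) := by have := nzs_nonneg (marg μ); positivity
    simp only [val, pow_zero, mul_one]
    linarith
  | succ t ih =>
    obtain ⟨μ', hμ', hmarg, hcorr, hev⟩ := exists_killLaw hη0 hη hμ hf
    set c := η ^ (k + 2) / 16 with hcdef
    have hc0 : 0 < c := by positivity
    have hc1 : c ≤ 1 / 16 := by
      have : η ^ (k + 2) ≤ 1 := pow_le_one₀ hη0.le hη1
      rw [hcdef]; linarith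
    have hα' : 0 < α * (1 - δ * c) := by
      have : δ * c ≤ 1 * (1 / 16) := mul_le_mul (by linarith) hc1 hc0.le zero_le_one
      exact mul_pos hα (by linarith)
    have hgap : ∀ i a, marg μ' i a = 0 ∨ η ≤ marg μ' i a := by
      intro i a; rw [hmarg]
      exact (killRow_gap hη (marg_mem hμ i) a).imp And.left And.left
    have hstep : ∀ p, P p * val P η (fun w => ev (prodLaw w) f) t (stepMarg η p (marg μ)) ≤
        P p * (ev (opLaw p μ') f + (2 * B * (η * nzs (marg μ')) +
          n * (q * (√(α * (1 - δ * c) ^ (t + 1)) * B)))) := by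
      intro p
      by_cases hp : P p = 0
      · simp [hp]
      refine mul_le_mul_of_nonneg_left ?_ (hP.1.1 p)
      have hpc := hm.conservative hP.1.1 hp
      have hr := (hcorr α hc).opLaw hμ' hα.le (by linarith) hη0 hgap hpc (ht p hp)
      -- Since 1-α ≥ δ, the gain α(1-α)c is at least αδc, which gives a fixed contraction factor.
      -- The condition α ≤ 1-δ persists because α decreases.
      have hr' : RestCorr (opLaw p μ') (α * (1 - δ * c)) := fun i =>
        (hr i).mono (opLaw_mem p hμ') (by
          have := mul_le_mul_of_nonneg_right hαδ (mul_pos hα hc0).le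
          rw [← hcdef]; nlinarith)
      have hmm : marg (opLaw p μ') = stepMarg η p (marg μ) := by
        funext i; rw [marg_opLaw, hmarg]; rfl
      have hle : α * (1 - δ * c) ≤ α :=
        mul_le_of_le_one_right hα.le (by linarith [mul_pos hδ hc0])
      have h1 := ih (opLaw_mem p hμ') hα' (hle.trans hαδ) hr'
      rw [hmm] at h1
      have h2 : nzs (stepMarg η p (marg μ)) ≤ nzs (marg μ') := by
        have := nzs_opRow_le hpc (marg μ')
        have e : (fun i => opRow p (marg μ' i)) = stepMarg η p (marg μ) :=
          funext fun i => by rw [hmarg]; rfl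
        rwa [e] at this
      have h3 : 2 * B * (η * nzs (stepMarg η p (marg μ))) ≤ 2 * B * (η * nzs (marg μ')) := by gcongr
      rw [mul_assoc α, ← pow_succ'] at h1
      linarith
    rw [val]
    refine (Finset.sum_le_sum fun p _ => hstep p).trans ?_
    simp only [mul_add (P _), Finset.sum_add_distrib, ← Finset.sum_mul, hP.1.2, one_mul]
    have h4 := sum_ev_opLaw_le (by omega) hP hμ'
    have h5 : ∑ i, ((nz (marg μ i) : ℝ) - nz (marg μ' i)) = nzs (marg μ) - nzs (marg μ') := by
      simp [nzs]
    rw [h5] at hev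
    linarith

/-! ### Lower bound through the convex extension -/

theorem convexExtension_le {f : (Fin n → Fin q) → ℝ} {μ : (Fin n → Fin q) → ℝ}
    {w : Fin n → Fin q → ℝ} (hμ : μ ∈ stdSimplex ℝ (Fin n → Fin q)) (hw : marg μ = w) :
    convexExtension f w ≤ ev μ f :=
  (convexExtension_isLeast f fun i => hw ▸ marg_mem hμ i).2
    ⟨μ, mem_couplings.2 ⟨hμ, hw⟩, rfl⟩

theorem exists_convexExtension (f : (Fin n → Fin q) → ℝ) {w : Fin n → Fin q → ℝ}
    (hw : ∀ i, w i ∈ stdSimplex ℝ (Fin q)) :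
    ∃ μ ∈ stdSimplex ℝ (Fin n → Fin q), marg μ = w ∧ ev μ f = convexExtension f w := by
  obtain ⟨μ, hμ, h⟩ := (convexExtension_isLeast f hw).1
  exact ⟨μ, (mem_couplings.1 hμ).1, (mem_couplings.1 hμ).2, h⟩

theorem ev_mix {Ω : Type*} [Fintype Ω] (c d : ℝ) (μ ν F : Ω → ℝ) :
    ev (fun x => c * μ x + d * ν x) F = c * ev μ F + d * ev ν F := by
  simp only [ev, add_mul, Finset.sum_add_distrib, Finset.mul_sum, mul_assoc]

theorem mix_mem {Ω : Type*} [Fintype Ω] {θ : ℝ} (h0 : 0 ≤ θ) (h1 : θ ≤ 1) {μ ν : Ω → ℝ}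
    (hμ : μ ∈ stdSimplex ℝ Ω) (hν : ν ∈ stdSimplex ℝ Ω) :
    (fun x => (1 - θ) * μ x + θ * ν x) ∈ stdSimplex ℝ Ω := by
  refine ⟨fun x => add_nonneg (mul_nonneg (by linarith) (hμ.1 x)) (mul_nonneg h0 (hν.1 x)), ?_⟩
  rw [Finset.sum_add_distrib, ← Finset.mul_sum, ← Finset.mul_sum, hμ.2, hν.2]; ring

theorem marg_mix (c d : ℝ) (μ ν : (Fin n → Fin q) → ℝ) (i : Fin n) (a : Fin q) :
    marg (fun x => c * μ x + d * ν x) i a = c * marg μ i a + d * marg ν i a := by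
  simp only [marg, push, Finset.sum_add_distrib, Finset.mul_sum]

/-- Write w as (1-θ)w' + θu. An optimal coupling for w' mixed with the product law of u is a
coupling for w, and only the fraction θ can lose, by at most 2B. -/
theorem convexExtension_le_of_dominates {f : (Fin n → Fin q) → ℝ} {B : ℝ} (hf : ∀ x, |f x| ≤ B)
    {w w' : Fin n → Fin q → ℝ} (hw : ∀ i, w i ∈ stdSimplex ℝ (Fin q))
    (hw' : ∀ i, w' i ∈ stdSimplex ℝ (Fin q)) {θ : ℝ} (hθ0 : 0 ≤ θ) (hθ1 : θ ≤ 1)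
    (h : ∀ i a, (1 - θ) * w' i a ≤ w i a) :
    convexExtension f w ≤ convexExtension f w' + 2 * θ * B := by
  -- The complementary marginals u are obtained by dividing by θ, so θ = 0 is treated apart; there
  -- w' = w.
  rcases hθ0.eq_or_lt with rfl | hθ
  · have : w' = w := by
      funext i a
      have h1 := fun a (_ : a ∈ Finset.univ) => h i a
      simp only [sub_zero, one_mul] at h1
      exact (Finset.sum_eq_sum_iff_of_le h1).1 ((hw' i).2.trans (hw i).2.symm) a (Finset.mem_univ a)
    rw [this]; simp
  obtain ⟨μ, hμ, hμw, hμf⟩ := exists_convexExtension f hw'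
  have hu : ∀ i, (fun a => (w i a - (1 - θ) * w' i a) / θ) ∈ stdSimplex ℝ (Fin q) := by
    intro i
    refine ⟨fun a => div_nonneg (by linarith [h i a]) hθ0, ?_⟩
    rw [← Finset.sum_div, Finset.sum_sub_distrib, ← Finset.mul_sum, (hw i).2, (hw' i).2]
    field_simp; ring
  have hν := prodLaw_mem hu
  have hle := convexExtension_le (f := f) (w := w) (mix_mem hθ0 hθ1 hμ hν) (by
    funext i a
    rw [marg_mix, hμw, marg_prodLaw hu]
    field_simp; ring)
  rw [ev_mix] at hle
  have h1 : ev (prodLaw fun i a => (w i a - (1 - θ) * w' i a) / θ) f ≤ B :=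
    ev_le_of_le hν fun x => (abs_le.1 (hf x)).2
  have h2 : -B ≤ ev μ f := le_ev_of_le hμ fun x => (abs_le.1 (hf x)).1
  rw [← hμf]
  nlinarith

theorem abs_convexExtension_le {f : (Fin n → Fin q) → ℝ} {B : ℝ} (hf : ∀ x, |f x| ≤ B)
    {w : Fin n → Fin q → ℝ} (hw : ∀ i, w i ∈ stdSimplex ℝ (Fin q)) :
    |convexExtension f w| ≤ B := by
  obtain ⟨μ, hμ, -, h⟩ := exists_convexExtension f hw
  rw [← h]
  exact abs_le.2 ⟨le_ev_of_le hμ fun x => (abs_le.1 (hf x)).1,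
    ev_le_of_le hμ fun x => (abs_le.1 (hf x)).2⟩

/-- A heavy letter has weight at least 1/(q+1), so the mass it receives is a small fraction of what
it had. This relative bound is what `convexExtension_le_of_dominates` needs. -/
theorem convexExtension_le_kill {f : (Fin n → Fin q) → ℝ} {B : ℝ} (hf : ∀ x, |f x| ≤ B)
    (hB : 0 ≤ B) {w : Fin n → Fin q → ℝ} (hw : ∀ i, w i ∈ stdSimplex ℝ (Fin q)) {η : ℝ}
    (hη0 : 0 < η) (hη : η ≤ 1 / ((q : ℝ) + 1)) :
    convexExtension f w ≤ convexExtension f (fun i => killRow η (w i)) +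
      2 * ((q + 1) * (η * (nzs w - nzs fun i => killRow η (w i)))) * B := by
  have hw' : ∀ i, killRow η (w i) ∈ stdSimplex ℝ (Fin q) := fun i => killRow_mem (hw i)
  have hnn : ∀ i, (0 : ℝ) ≤ nz (w i) - nz (killRow η (w i)) := fun i =>
    sub_nonneg.2 (nz_killRow_le hη0 hη (hw i))
  have hnz : nzs w - nzs (fun i => killRow η (w i)) =
      ∑ i, ((nz (w i) : ℝ) - nz (killRow η (w i))) := by simp [nzs]
  have hθ0 : 0 ≤ (q + 1) * (η * (nzs w - nzs fun i => killRow η (w i))) := by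
    rw [hnz]; have := Finset.sum_nonneg fun i (_ : i ∈ Finset.univ) => hnn i; positivity
  -- If the claimed fraction θ is at least 1, the bound follows from |convexExtension| ≤ B alone.
  rcases le_total 1 ((q + 1) * (η * (nzs w - nzs fun i => killRow η (w i)))) with h1 | h1
  · have h2 := (abs_le.1 (abs_convexExtension_le hf hw)).2
    have h3 := (abs_le.1 (abs_convexExtension_le hf hw')).1
    nlinarith
  refine convexExtension_le_of_dominates hf hw hw' hθ0 h1 fun i a => ?_
  set θ := (q + 1) * (η * (nzs w - nzs fun i => killRow η (w i))) with hθ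
  have hmass : lightMass η (w i) * (q + 1) ≤ θ := by
    rw [hθ, hnz, mul_comm]
    refine mul_le_mul_of_nonneg_left ((lightMass_le hη0 hη (hw i)).trans
      (mul_le_mul_of_nonneg_left ?_ hη0.le)) (by positivity)
    exact Finset.single_le_sum (f := fun i => (nz (w i) : ℝ) - nz (killRow η (w i)))
      (fun i _ => hnn i) (Finset.mem_univ i)
  have h0 := (hw i).1 a
  have hz : (if w i a < η then 0 else w i a) ≤ w i a := by split_ifs <;> linarith
  have hz0 : 0 ≤ (if w i a < η then 0 else w i a) := by split_ifs <;> linarith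
  by_cases hfh : FirstHeavy (w i) a
  · simp only [killRow, if_pos hfh]
    have hL := lightMass_nonneg (η := η) (hw i)
    have hK : (0 : ℝ) < q + 1 := by positivity
    have h2 := hfh.1
    rw [div_le_iff₀ hK] at h2
    have h3 : lightMass η (w i) ≤ θ * w i a := by
      have : lightMass η (w i) * 1 ≤ lightMass η (w i) * (w i a * (q + 1)) :=
        mul_le_mul_of_nonneg_left h2 hL
      nlinarith
    nlinarith
  · simp only [killRow, if_neg hfh, add_zero]
    nlinarith

/-- Mixing optimal couplings for the rows after p, with weights P p, produces a coupling for w by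
the martingale property. -/
theorem convexExtension_le_op {P : Operation q k → ℝ} (hP : P ∈ stdSimplex ℝ (Operation q k))
    (hk : k ≠ 0) (hm : IsMeasurePreserving P) (f : (Fin n → Fin q) → ℝ) {w : Fin n → Fin q → ℝ}
    (hw : ∀ i, w i ∈ stdSimplex ℝ (Fin q)) :
    convexExtension f w ≤ ∑ p, P p * convexExtension f fun i => opRow p (w i) := by
  choose μ hμ hμw hμf using fun p : Operation q k =>
    exists_convexExtension f fun i => opRow_mem p (hw i)
  simp only [← hμf, ← ev_sum_left]
  refine convexExtension_le ⟨fun x => Finset.sum_nonneg fun p _ => mul_nonneg (hP.1 p) ((hμ p).1 x),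
    ?_⟩ ?_
  · rw [Finset.sum_comm]
    simp only [← Finset.mul_sum, (hμ _).2, mul_one, hP.2]
  · funext i a
    rw [← hm.sum_opRow hk (hw i) a]
    have : ∀ p, opRow p (w i) a = marg (μ p) i a := fun p => by rw [hμw]
    simp only [this, marg, push, Finset.mul_sum]
    rw [Finset.sum_comm]

/-- Convexity handles the operation step and domination the merging step; at the end the product law
is itself a competitor in the minimum. -/
theorem le_val {P : Operation q k → ℝ} {f : (Fin n → Fin q) → ℝ} (hk : k ≠ 0)
    (hP : P ∈ stdSimplex ℝ (Operation q k)) (hm : IsMeasurePreserving P)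
    {η B : ℝ} (hη0 : 0 < η) (hη : η ≤ 1 / ((q : ℝ) + 1)) (hB : 0 ≤ B)
    (hf : ∀ x, |f x| ≤ B) (t : ℕ) {w : Fin n → Fin q → ℝ}
    (hw : ∀ i, w i ∈ stdSimplex ℝ (Fin q)) :
    convexExtension f w ≤ val P η (fun w => ev (prodLaw w) f) t w +
      2 * ((q + 1) * (η * nzs w)) * B := by
  induction t generalizing w with
  | zero =>
    have h1 := convexExtension_le (f := f) (prodLaw_mem hw) (marg_prodLaw hw)
    have h2 := nzs_nonneg w
    have : 0 ≤ 2 * ((q + 1) * (η * nzs w)) * B := by positivity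
    simp only [val]
    linarith
  | succ t ih =>
    have h1 := convexExtension_le_kill hf hB hw hη0 hη
    have hw' : ∀ i, killRow η (w i) ∈ stdSimplex ℝ (Fin q) := fun i => killRow_mem (hw i)
    have h2 := convexExtension_le_op hP hk hm f hw'
    have h3 : ∑ p, P p * convexExtension f (fun i => opRow p (killRow η (w i))) ≤
        ∑ p, P p * (val P η (fun w => ev (prodLaw w) f) t (stepMarg η p w) +
          2 * ((q + 1) * (η * nzs fun i => killRow η (w i))) * B) := by
      refine Finset.sum_le_sum fun p _ => ?_
      by_cases hp : P p = 0
      · simp [hp]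
      refine mul_le_mul_of_nonneg_left ((ih (stepMarg_mem p hw)).trans ?_) (hP.1 p)
      have h4 : nzs (stepMarg η p w) ≤ nzs fun i => killRow η (w i) :=
        nzs_opRow_le (hm.conservative hP.1 hp) _
      gcongr
    simp only [mul_add (P _), Finset.sum_add_distrib, ← Finset.sum_mul, hP.2, one_mul] at h3
    rw [val]
    nlinarith

/-! ### The initial mixture -/

/-- The hypothesis `hi` is correlation 0 under ν, and under μ the trivial bound 1 holds. The
linearised form is affine in the law once X has the same distribution under both, so the bounds
interpolate. -/
theorem MaxCorr.mix {Ω A C : Type*} [Fintype Ω] {μ ν : Ω → ℝ} {X : Ω → A} {Y : Ω → C}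
    (hμ : μ ∈ stdSimplex ℝ Ω) {δ : ℝ} (hδ0 : 0 ≤ δ) (hδ1 : δ ≤ 1)
    (hm : ∀ g : A → ℝ, ev μ (fun x => g (X x)) = ev ν fun x => g (X x))
    (hi : ∀ (g : A → ℝ) (h : C → ℝ), 2 * ev ν (fun x => g (X x) * h (Y x)) ≤
      ev ν (fun x => h (Y x) ^ 2) + ev ν (fun x => g (X x)) ^ 2) :
    MaxCorr (fun x => (1 - δ) * μ x + δ * ν x) X Y (1 - δ) := by
  intro g h
  simp only [ev_mix, ← hm g, ← hm fun a => g a ^ 2]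
  have h1 : 2 * ev μ (fun x => g (X x) * h (Y x)) ≤ ev μ (fun x => h (Y x) ^ 2) +
      ev μ fun x => g (X x) ^ 2 := by
    rw [← ev_const_mul, ← ev_add]
    exact ev_mono hμ.1 fun x => by nlinarith [sq_nonneg (g (X x) - h (Y x))]
  have h2 := hi g h
  rw [← hm g] at h2
  nlinarith [mul_le_mul_of_nonneg_left h1 (sub_nonneg.2 hδ1), mul_le_mul_of_nonneg_left h2 hδ0]

theorem prodLaw_indep {w : Fin n → Fin q → ℝ} (hw : ∀ i, w i ∈ stdSimplex ℝ (Fin q)) (i : Fin n)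
    (g : Fin q → ℝ) (h : ({j // j ≠ i} → Fin q) → ℝ) :
    2 * ev (prodLaw w) (fun x => g (x i) * h fun j => x j) ≤
      ev (prodLaw w) (fun x => h (fun j => x j) ^ 2) + ev (prodLaw w) (fun x => g (x i)) ^ 2 := by
  have hmem := prodLaw_mem hw
  have hup : ∀ (x : Fin n → Fin q) a, (fun j : {j // j ≠ i} => Function.update x i a j) = fun j : {j // j ≠ i} => x j :=
    fun x a => funext fun j => Function.update_of_ne j.2 _ _
  have h1 : ev (prodLaw w) (fun x => g (x i) * h fun j => x j) =
      ev (w i) g * ev (prodLaw w) fun x => h fun j => x j := by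
    rw [← ev_prodLaw_avg hw i, ← ev_const_mul]
    congr 1; funext x
    simp only [avg, Function.update_self, hup, ev_mul_const]
  have h2 : ev (prodLaw w) (fun x => g (x i)) = ev (w i) g := by
    rw [← marg_prodLaw hw, ev_marg, marg_prodLaw hw]
  have h3 := ev_sq_le hmem fun x => h fun j => x j
  rw [h1, h2]
  nlinarith [sq_nonneg (ev (w i) g - ev (prodLaw w) fun x => h fun j => x j)]

/-- The upper bound starts from an optimal coupling with a fraction δ of the product law. The
marginals stay w, the value rises by at most 2δB, and the correlation starts at 1-δ. -/
theorem abs_val_sub_convexExtension_le {P : Operation q (k + 2) → ℝ} {f : (Fin n → Fin q) → ℝ}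
    (hP : IsFractionalPolymorphism P f) (ht : IsTransitiveSymmetric P) (hm : IsMeasurePreserving P)
    {η δ B : ℝ} (hη0 : 0 < η) (hη : η ≤ 1 / ((q : ℝ) + 1)) (hδ : 0 < δ) (hδ1 : δ < 1) (hB : 0 ≤ B)
    (hf : ∀ x, |f x| ≤ B) (t : ℕ) {w : Fin n → Fin q → ℝ}
    (hw : ∀ i, w i ∈ stdSimplex ℝ (Fin q)) :
    |val P η (fun w => ev (prodLaw w) f) t w - convexExtension f w| ≤
      (2 * δ + 2 * ((q + 1) * (η * (n * q))) +
        n * (q * √((1 - δ * (η ^ (k + 2) / 16)) ^ t))) * B := by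
  have hlow := le_val (by omega) hP.1 hm hη0 hη hB hf t hw
  obtain ⟨μ, hμ, hμw, hμf⟩ := exists_convexExtension f hw
  have hprod := prodLaw_mem hw
  have hmix := mix_mem hδ.le hδ1.le hμ hprod
  have hmm : marg (fun x => (1 - δ) * μ x + δ * prodLaw w x) = w := by
    funext i a; rw [marg_mix, hμw, marg_prodLaw hw]; ring
  have hcorr : RestCorr (fun x => (1 - δ) * μ x + δ * prodLaw w x) (1 - δ) := by
    intro i
    refine MaxCorr.mix hμ hδ.le hδ1.le (fun g => ?_) fun g h => prodLaw_indep hw i g h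
    rw [← ev_marg, ← ev_marg, hμw, marg_prodLaw hw]
  have hup := val_le hP ht hm hη0 hη hδ hB hf t hmix (by linarith) le_rfl hcorr
  rw [hmm, ev_mix, hμf] at hup
  have h1 : ev (prodLaw w) f ≤ B := ev_le_of_le hprod fun x => (abs_le.1 (hf x)).2
  have h2 := (abs_le.1 (abs_convexExtension_le hf hw)).1
  have h3 := nzs_le w
  have h4 := nzs_nonneg w
  have hq : (0 : ℝ) ≤ q := Nat.cast_nonneg q
  have h5 : η * nzs w * B ≤ η * (n * q) * B := by gcongr
  have h50 : 0 ≤ η * nzs w * B := by positivity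
  have h6 : η * nzs w * B * (q + 1) ≤ η * (n * q) * B * (q + 1) := by gcongr
  set κ := δ * (η ^ (k + 2) / 16)
  have h8 : κ ≤ 1 := by
    have hη1 : η ≤ 1 := hη.trans ((div_le_one (by positivity)).2 (by linarith))
    have : η ^ (k + 2) ≤ 1 := pow_le_one₀ hη0.le hη1
    have h0 : 0 ≤ η ^ (k + 2) := by positivity
    change δ * (η ^ (k + 2) / 16) ≤ 1
    nlinarith
  have h7 : √((1 - δ) * (1 - κ) ^ t) ≤ √((1 - κ) ^ t) := by
    refine Real.sqrt_le_sqrt (mul_le_of_le_one_left (pow_nonneg (by linarith) t) (by linarith))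
  have h9 : n * (q * (√((1 - δ) * (1 - κ) ^ t) * B)) ≤ n * (q * (√((1 - κ) ^ t) * B)) := by gcongr
  have h10 : 0 ≤ n * (q * (√((1 - κ) ^ t) * B)) := by positivity
  have h11 : 0 ≤ η * (n * q) * B * q := by positivity
  rw [abs_le]
  constructor
  · have : 0 ≤ δ * B := by positivity
    nlinarith
  · have : 0 ≤ δ * B := by positivity
    nlinarith [mul_le_mul_of_nonneg_left h1 hδ.le, mul_le_mul_of_nonneg_left h2 hδ.le]

end Dynamics

/-! ### Dyadic sampling -/

namespace RealRAM

/-- The digit drawn last is the leading one, so recursion on binary digits peels off the final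
kernel. -/
theorem iterK_succ_last {Ω : Type} (κ : Ω → PMF Ω) (m : ℕ) (ω : Ω) :
    iterK (fun _ => κ) (m + 1) ω = (iterK (fun _ => κ) m ω).bind κ := by
  induction m generalizing ω with
  | zero => simp [iterK]
  | succ m ih =>
    rw [iterK, iterK, PMF.bind_bind]
    congr 1; funext x; exact ih x

/-- Append a random bit in front of a binary expansion. -/
def dyStep (u : ℝ) : PMF ℝ := (PMF.uniformOfFintype (Fin 2)).map fun b : Fin 2 => (u + (b.val : ℝ)) / 2

/-- The law of a random number with `L` binary digits. -/
def dyadic (L : ℕ) : PMF ℝ := iterK (fun _ => dyStep) L 0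

theorem tsum_dyStep (u : ℝ) (F : ℝ → ℝ≥0∞) :
    ∑' x, dyStep u x * F x = 2⁻¹ * (F (u / 2) + F ((u + 1) / 2)) := by
  rw [dyStep, tsum_map_mul, tsum_fintype, Fin.sum_univ_two]
  simp [mul_add]

theorem dyadic_mem {L : ℕ} {u : ℝ} (hu : u ∈ (dyadic L).support) : 0 ≤ u ∧ u < 1 := by
  induction L generalizing u with
  | zero => simp [dyadic, iterK] at hu; subst hu; norm_num
  | succ L ih =>
    rw [dyadic, iterK_succ_last, PMF.mem_support_bind_iff] at hu
    obtain ⟨u', hu', h⟩ := hu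
    obtain ⟨h0, h1⟩ := ih hu'
    rw [dyStep, PMF.mem_support_map_iff] at h
    obtain ⟨b, -, rfl⟩ := h
    have hb : (b.val : ℝ) ≤ 1 := by exact_mod_cast Nat.lt_succ_iff.1 b.2
    constructor
    · positivity
    · linarith

/-- Distribution function of a law on the reals. -/
def cdf (D : PMF ℝ) (c : ℝ) : ℝ≥0∞ := ∑' u, D u * if u < c then 1 else 0

theorem cdf_le_one (D : PMF ℝ) (c : ℝ) : cdf D c ≤ 1 := by
  rw [cdf, ← D.tsum_coe]
  exact ENNReal.tsum_le_tsum fun u => by split_ifs <;> simp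

/-- The leading digit selects a half of [0,1), and each half is rescaled to the whole interval. -/
theorem cdf_dyadic_succ (L : ℕ) (c : ℝ) :
    cdf (dyadic (L + 1)) c = 2⁻¹ * (cdf (dyadic L) (2 * c) + cdf (dyadic L) (2 * c - 1)) := by
  rw [cdf, dyadic, iterK_succ_last, tsum_bind_mul]
  simp only [tsum_dyStep]
  simp only [cdf, dyadic, ← ENNReal.tsum_add, ← ENNReal.tsum_mul_left]
  refine tsum_congr fun u => ?_
  have h1 : u / 2 < c ↔ u < 2 * c := by constructor <;> intro h <;> linarith
  have h2 : (u + 1) / 2 < c ↔ u < 2 * c - 1 := by constructor <;> intro h <;> linarith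
  simp only [h1, h2]
  ring

theorem cdf_dyadic_one {L : ℕ} {c : ℝ} (hc : 1 ≤ c) : cdf (dyadic L) c = 1 := by
  refine Eq.trans (tsum_congr fun u => ?_) (dyadic L).tsum_coe
  by_cases hu : u ∈ (dyadic L).support
  · rw [if_pos ((dyadic_mem hu).2.trans_le hc), mul_one]
  · rw [PMF.mem_support_iff, not_not] at hu; rw [hu, zero_mul]

theorem cdf_dyadic_zero {L : ℕ} {c : ℝ} (hc : c ≤ 0) : cdf (dyadic L) c = 0 := by
  rw [cdf, ENNReal.tsum_eq_zero]
  intro u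
  by_cases hu : u ∈ (dyadic L).support
  · rw [if_neg (not_lt.2 (hc.trans (dyadic_mem hu).1)), mul_zero]
  · rw [PMF.mem_support_iff, not_not] at hu; rw [hu, zero_mul]

/-- In either half one of the two terms of the recursion is exact, so every digit halves the error.
-/
theorem abs_cdf_dyadic_sub_le (L : ℕ) {c : ℝ} (h0 : 0 ≤ c) (h1 : c ≤ 1) :
    |(cdf (dyadic L) c).toReal - c| ≤ (1 / 2) ^ L := by
  induction L generalizing c with
  | zero =>
    have := ENNReal.toReal_mono ENNReal.one_ne_top (cdf_le_one (dyadic 0) c)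
    have h2 := ENNReal.toReal_nonneg (a := cdf (dyadic 0) c)
    rw [ENNReal.toReal_one] at this
    rw [abs_le]; constructor <;> simp <;> linarith
  | succ L ih =>
    have ht : ∀ c, cdf (dyadic L) c ≠ ⊤ := fun c => ne_top_of_le_ne_top ENNReal.one_ne_top (cdf_le_one _ c)
    rw [cdf_dyadic_succ, ENNReal.toReal_mul, ENNReal.toReal_add (ht _) (ht _), ENNReal.toReal_inv]
    simp only [ENNReal.toReal_ofNat]
    rcases le_total c (1 / 2) with hc | hc
    · rw [cdf_dyadic_zero (by linarith : 2 * c - 1 ≤ 0)]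
      have := abs_le.1 (ih (by linarith : 0 ≤ 2 * c) (by linarith))
      rw [pow_succ, abs_le]; simp only [ENNReal.toReal_zero]; constructor <;> linarith
    · rw [cdf_dyadic_one (by linarith : 1 ≤ 2 * c)]
      have := abs_le.1 (ih (by linarith : 0 ≤ 2 * c - 1) (by linarith))
      rw [pow_succ, abs_le]; simp only [ENNReal.toReal_one]; constructor <;> linarith

/-! ### Choosing an index from a random number -/

section Select

variable {m : ℕ}

/-- Total weight of the indices before `a`. -/
def preSum (v : Fin m → ℝ) (a : ℕ) : ℝ := ∑ b ∈ Finset.univ.filter (fun b : Fin m => b.val < a), v b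

theorem preSum_succ (v : Fin m → ℝ) (a : Fin m) : preSum v (a + 1) = preSum v a + v a := by
  rw [preSum, preSum, add_comm (∑ b ∈ _, v b), ← Finset.sum_insert (by simp)]
  congr 1; ext b; simp [Fin.ext_iff]; omega

theorem preSum_zero (v : Fin m → ℝ) : preSum v 0 = 0 := by simp [preSum]

theorem preSum_last (v : Fin m → ℝ) : preSum v m = ∑ a, v a := by
  simp [preSum]

theorem preSum_mono {v : Fin m → ℝ} (hv : ∀ a, 0 ≤ v a) {a b : ℕ} (h : a ≤ b) :
    preSum v a ≤ preSum v b :=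
  Finset.sum_le_sum_of_subset_of_nonneg (fun c hc => by
    simp only [Finset.mem_filter, Finset.mem_univ, true_and] at hc ⊢; omega) fun c _ _ => hv c

/-- The number `u` falls into the `a`-th interval. -/
def Falls (v : Fin m → ℝ) (u : ℝ) (a : Fin m) : Prop := preSum v a ≤ u ∧ u < preSum v (a + 1)

theorem Falls.unique {v : Fin m → ℝ} (hv : ∀ a, 0 ≤ v a) {u : ℝ} {a b : Fin m} (ha : Falls v u a)
    (hb : Falls v u b) : a = b := by
  rcases lt_trichotomy a b with h | h | h
  · linarith [ha.2, hb.1, preSum_mono hv (Nat.succ_le_of_lt (Fin.lt_def.1 h))]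
  · exact h
  · linarith [hb.2, ha.1, preSum_mono hv (Nat.succ_le_of_lt (Fin.lt_def.1 h))]

theorem exists_falls {v : Fin m → ℝ} {u : ℝ} (h0 : 0 ≤ u) (h1 : u < ∑ a, v a) : ∃ a, Falls v u a := by
  by_contra! hcon
  have : ∀ a ≤ m, preSum v a ≤ u := by
    intro a
    induction a with
    | zero => intro _; rw [preSum_zero]; exact h0
    | succ a ih =>
      intro ha
      by_contra h
      exact hcon ⟨a, ha⟩ ⟨ih (by omega), not_le.1 h⟩
  have := this m le_rfl
  rw [preSum_last] at this
  linarith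

open Classical in
/-- The index of the interval into which `u` falls. -/
def sel (v : Fin m → ℝ) (u : ℝ) : Option (Fin m) :=
  if h : ∃ a, Falls v u a then some h.choose else none

theorem sel_eq {v : Fin m → ℝ} (hv : ∀ a, 0 ≤ v a) {u : ℝ} {a : Fin m} (ha : Falls v u a) :
    sel v u = some a := by
  have h : ∃ a, Falls v u a := ⟨a, ha⟩
  rw [sel, dif_pos h, h.choose_spec.unique hv ha]

/-- The index chosen by a random number with `L` binary digits. -/
def selLaw (v : Fin m → ℝ) (L : ℕ) : PMF (Option (Fin m)) := (dyadic L).map (sel v)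

/-- The probability of an index is a difference of two values of the distribution function, each off
by at most 2^-L. Since the draw lies in [0,1) and the weights sum to 1, `none` has probability 0 and
the perturbed weights W again form a distribution. -/
theorem exists_selLaw {v : Fin m → ℝ} (hv : v ∈ stdSimplex ℝ (Fin m)) (L : ℕ) :
    ∃ W ∈ stdSimplex ℝ (Fin m), (∀ a, |W a - v a| ≤ 2 * (1 / 2) ^ L) ∧
      ∀ G : Option (Fin m) → ℝ≥0∞,
        ∑' o, selLaw v L o * G o = ∑ a, ENNReal.ofReal (W a) * G (some a) := by
  classical
  set A : Fin m → ℝ≥0∞ := fun a => ∑' u, dyadic L u * if Falls v u a then 1 else 0 with hA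
  have hG : ∀ G : Option (Fin m) → ℝ≥0∞,
      ∑' o, selLaw v L o * G o = ∑ a, A a * G (some a) := by
    intro G
    rw [selLaw, tsum_map_mul]
    simp only [hA, ← ENNReal.tsum_mul_right]
    rw [← tsum_fintype (L := .unconditional _), ENNReal.tsum_comm]
    refine tsum_congr fun u => ?_
    by_cases hu : u ∈ (dyadic L).support
    · obtain ⟨h0, h1⟩ := dyadic_mem hu
      obtain ⟨a, ha⟩ := exists_falls (v := v) h0 (by rw [hv.2]; exact h1)
      rw [sel_eq hv.1 ha, tsum_eq_single a]
      · simp [ha]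
      · intro b hb
        rw [if_neg fun h => hb (h.unique hv.1 ha)]; simp
    · rw [PMF.mem_support_iff, not_not] at hu; simp [hu]
  have hAc : ∀ a : Fin m, A a + cdf (dyadic L) (preSum v a) = cdf (dyadic L) (preSum v (a + 1)) := by
    intro a
    have hle : preSum v a ≤ preSum v (a + 1) := preSum_mono hv.1 (Nat.le_succ _)
    simp only [hA, cdf, ← ENNReal.tsum_add, ← mul_add]
    refine tsum_congr fun u => ?_
    congr 1
    by_cases h1 : u < preSum v a
    · rw [if_neg fun h : Falls v u a => absurd h.1 (not_le.2 h1), if_pos h1,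
        if_pos (h1.trans_le hle), zero_add]
    · by_cases h2 : u < preSum v (a + 1)
      · rw [if_pos (show Falls v u a from ⟨not_lt.1 h1, h2⟩), if_neg h1, if_pos h2, add_zero]
      · rw [if_neg fun h : Falls v u a => h2 h.2, if_neg h1, if_neg h2, add_zero]
  have hone : ∑ a, A a = 1 := by
    have := hG fun _ => 1
    simp only [mul_one, PMF.tsum_coe] at this
    exact this.symm
  have hAt : ∀ a, A a ≠ ⊤ := fun a =>
    ne_top_of_le_ne_top ENNReal.one_ne_top (hone ▸ Finset.single_le_sum (fun _ _ => zero_le) (Finset.mem_univ a))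
  refine ⟨fun a => (A a).toReal, ⟨fun a => ENNReal.toReal_nonneg, ?_⟩, fun a => ?_, fun G => ?_⟩
  · rw [← ENNReal.toReal_sum fun a _ => hAt a, hone, ENNReal.toReal_one]
  · have hct : ∀ c, cdf (dyadic L) c ≠ ⊤ := fun c =>
      ne_top_of_le_ne_top ENNReal.one_ne_top (cdf_le_one _ c)
    have h1 := congrArg ENNReal.toReal (hAc a)
    rw [ENNReal.toReal_add (hAt a) (hct _)] at h1
    have hb : ∀ b ≤ m, 0 ≤ preSum v b ∧ preSum v b ≤ 1 := fun b hb =>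
      ⟨by rw [← preSum_zero v]; exact preSum_mono hv.1 (Nat.zero_le _),
        by rw [← hv.2, ← preSum_last]; exact preSum_mono hv.1 hb⟩
    have h2 := abs_le.1 (abs_cdf_dyadic_sub_le L (hb a a.2.le).1 (hb a a.2.le).2)
    have h3 := abs_le.1 (abs_cdf_dyadic_sub_le L (hb (a + 1) a.2).1 (hb (a + 1) a.2).2)
    rw [preSum_succ] at h1 h3
    rw [abs_le]; constructor <;> linarith
  · rw [hG]
    exact Finset.sum_congr rfl fun a _ => by rw [ENNReal.ofReal_toReal (hAt a)]

end Select

/-! ### Concentration of sums of independent samples -/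

/-- The linear term vanishes for a centred variable, which leaves a subgaussian bound on its
exponential moment. -/
theorem exp_le_add_exp_sq (x : ℝ) : Real.exp x ≤ x + Real.exp (x ^ 2) := by
  have h2 := Real.add_one_le_exp (x ^ 2)
  rcases le_or_gt |x| 1 with h | h
  · have := (abs_le.1 (Real.abs_exp_sub_one_sub_id_le h)).2
    linarith
  · rcases lt_abs.1 h with h | h
    · have : Real.exp x ≤ Real.exp (x ^ 2) := Real.exp_le_exp.2 (by nlinarith)
      linarith
    · have : Real.exp x ≤ 1 := Real.exp_le_one_iff.2 (by linarith)
      nlinarith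

/-- Law of the sum after one more sample. -/
def addK {X : Type} (D : PMF X) (f : X → ℝ) (S : ℝ) : PMF ℝ := D.map fun x => S + f x

theorem tsum_iterK_addK {X : Type} [Fintype X] (D : PMF X) (f : X → ℝ) {l M m : ℝ}
    (hM : ∑ x, (D x).toReal * Real.exp (l * (f x - m)) ≤ M) (N : ℕ) (S : ℝ) :
    ∑' S', iterK (fun _ => addK D f) N S S' * ENNReal.ofReal (Real.exp (l * (S' - N * m))) ≤
      ENNReal.ofReal (Real.exp (l * S) * M ^ N) := by
  have hM0 : 0 ≤ M := le_trans (Finset.sum_nonneg fun x _ => by positivity) hM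
  induction N generalizing S with
  | zero => simp [iterK]
  | succ N ih =>
    rw [iterK, tsum_bind_mul]
    have h1 : ∀ S', ∑' S'', iterK (fun _ => addK D f) N S' S'' *
        ENNReal.ofReal (Real.exp (l * (S'' - (N + 1 : ℕ) * m))) ≤
        ENNReal.ofReal (Real.exp (l * (S' - m)) * M ^ N) := by
      intro S'
      have e : ∀ S'', ENNReal.ofReal (Real.exp (l * (S'' - (N + 1 : ℕ) * m))) =
          ENNReal.ofReal (Real.exp (l * (S'' - N * m))) * ENNReal.ofReal (Real.exp (-(l * m))) := by
        intro S''
        rw [← ENNReal.ofReal_mul (Real.exp_nonneg _), ← Real.exp_add]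
        congr 2; push_cast; ring
      simp only [e, ← mul_assoc]
      rw [ENNReal.tsum_mul_right]
      refine (mul_le_mul_left (ih S') _).trans (le_of_eq ?_)
      rw [← ENNReal.ofReal_mul (by positivity), mul_right_comm, ← Real.exp_add]
      congr 3; ring
    refine (ENNReal.tsum_le_tsum fun S' => mul_le_mul_right (h1 S') _).trans ?_
    rw [addK, tsum_map_mul, tsum_fintype]
    have e2 : ∀ x, D x * ENNReal.ofReal (Real.exp (l * (S + f x - m)) * M ^ N) =
        ENNReal.ofReal ((D x).toReal * Real.exp (l * (f x - m)) * (Real.exp (l * S) * M ^ N)) := by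
      intro x
      nth_rewrite 1 [← ENNReal.ofReal_toReal (D.apply_ne_top x)]
      rw [← ENNReal.ofReal_mul ENNReal.toReal_nonneg]
      congr 1
      rw [show l * (S + f x - m) = l * (f x - m) + l * S by ring, Real.exp_add]; ring
    simp only [e2]
    rw [← ENNReal.ofReal_sum_of_nonneg fun x _ => by positivity, ← Finset.sum_mul]
    refine ENNReal.ofReal_le_ofReal ?_
    calc _ ≤ M * (Real.exp (l * S) * M ^ N) := mul_le_mul_of_nonneg_right hM (by positivity)
      _ = _ := by ring

theorem sum_toReal_eq_one {X : Type} [Fintype X] (D : PMF X) : ∑ x, (D x).toReal = 1 := by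
  rw [← ENNReal.toReal_sum fun x _ => D.apply_ne_top x, ← tsum_fintype (L := .unconditional _), D.tsum_coe, ENNReal.toReal_one]

theorem mgf_le {X : Type} [Fintype X] (D : PMF X) {f : X → ℝ} {B : ℝ} (hf : ∀ x, |f x| ≤ B) (l : ℝ) :
    ∑ x, (D x).toReal * Real.exp (l * (f x - ∑ y, (D y).toReal * f y)) ≤
      Real.exp (4 * l ^ 2 * B ^ 2) := by
  set m := ∑ y, (D y).toReal * f y with hm
  have hone := sum_toReal_eq_one D
  have hD : (fun x => (D x).toReal) ∈ stdSimplex ℝ X := ⟨fun _ => ENNReal.toReal_nonneg, hone⟩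
  have hmB : |m| ≤ B := abs_le.2 ⟨le_ev_of_le hD fun x => (abs_le.1 (hf x)).1,
    ev_le_of_le hD fun x => (abs_le.1 (hf x)).2⟩
  have h1 : ∀ x, Real.exp (l * (f x - m)) ≤ l * (f x - m) + Real.exp (4 * l ^ 2 * B ^ 2) := by
    intro x
    refine (exp_le_add_exp_sq _).trans (add_le_add le_rfl (Real.exp_le_exp.2 ?_))
    have : (f x - m) ^ 2 ≤ (2 * B) ^ 2 := by
      have h2 := abs_le.1 (hf x)
      have h3 := abs_le.1 hmB
      exact sq_le_sq' (by linarith) (by linarith)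
    nlinarith [sq_nonneg l]
  refine (ev_mono hD.1 h1).trans (le_of_eq ?_)
  rw [ev_add, ev_const_mul, ev_sub, ev_const hD, ev_const hD]
  have : ev (fun x => (D x).toReal) f = m := rfl
  rw [this]; ring

/-- Markov's inequality for the exponential moments with parameters l and -l. With l = τ/(8B²) the
exponent is Nτ²/(16B²) - Nτ²/(8B²). -/
theorem concentration {X : Type} [Fintype X] (D : PMF X) {f : X → ℝ} {B τ : ℝ} (hB : 0 < B)
    (hf : ∀ x, |f x| ≤ B) (hτ : 0 ≤ τ) (N : ℕ) :
    (iterK (fun _ => addK D f) N 0).toOuterMeasure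
      {S | ¬ |S - N * ∑ x, (D x).toReal * f x| ≤ N * τ} ≤
      ENNReal.ofReal (2 * Real.exp (-(N * τ ^ 2 / (16 * B ^ 2)))) := by
  set m := ∑ x, (D x).toReal * f x with hm
  set l := τ / (8 * B ^ 2) with hl
  have hl0 : 0 ≤ l := by positivity
  have key : ∀ l', l' ^ 2 = l ^ 2 →
      ∑' S, iterK (fun _ => addK D f) N 0 S * ENNReal.ofReal (Real.exp (l' * (S - N * m))) ≤
      ENNReal.ofReal (Real.exp (N * τ ^ 2 / (16 * B ^ 2))) := by
    intro l' hl'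
    refine (tsum_iterK_addK D f (mgf_le D hf l') N 0).trans (le_of_eq ?_)
    rw [mul_zero, Real.exp_zero, one_mul, ← Real.exp_nat_mul, hl', hl]
    congr 2; field_simp; ring
  rw [PMF.toOuterMeasure_apply]
  have hpt : ∀ S, Set.indicator {S | ¬ |S - N * m| ≤ N * τ} (iterK (fun _ => addK D f) N 0) S ≤
      (iterK (fun _ => addK D f) N 0 S * ENNReal.ofReal (Real.exp (l * (S - N * m))) +
       iterK (fun _ => addK D f) N 0 S * ENNReal.ofReal (Real.exp (-l * (S - N * m)))) *
      ENNReal.ofReal (Real.exp (-(l * (N * τ)))) := by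
    intro S
    by_cases hS : |S - N * m| ≤ N * τ
    · rw [Set.indicator_of_notMem (by simpa using hS)]; exact zero_le
    · rw [Set.indicator_of_mem (by simpa using hS), ← mul_add, mul_assoc]
      refine le_mul_of_one_le_right zero_le ?_
      rw [← ENNReal.ofReal_add (Real.exp_nonneg _) (Real.exp_nonneg _),
        ← ENNReal.ofReal_mul (by positivity), ENNReal.one_le_ofReal, add_mul, ← Real.exp_add,
        ← Real.exp_add]
      rw [not_le] at hS
      rcases lt_abs.1 hS with h | h
      · have := Real.one_le_exp (x := l * (S - N * m) + -(l * (N * τ))) (by nlinarith)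
        have := Real.exp_nonneg (-l * (S - N * m) + -(l * (N * τ)))
        linarith
      · have := Real.one_le_exp (x := -l * (S - N * m) + -(l * (N * τ))) (by nlinarith)
        have := Real.exp_nonneg (l * (S - N * m) + -(l * (N * τ)))
        linarith
  refine (ENNReal.tsum_le_tsum hpt).trans ?_
  rw [ENNReal.tsum_mul_right, ENNReal.tsum_add]
  refine (mul_le_mul_left (add_le_add (key l rfl) (key (-l) (by ring))) _).trans (le_of_eq ?_)
  rw [← ENNReal.ofReal_add (by positivity) (by positivity), ← ENNReal.ofReal_mul (by positivity),
    ← two_mul, mul_assoc, ← Real.exp_add]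
  congr 3; rw [hl]; field_simp; ring

/-- Settles f = 0, where the positive bound B demanded by `concentration` is not available from the
norm. -/
theorem iterK_addK_zero {X : Type} (D : PMF X) (N : ℕ) (S : ℝ) :
    iterK (fun _ => addK D fun _ => 0) N S = PMF.pure S := by
  have : ∀ S, addK D (fun _ => 0) S = PMF.pure S := by
    intro S; simp only [addK, add_zero]; exact PMF.map_const D S
  induction N with
  | zero => rfl
  | succ N ih => rw [iterK, this, PMF.pure_bind, ih]

end RealRAM

namespace RealRAM

/-! ### The law of one sample of the algorithm -/

section Sample

variable {q n k : ℕ}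

theorem abs_val_le {P : Operation q k → ℝ} (hP : P ∈ stdSimplex ℝ (Operation q k)) {η B : ℝ}
    {F : (Fin n → Fin q → ℝ) → ℝ} (hF : ∀ w, (∀ i, w i ∈ stdSimplex ℝ (Fin q)) → |F w| ≤ B) (t : ℕ)
    {w : Fin n → Fin q → ℝ} (hw : ∀ i, w i ∈ stdSimplex ℝ (Fin q)) : |val P η F t w| ≤ B := by
  induction t generalizing w with
  | zero => exact hF w hw
  | succ t ih =>
    refine abs_le.2 ⟨le_ev_of_le hP fun p => (abs_le.1 (ih (stepMarg_mem p hw))).1,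
      ev_le_of_le hP fun p => (abs_le.1 (ih (stepMarg_mem p hw))).2⟩

theorem val_add_const {P : Operation q k → ℝ} (hP : P ∈ stdSimplex ℝ (Operation q k)) (η : ℝ)
    (F : (Fin n → Fin q → ℝ) → ℝ) (c : ℝ) (t : ℕ) (w : Fin n → Fin q → ℝ) :
    val P η (fun w => F w + c) t w = val P η F t w + c := by
  induction t generalizing w with
  | zero => rfl
  | succ t ih =>
    simp only [val, ih, mul_add, Finset.sum_add_distrib, ← Finset.sum_mul, hP.2, one_mul]

/-- Replace P by P' one step at a time: each replacement costs the ℓ¹ distance times B, and the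
terminal function is replaced once. -/
theorem abs_val_sub_val_le {P P' : Operation q k → ℝ} (hP : P ∈ stdSimplex ℝ (Operation q k))
    (hP' : P' ∈ stdSimplex ℝ (Operation q k)) {η B θ₁ θ₂ : ℝ} {F F' : (Fin n → Fin q → ℝ) → ℝ}
    (hF : ∀ w, (∀ i, w i ∈ stdSimplex ℝ (Fin q)) → |F w| ≤ B)
    (hFF : ∀ w, (∀ i, w i ∈ stdSimplex ℝ (Fin q)) → |F w - F' w| ≤ θ₂)
    (hPP : ∑ p, |P p - P' p| ≤ θ₁) (hB : 0 ≤ B) (t : ℕ) {w : Fin n → Fin q → ℝ}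
    (hw : ∀ i, w i ∈ stdSimplex ℝ (Fin q)) :
    |val P η F t w - val P' η F' t w| ≤ t * (θ₁ * B) + θ₂ := by
  induction t generalizing w with
  | zero => simpa [val] using hFF w hw
  | succ t ih =>
    have e : val P η F (t + 1) w - val P' η F' (t + 1) w =
        ∑ p, (P p - P' p) * val P η F t (stepMarg η p w) +
        ev P' fun p => val P η F t (stepMarg η p w) - val P' η F' t (stepMarg η p w) := by
      rw [ev_sub]
      simp only [val, sub_mul, Finset.sum_sub_distrib, ev]
      ring
    have h1 : |∑ p, (P p - P' p) * val P η F t (stepMarg η p w)| ≤ θ₁ * B := by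
      refine (Finset.abs_sum_le_sum_abs _ _).trans (le_trans (Finset.sum_le_sum fun p _ => ?_)
        (le_trans (le_of_eq (Finset.sum_mul _ _ _).symm) (mul_le_mul_of_nonneg_right hPP hB)))
      rw [abs_mul]
      exact mul_le_mul_of_nonneg_left (abs_val_le hP hF t (stepMarg_mem p hw)) (abs_nonneg _)
    have h2 : |ev P' fun p => val P η F t (stepMarg η p w) - val P' η F' t (stepMarg η p w)| ≤
        t * (θ₁ * B) + θ₂ :=
      abs_le.2 ⟨le_ev_of_le hP' fun p => (abs_le.1 (ih (stepMarg_mem p hw))).1,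
        ev_le_of_le hP' fun p => (abs_le.1 (ih (stepMarg_mem p hw))).2⟩
    rw [e]
    refine (abs_add_le _ _).trans ((add_le_add h1 h2).trans (le_of_eq ?_))
    push_cast; ring

theorem abs_avgs_sub_le {w W : Fin n → Fin q → ℝ} (hw : ∀ i, w i ∈ stdSimplex ℝ (Fin q))
    (hW : ∀ i, W i ∈ stdSimplex ℝ (Fin q)) {θ B : ℝ} (h : ∀ i a, |W i a - w i a| ≤ θ)
    {f : (Fin n → Fin q) → ℝ} (hf : ∀ x, |f x| ≤ B) (l : List (Fin n)) (x : Fin n → Fin q) :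
    |avgs W l f x - avgs w l f x| ≤ l.length * (q * (θ * B)) := by
  induction l generalizing x with
  | nil => simp [avgs]
  | cons i l ih =>
    have e : avgs W (i :: l) f x - avgs w (i :: l) f x =
        ∑ a, (W i a - w i a) * avgs W l f (Function.update x i a) +
        ev (w i) fun a => avgs W l f (Function.update x i a) - avgs w l f (Function.update x i a) := by
      rw [ev_sub]
      simp only [avgs, List.foldr_cons, avg, ev, sub_mul, Finset.sum_sub_distrib]
      ring
    have h1 : |∑ a, (W i a - w i a) * avgs W l f (Function.update x i a)| ≤ q * (θ * B) := by
      refine (Finset.abs_sum_le_sum_abs _ _).trans ((Finset.sum_le_sum fun a _ =>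
        show _ ≤ θ * B from ?_).trans (le_of_eq (by simp)))
      rw [abs_mul]
      exact mul_le_mul (h i a) (avgs_le hW hf l _) (abs_nonneg _) ((abs_nonneg _).trans (h i a))
    have h2 : |ev (w i) fun a => avgs W l f (Function.update x i a) -
        avgs w l f (Function.update x i a)| ≤ l.length * (q * (θ * B)) :=
      abs_le.2 ⟨le_ev_of_le (hw i) fun a => (abs_le.1 (ih _)).1,
        ev_le_of_le (hw i) fun a => (abs_le.1 (ih _)).2⟩
    rw [e]
    refine (abs_add_le _ _).trans ((add_le_add h1 h2).trans (le_of_eq ?_))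
    rw [List.length_cons]; push_cast; ring

/-- Sample an operation and apply it. -/
def opKernel (P : Operation q k → ℝ) (η : ℝ) (L : ℕ) (w : Fin n → Fin q → ℝ) :
    PMF (Fin n → Fin q → ℝ) :=
  (selLaw (fun j => P ((opEquiv q k).symm j)) L).map fun o =>
    o.elim w fun j => stepMarg η ((opEquiv q k).symm j) w

/-- Sample the letter at which `j` letters remain to be sampled. -/
def letterKernel (w : Fin n → Fin q → ℝ) (L : ℕ) (j : ℕ) (x : Fin n → Fin q) :
    PMF (Fin n → Fin q) :=
  if h : n - 1 - j < n then
    (selLaw (w ⟨n - 1 - j, h⟩) L).map fun o => o.elim x (Function.update x ⟨n - 1 - j, h⟩)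
  else PMF.pure x

/-- Sample all letters. -/
def assignLaw (w : Fin n → Fin q → ℝ) (L : ℕ) (x : Fin n → Fin q) : PMF (Fin n → Fin q) :=
  iterK (letterKernel w L) n x

/-- The law of the queried assignment. -/
def sampleLaw (P : Operation q k → ℝ) (η : ℝ) (L r : ℕ) (w : Fin n → Fin q → ℝ)
    (x : Fin n → Fin q) : PMF (Fin n → Fin q) :=
  (iterK (fun _ => opKernel P η L) r w).bind fun w' => assignLaw w' L x

/-- Rounding affects each row separately, so letter-by-letter sampling gives exactly the product law
of the perturbed rows W. -/
theorem tsum_assignLaw {w : Fin n → Fin q → ℝ} (hw : ∀ i, w i ∈ stdSimplex ℝ (Fin q)) (L : ℕ) :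
    ∃ W : Fin n → Fin q → ℝ, (∀ i, W i ∈ stdSimplex ℝ (Fin q)) ∧
      (∀ i a, |W i a - w i a| ≤ 2 * (1 / 2) ^ L) ∧
      ∀ (F : (Fin n → Fin q) → ℝ) (_ : ∀ x, 0 ≤ F x) (x : Fin n → Fin q),
        ∑' y, assignLaw w L x y * ENNReal.ofReal (F y) = ENNReal.ofReal (ev (prodLaw W) F) := by
  choose W hW hWw hWG using fun i => exists_selLaw (hw i) L
  refine ⟨W, hW, hWw, fun F hF x => ?_⟩
  have hnn : ∀ (l : List (Fin n)) x, 0 ≤ avgs W l F x := by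
    intro l
    induction l with
    | nil => exact hF
    | cons i l ih => exact fun x => ev_nonneg (hW i).1 fun a => ih _
  -- With m letters still to be drawn, the last m coordinates are averaged; this matches the index
  -- n-1-j in `letterKernel`.
  have key : ∀ m ≤ n, ∀ x, ∑' y, iterK (letterKernel w L) m x y * ENNReal.ofReal (F y) =
      ENNReal.ofReal (avgs W ((List.finRange n).drop (n - m)) F x) := by
    intro m
    induction m with
    | zero =>
      intro _ x
      rw [Nat.sub_zero, List.drop_of_length_le (by simp)]
      simp [iterK, avgs]
    | succ m ih =>
      intro hm x
      have hi : n - 1 - m < n := by omega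
      have hlen : n - (m + 1) < (List.finRange n).length := by simp; omega
      rw [List.drop_eq_getElem_cons hlen, show n - (m + 1) + 1 = n - m by omega, iterK,
        tsum_bind_mul]
      simp only [ih (by omega)]
      rw [letterKernel, dif_pos hi, tsum_map_mul, hWG]
      simp only [Option.elim]
      have hidx : (List.finRange n)[n - (m + 1)] = ⟨n - 1 - m, hi⟩ := by
        rw [List.getElem_finRange]; ext; simp; omega
      rw [hidx]
      simp only [avgs, List.foldr_cons, avg, ev]
      rw [ENNReal.ofReal_sum_of_nonneg]
      · exact Finset.sum_congr rfl fun a _ => (ENNReal.ofReal_mul ((hW _).1 a)).symm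
      · exact fun a _ => mul_nonneg ((hW _).1 a) (hnn _ _)
  rw [assignLaw, key n le_rfl, Nat.sub_self, List.drop_zero, avgs_finRange hW]

theorem tsum_iterK_opKernel {P : Operation q k → ℝ} (hP : P ∈ stdSimplex ℝ (Operation q k)) (η : ℝ)
    (L : ℕ) :
    ∃ W ∈ stdSimplex ℝ (Operation q k), (∀ p, |W p - P p| ≤ 2 * (1 / 2) ^ L) ∧
      ∀ (F : (Fin n → Fin q → ℝ) → ℝ) (_ : ∀ w, 0 ≤ F w) (r : ℕ) (w : Fin n → Fin q → ℝ),
        ∑' w', iterK (fun _ => opKernel P η L) r w w' * ENNReal.ofReal (F w') =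
          ENNReal.ofReal (val W η F r w) := by
  have hP' : (fun j => P ((opEquiv q k).symm j)) ∈ stdSimplex ℝ (Fin (q ^ q ^ k)) :=
    ⟨fun j => hP.1 _, by rw [(opEquiv q k).symm.sum_comp, hP.2]⟩
  obtain ⟨W, hW, hWP, hWG⟩ := exists_selLaw hP' L
  refine ⟨fun p => W (opEquiv q k p), ⟨fun p => hW.1 _, ?_⟩, fun p => ?_, fun F hF r w => ?_⟩
  · rw [(opEquiv q k).sum_comp, hW.2]
  · simpa using hWP (opEquiv q k p)
  · have hnn : ∀ r w, 0 ≤ val (fun p => W (opEquiv q k p)) η F r w := by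
      intro r
      induction r with
      | zero => exact hF
      | succ r ih => exact fun w => Finset.sum_nonneg fun p _ => mul_nonneg (hW.1 _) (ih _)
    induction r generalizing w with
    | zero => simp only [iterK, tsum_pure_mul, val]
    | succ r ih =>
      rw [iterK, tsum_bind_mul]
      simp only [ih]
      rw [opKernel, tsum_map_mul, hWG]
      simp only [Option.elim]
      rw [val, ← (opEquiv q k).symm.sum_comp, ENNReal.ofReal_sum_of_nonneg]
      · refine Finset.sum_congr rfl fun j _ => ?_
        rw [ENNReal.ofReal_mul (hW.1 _), Equiv.apply_symm_apply]
      · exact fun a _ => mul_nonneg (hW.1 _) (hnn _ _)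

theorem tsum_mul_ofReal_eq {X : Type} [Fintype X] (D : PMF X) {F : X → ℝ} (hF : ∀ x, 0 ≤ F x) :
    ∑' x, D x * ENNReal.ofReal (F x) = ENNReal.ofReal (∑ x, (D x).toReal * F x) := by
  rw [tsum_fintype, ENNReal.ofReal_sum_of_nonneg fun x _ =>
    mul_nonneg ENNReal.toReal_nonneg (hF x)]
  refine Finset.sum_congr rfl fun x _ => ?_
  rw [ENNReal.ofReal_mul ENNReal.toReal_nonneg, ENNReal.ofReal_toReal (D.apply_ne_top x)]

theorem abs_mean_sub_val_le {P : Operation q k → ℝ} (hP : P ∈ stdSimplex ℝ (Operation q k))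
    (η : ℝ) (L r : ℕ) {f : (Fin n → Fin q) → ℝ} {B : ℝ} (hB : 0 ≤ B) (hf : ∀ x, |f x| ≤ B)
    {w : Fin n → Fin q → ℝ} (hw : ∀ i, w i ∈ stdSimplex ℝ (Fin q)) (x₀ : Fin n → Fin q) :
    |∑ x, (sampleLaw P η L r w x₀ x).toReal * f x - val P η (fun w => ev (prodLaw w) f) r w| ≤
      r * ((q ^ q ^ k : ℕ) * (2 * (1 / 2) ^ L) * B) + n * (q * (2 * (1 / 2) ^ L * (2 * B))) := by
  set θ : ℝ := 2 * (1 / 2) ^ L with hθ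
  -- Adding B makes the function nonnegative, so that expectations with values in [0,∞] can be used.
  have hfB : ∀ x, 0 ≤ f x + B := fun x => by linarith [(abs_le.1 (hf x)).1]
  have hfB2 : ∀ x, |f x + B| ≤ 2 * B := fun x => by
    rw [abs_of_nonneg (hfB x)]; linarith [(abs_le.1 (hf x)).2]
  set F : (Fin n → Fin q → ℝ) → ℝ := fun w' =>
    ∑ x, (assignLaw w' L x₀ x).toReal * (f x + B) with hF
  have hF0 : ∀ w', 0 ≤ F w' := fun w' => Finset.sum_nonneg fun x _ =>
    mul_nonneg ENNReal.toReal_nonneg (hfB x)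
  obtain ⟨W, hW, hWP, hWF⟩ := tsum_iterK_opKernel (n := n) hP η L
  have h1 : ENNReal.ofReal (∑ x, (sampleLaw P η L r w x₀ x).toReal * (f x + B)) =
      ENNReal.ofReal (val W η F r w) := by
    rw [← tsum_mul_ofReal_eq _ hfB, sampleLaw, tsum_bind_mul]
    simp only [tsum_mul_ofReal_eq _ hfB]
    exact hWF F hF0 r w
  have hval0 : 0 ≤ val W η F r w := by
    have : ∀ r w, 0 ≤ val W η F r w := by
      intro r
      induction r with
      | zero => exact hF0
      | succ r ih => exact fun w => Finset.sum_nonneg fun p _ => mul_nonneg (hW.1 _) (ih _)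
    exact this r w
  rw [ENNReal.ofReal_eq_ofReal_iff (Finset.sum_nonneg fun x _ =>
    mul_nonneg ENNReal.toReal_nonneg (hfB x)) hval0] at h1
  simp only [mul_add, Finset.sum_add_distrib, ← Finset.sum_mul, sum_toReal_eq_one, one_mul] at h1
  have h2 : val W η F r w = val W η (fun w => F w - B) r w + B := by
    rw [← val_add_const hW]; simp
  have h3 : ∀ w', (∀ i, w' i ∈ stdSimplex ℝ (Fin q)) →
      |ev (prodLaw w') f - (F w' - B)| ≤ n * (q * (θ * (2 * B))) := by
    intro w' hw'
    obtain ⟨V, hV, hVw, hVF⟩ := tsum_assignLaw hw' L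
    have h4 := hVF _ hfB x₀
    rw [tsum_mul_ofReal_eq _ hfB, ENNReal.ofReal_eq_ofReal_iff (hF0 w')
      (ev_nonneg (prodLaw_mem hV).1 hfB)] at h4
    have h5 := abs_avgs_sub_le hw' hV hVw hfB2 (List.finRange n) x₀
    rw [avgs_finRange hV, avgs_finRange hw', List.length_finRange, ← h4, ev_add,
      ev_const (prodLaw_mem hw'), abs_sub_comm] at h5
    rw [show ev (prodLaw w') f - (F w' - B) = ev (prodLaw w') f + B - F w' by ring]
    exact h5
  have h6 : ∑ p, |P p - W p| ≤ (q ^ q ^ k : ℕ) * θ := by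
    refine (Finset.sum_le_sum fun p _ => show _ ≤ θ by rw [abs_sub_comm]; exact hWP p).trans ?_
    rw [Finset.sum_const, Finset.card_univ, Fintype.card_congr (opEquiv q k), Fintype.card_fin,
      nsmul_eq_mul]
  have h7 := abs_val_sub_val_le (η := η) hP hW (B := B) (fun w' hw' =>
    abs_le.2 ⟨le_ev_of_le (prodLaw_mem hw') fun x => (abs_le.1 (hf x)).1,
    ev_le_of_le (prodLaw_mem hw') fun x => (abs_le.1 (hf x)).2⟩) h3 h6 hB r hw
  rw [show ∑ x, (sampleLaw P η L r w x₀ x).toReal * f x = val W η (fun w => F w - B) r w by linarith,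
    abs_sub_comm]
  exact h7

/-! ### Choice of the parameters -/

/-- Bernoulli's inequality for (1+κ)^r together with (1-κ)(1+κ) ≤ 1. A polynomial decay rate
suffices since r may be any polynomial. -/
theorem one_sub_pow_le {κ : ℝ} (h0 : 0 < κ) (h1 : κ ≤ 1) (r : ℕ) (hr : 0 < r) :
    (1 - κ) ^ r ≤ 1 / (r * κ) := by
  have h2 : (1 - κ) * (1 + κ) ≤ 1 := by nlinarith
  have h3 : (1 - κ) ^ r * (1 + κ) ^ r ≤ 1 := by
    rw [← mul_pow]; exact pow_le_one₀ (mul_nonneg (by linarith) (by linarith)) h2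
  have h4 : 1 + r * κ ≤ (1 + κ) ^ r := one_add_mul_le_pow (by linarith) r
  have h5 : 0 ≤ (1 - κ) ^ r := pow_nonneg (by linarith) r
  have hr' : (0 : ℝ) < r := by exact_mod_cast hr
  rw [le_div_iff₀ (by positivity)]
  nlinarith

theorem half_pow_le {L : ℕ} (hL : 0 < L) : (1 / 2 : ℝ) ^ L ≤ 1 / L := by
  have : (L : ℝ) ≤ 2 ^ L := by exact_mod_cast Nat.lt_two_pow_self.le
  rw [one_div, inv_pow, one_div]
  exact inv_anti₀ (by exact_mod_cast hL) this

/-- The inverse of the threshold below which letters are removed. -/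
def parT (q s : ℕ) : ℕ := 32 * (q + 1) ^ 2 * s * s

/-- The number of operations along a path. -/
def parR (q k s : ℕ) : ℕ := 131072 * (q + 1) ^ 2 * s ^ 5 * parT q s ^ (k + 2)

/-- The number of random bits of a sample. -/
def parL (q k s : ℕ) : ℕ := 64 * s * (parR q k s * q ^ q ^ (k + 2) + s * (q + 1))

/-- The number of samples. -/
def parN (s : ℕ) : ℕ := 192 * s ^ 3

/-- The parameters make each of four errors at most B/(16s): the initial mixture, the merging, the
remaining correlation and the rounding of random bits. -/
theorem abs_mean_sub_convexExtension_le {P : Operation q (k + 2) → ℝ} {f : (Fin n → Fin q) → ℝ}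
    (hP : IsFractionalPolymorphism P f) (ht : IsTransitiveSymmetric P) (hm : IsMeasurePreserving P)
    {B : ℝ} (hB : 0 ≤ B) (hf : ∀ x, |f x| ≤ B) {w : Fin n → Fin q → ℝ}
    (hw : ∀ i, w i ∈ stdSimplex ℝ (Fin q)) (x₀ : Fin n → Fin q) {s : ℕ} (hs : n + 1 ≤ s) :
    |∑ x, (sampleLaw P (1 / parT q s) (parL q k s) (parR q k s) w x₀ x).toReal * f x -
      convexExtension f w| ≤ 1 / (2 * s) * B := by
  have hs1 : (1 : ℝ) ≤ s := by exact_mod_cast (by omega : 1 ≤ s)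
  have hs0 : 0 < s := by omega
  have hsp : (0 : ℝ) < s := by linarith
  have hns : (n : ℝ) ≤ s := by exact_mod_cast (by omega : n ≤ s)
  have hK : (1 : ℝ) ≤ q + 1 := by linarith [Nat.cast_nonneg (α := ℝ) q]
  have hq0 : (0 : ℝ) ≤ q := Nat.cast_nonneg q
  have hT : (parT q s : ℝ) = 32 * (q + 1) ^ 2 * s * s := by rw [parT]; push_cast; ring
  have hT0 : (0 : ℝ) < parT q s := by rw [hT]; positivity
  have hTK : (q : ℝ) + 1 ≤ parT q s := by
    rw [hT]
    have : (1 : ℝ) ≤ s * s := by nlinarith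
    nlinarith [mul_nonneg (by linarith : (0:ℝ) ≤ q + 1) (by linarith : (0:ℝ) ≤ s * s - 1),
      mul_nonneg (sq_nonneg ((q : ℝ) + 1)) (by linarith : (0:ℝ) ≤ s * s - 1)]
  have hη0 : (0 : ℝ) < 1 / parT q s := by positivity
  have hη : (1 : ℝ) / parT q s ≤ 1 / (q + 1) := one_div_le_one_div_of_le (by linarith) hTK
  set δ : ℝ := 1 / (32 * s) with hδ
  have hδ0 : 0 < δ := by positivity
  have hδ1 : δ < 1 := by rw [hδ, div_lt_one (by positivity)]; linarith
  have h1 := abs_val_sub_convexExtension_le hP ht hm hη0 hη hδ0 hδ1 hB hf (parR q k s) hw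
  have h2 := abs_mean_sub_val_le hP.1 (1 / parT q s) (parL q k s) (parR q k s) hB hf hw x₀
  set κ : ℝ := δ * ((1 / parT q s) ^ (k + 2) / 16) with hκ
  have hR : (parR q k s : ℝ) = 131072 * (q + 1) ^ 2 * s ^ 5 * (parT q s : ℝ) ^ (k + 2) := by
    rw [parR]; push_cast; ring
  have hR0 : 0 < parR q k s := by
    have : 0 < parT q s := by exact_mod_cast hT0
    rw [parR]; positivity
  have hκ0 : 0 < κ := by positivity
  have hκ1 : κ ≤ 1 := by
    have h3 : (1 : ℝ) / parT q s ≤ 1 := (div_le_one hT0).2 (hK.trans hTK)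
    have h4 : ((1 : ℝ) / parT q s) ^ (k + 2) ≤ 1 := pow_le_one₀ hη0.le h3
    have h5 : 0 ≤ ((1 : ℝ) / parT q s) ^ (k + 2) := by positivity
    rw [hκ]; nlinarith
  -- 131072 = 32 · 16 · 16²: 32 cancels δ, 16 cancels the contraction constant, and a perfect square
  -- remains under the root.
  have hRκ : (parR q k s : ℝ) * κ = (16 * (q + 1) * s ^ 2) ^ 2 := by
    rw [hR, hκ, hδ, one_div, one_div, inv_pow]
    have : (parT q s : ℝ) ^ (k + 2) ≠ 0 := by positivity
    field_simp; ring
  have e1 : n * (q * √((1 - κ) ^ parR q k s)) ≤ 1 / (16 * s) := by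
    have h3 : √((1 - κ) ^ parR q k s) ≤ 1 / (16 * (q + 1) * s ^ 2) := by
      rw [Real.sqrt_le_left (by positivity), div_pow, one_pow, ← hRκ]
      exact one_sub_pow_le hκ0 hκ1 _ hR0
    calc n * (q * √((1 - κ) ^ parR q k s)) ≤ s * ((q + 1) * (1 / (16 * (q + 1) * s ^ 2))) := by
          gcongr; linarith
      _ = 1 / (16 * s) := by field_simp
  have e2 : 2 * δ = 1 / (16 * s) := by rw [hδ]; field_simp; norm_num
  have e3 : 2 * (((q : ℝ) + 1) * (1 / parT q s * (n * q))) ≤ 1 / (16 * s) := by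
    calc 2 * (((q : ℝ) + 1) * (1 / parT q s * (n * q)))
        ≤ 2 * (((q : ℝ) + 1) * (1 / parT q s * (s * (q + 1)))) := by gcongr; linarith
      _ = 1 / (16 * s) := by rw [hT]; field_simp; norm_num
  have hL0 : 0 < parL q k s := by rw [parL]; positivity
  have hL : (parL q k s : ℝ) = 64 * s * (parR q k s * (q ^ q ^ (k + 2) : ℕ) + s * (q + 1)) := by
    rw [parL]; push_cast; ring
  have e4 : (parR q k s : ℝ) * ((q ^ q ^ (k + 2) : ℕ) * (2 * (1 / 2) ^ parL q k s) * B) +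
      n * (q * (2 * (1 / 2) ^ parL q k s * (2 * B))) ≤ 1 / (16 * s) * B := by
    have h3 := half_pow_le hL0
    have hX : (0 : ℝ) < parR q k s * (q ^ q ^ (k + 2) : ℕ) + s * (q + 1) := by positivity
    have h4 : (1 / 2 : ℝ) ^ parL q k s * (4 * (parR q k s * (q ^ q ^ (k + 2) : ℕ) + s * (q + 1))) ≤
        1 / (16 * s) := by
      refine (mul_le_mul_of_nonneg_right h3 (by positivity)).trans (le_of_eq ?_)
      rw [hL]; field_simp; norm_num
    refine le_trans ?_ (mul_le_mul_of_nonneg_right h4 hB)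
    have h5 : (0 : ℝ) ≤ (1 / 2) ^ parL q k s := by positivity
    have h6 : (n : ℝ) * q ≤ s * (q + 1) := by gcongr; linarith
    have h7 : 0 ≤ (1 / 2 : ℝ) ^ parL q k s * B := by positivity
    have h8 : 0 ≤ (parR q k s : ℝ) * (q ^ q ^ (k + 2) : ℕ) := by positivity
    nlinarith [mul_le_mul_of_nonneg_left h6 h7, mul_nonneg h7 h8]
  refine (abs_sub_le _ _ _).trans ((add_le_add (h2.trans e4) (h1.trans
    (mul_le_mul_of_nonneg_right (add_le_add (add_le_add e2.le e3) e1) hB))).trans ?_)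
  rw [← add_mul]
  refine mul_le_mul_of_nonneg_right ?_ hB
  rw [show 1 / (16 * (s : ℝ)) + (1 / (16 * s) + 1 / (16 * s) + 1 / (16 * s)) = 1 / (4 * s) by
    field_simp; norm_num]
  exact one_div_le_one_div_of_le (by positivity) (by linarith)

/-- With 192 s³ samples and ε ≥ 1/s the exponent is at least 3s ≥ n+3; one of these units absorbs
the factor 2 of the two tails. -/
theorem two_exp_neg_le {n s : ℕ} {ε : ℝ} (hε : 1 / s ≤ ε) (hs : n + 1 ≤ s) :
    2 * Real.exp (-(parN s * ε ^ 2 / 64)) ≤ (1 / 2) ^ (n + 2) := by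
  have hs1 : (0 : ℝ) < s := by exact_mod_cast (by omega : 0 < s)
  have h1 : ((n + 3 : ℕ) : ℝ) ≤ parN s * ε ^ 2 / 64 := by
    have h2 : (1 / s : ℝ) ^ 2 ≤ ε ^ 2 := pow_le_pow_left₀ (by positivity) hε 2
    have h3 : (parN s : ℝ) * (1 / s : ℝ) ^ 2 / 64 = 3 * s := by
      rw [parN]; push_cast; field_simp; norm_num
    have h4 : (parN s : ℝ) * (1 / s : ℝ) ^ 2 / 64 ≤ parN s * ε ^ 2 / 64 := by gcongr
    have h5 : ((n + 3 : ℕ) : ℝ) ≤ 3 * s := by exact_mod_cast (by omega : n + 3 ≤ 3 * s)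
    linarith
  have h2 : Real.exp (-1) ≤ 1 / 2 := by
    have := Real.add_one_le_exp 1
    rw [Real.exp_neg, one_div]
    exact inv_anti₀ (by norm_num) (by linarith)
  calc 2 * Real.exp (-(parN s * ε ^ 2 / 64)) ≤ 2 * Real.exp (((n + 3 : ℕ) : ℝ) * (-1)) := by
        gcongr; linarith
    _ = 2 * Real.exp (-1) ^ (n + 3) := by rw [Real.exp_nat_mul]
    _ ≤ 2 * (1 / 2) ^ (n + 3) := by gcongr
    _ = (1 / 2) ^ (n + 2) := by rw [pow_succ]; ring

/-- The average over all samples is accurate with high probability. -/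
theorem sampleLaw_accurate {P : Operation q (k + 2) → ℝ} {f : (Fin n → Fin q) → ℝ}
    (hP : IsFractionalPolymorphism P f) (ht : IsTransitiveSymmetric P) (hm : IsMeasurePreserving P)
    {w : Fin n → Fin q → ℝ} (hw : ∀ i, w i ∈ stdSimplex ℝ (Fin q)) (x₀ : Fin n → Fin q) {s : ℕ}
    (hs : n + 1 ≤ s) {ε : ℝ} (hε : 1 / s ≤ ε) :
    (iterK (fun _ => addK (sampleLaw P (1 / parT q s) (parL q k s) (parR q k s) w x₀) f)
      (parN s) 0).toOuterMeasure {S | ¬ |S / parN s - convexExtension f w| ≤ ε * ‖f‖} ≤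
      (1 / 2) ^ (n + 2) := by
  have hf : ∀ x, |f x| ≤ ‖f‖ := fun x => norm_le_pi_norm f x
  have hs0 : 0 < s := by omega
  have hsp : (0 : ℝ) < s := by exact_mod_cast hs0
  have hN : (0 : ℝ) < parN s := by rw [parN]; exact_mod_cast by positivity
  have hmean := abs_mean_sub_convexExtension_le hP ht hm (norm_nonneg f) hf hw x₀ hs
  have hε2 : 1 / (2 * s : ℝ) ≤ ε / 2 := by
    rw [show 1 / (2 * s : ℝ) = 1 / s / 2 by field_simp]; linarith
  have hε0 : 0 < ε := lt_of_lt_of_le (by positivity) hε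
  generalize sampleLaw P (1 / parT q s) (parL q k s) (parR q k s) w x₀ = D at *
  -- If f = 0, all samples and the convex extension vanish, so no concentration is needed.
  rcases (norm_nonneg f).eq_or_lt with h0 | hB
  · have hf0 : f = fun _ => 0 := funext fun x => abs_eq_zero.1 (le_antisymm (h0 ▸ hf x) (abs_nonneg _))
    rw [← h0, mul_zero] at hmean
    simp only [hf0, mul_zero, Finset.sum_const_zero, zero_sub, abs_neg] at hmean
    have hc := abs_eq_zero.1 (le_antisymm hmean (abs_nonneg _))
    rw [hf0, iterK_addK_zero, hc, PMF.toOuterMeasure_apply, ENNReal.tsum_eq_zero.2]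
    · exact zero_le
    · intro S
      by_cases hS : S = 0
      · subst hS; simp; positivity
      · simp [Set.indicator_apply, PMF.pure_apply, hS]
  · have := concentration D hB hf (τ := ε / 2 * ‖f‖) (by positivity) (parN s)
    refine le_trans ((iterK (fun _ => addK D f) (parN s) 0).toOuterMeasure.mono fun S hS => ?_)
      (this.trans ?_)
    · simp only [Set.mem_ofPred_eq] at hS ⊢
      refine fun h => hS ?_
      set m := ∑ x, (D x).toReal * f x
      have h1 : |S / parN s - m| ≤ ε / 2 * ‖f‖ := by
        rw [show S / parN s - m = (S - parN s * m) / parN s by field_simp, abs_div,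
          abs_of_pos hN, div_le_iff₀ hN]
        linarith
      have h2 := mul_le_mul_of_nonneg_right hε2 hB.le
      refine (abs_sub_le _ m _).trans ?_
      linarith
    · have h3 : -(parN s * (ε / 2 * ‖f‖) ^ 2 / (16 * ‖f‖ ^ 2)) = -(parN s * ε ^ 2 / 64) := by
        field_simp; ring
      rw [h3]
      refine (ENNReal.ofReal_le_ofReal (two_exp_neg_le hε hs)).trans (le_of_eq ?_)
      rw [ENNReal.ofReal_pow (by norm_num), ENNReal.ofReal_div_of_pos (by norm_num)]
      simp

end Sample

end RealRAM

namespace RealRAM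

/-! ### Tools for verifying programs -/

section Tools

variable {O : Oracle} {p : Program} {T : ℕ} {s s' s'' : Store}

@[simp] theorem setInt_int (s : Store) (d : Addr) (v a : ℕ) :
    (s.setInt d v).int a = if a = d.loc s then v else s.int a := by
  simp [Store.setInt, Function.update_apply]

@[simp] theorem setInt_real (s : Store) (d : Addr) (v a : ℕ) : (s.setInt d v).real a = s.real a := rfl

@[simp] theorem setReal_int (s : Store) (d : Addr) (v : ℝ) (a : ℕ) :
    (s.setReal d v).int a = s.int a := rfl

@[simp] theorem setReal_real (s : Store) (d : Addr) (v : ℝ) (a : ℕ) :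
    (s.setReal d v).real a = if a = d.loc s then v else s.real a := by
  simp [Store.setReal, Function.update_apply]

@[simp] theorem loc_dir (s : Store) (a : ℕ) : (Addr.dir a).loc s = a := rfl

@[simp] theorem loc_ind (s : Store) (a : ℕ) : (Addr.ind a).loc s = s.int a := rfl

@[simp] theorem getInt_eq (s : Store) (a : Addr) : s.getInt a = s.int (a.loc s) := rfl

@[simp] theorem getReal_eq (s : Store) (a : Addr) : s.getReal a = s.real (a.loc s) := rfl

/-- The stores agree outside the integer cells in `I` and the real cells in `R`. -/
def Same (I R : ℕ → Prop) (s s' : Store) : Prop :=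
  (∀ a, ¬ I a → s'.int a = s.int a) ∧ ∀ a, ¬ R a → s'.real a = s.real a

theorem Same.refl {I R : ℕ → Prop} : Same I R s s := ⟨fun _ _ => rfl, fun _ _ => rfl⟩

theorem Same.trans {I R I₁ R₁ I₂ R₂ : ℕ → Prop} (h : Same I₁ R₁ s s') (h' : Same I₂ R₂ s' s'')
    (hI : ∀ a, I₁ a ∨ I₂ a → I a) (hR : ∀ a, R₁ a ∨ R₂ a → R a) : Same I R s s'' :=
  ⟨fun a ha => (h'.1 a fun h => ha (hI a (Or.inr h))).trans (h.1 a fun h => ha (hI a (Or.inl h))),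
    fun a ha => (h'.2 a fun h => ha (hR a (Or.inr h))).trans (h.2 a fun h => ha (hR a (Or.inl h)))⟩

theorem Same.mono {I R I₁ R₁ : ℕ → Prop} (h : Same I₁ R₁ s s') (hI : ∀ a, I₁ a → I a)
    (hR : ∀ a, R₁ a → R a) : Same I R s s' :=
  h.trans (Same.refl (I := I₁) (R := R₁)) (fun a ha => hI a (or_self_iff.1 ha))
    fun a ha => hR a (or_self_iff.1 ha)

theorem Same.setInt {I R : ℕ → Prop} (h : Same I R s s') {d : Addr} {v : ℕ} (hd : I (d.loc s')) :
    Same I R s (s'.setInt d v) :=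
  ⟨fun a ha => by
    rw [setInt_int, if_neg (by rintro rfl; exact ha hd)]; exact h.1 a ha, fun a ha => h.2 a ha⟩

theorem Same.setReal {I R : ℕ → Prop} (h : Same I R s s') {d : Addr} {v : ℝ} (hd : R (d.loc s')) :
    Same I R s (s'.setReal d v) :=
  ⟨fun a ha => h.1 a ha, fun a ha => by
    rw [setReal_real, if_neg (by rintro rfl; exact ha hd)]; exact h.2 a ha⟩

/-- Impossible outcomes have weight 0, so the bound there may be taken to be ⊤. This makes available
that a drawn number lies in [0,1). -/
theorem Spec.support {Ω : Type} {U : PMF Ω} {Post : Ω → Store → Prop} (h : Spec O p T s U Post) :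
    Spec O p T s U fun ω s' => ω ∈ U.support ∧ Post ω s' := by
  classical
  intro bad K T' φ hφ
  refine (h bad K T' (fun ω => if ω ∈ U.support then φ ω else ⊤) fun ω s' hs' => ?_).trans
    (ENNReal.tsum_le_tsum fun ω => ?_)
  · by_cases hω : ω ∈ U.support
    · rw [if_pos hω]; exact hφ ω s' ⟨hω, hs'⟩
    · rw [if_neg hω]; exact le_top
  · by_cases hω : ω ∈ U.support
    · rw [if_pos hω]
    · rw [PMF.mem_support_iff, not_not] at hω; rw [hω, zero_mul, zero_mul]

end Tools

/-! ### The persistent part of the memory -/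

/-- The fixed parameters of the algorithm. -/
structure Params (q k n : ℕ) where
  L : ℕ
  r : ℕ
  N : ℕ
  η : ℝ
  P : Operation q k → ℝ
  w : Fin n → Fin q → ℝ

variable {q k n : ℕ}

/-- The number of operations. -/
def Params.Q (_ : Params q k n) : ℕ := q ^ q ^ k

/-- The first cell of the relocated input. -/
def Params.base (c : Params q k n) : ℕ := c.Q + 20 + 2 * q + n * q

/-- The persistent memory has the right contents. -/
structure Env (c : Params q k n) (s : Store) : Prop where
  int0 : s.int 0 = n
  int1 : s.int 1 = 1
  int3 : s.int 3 = 0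
  int5 : s.int 5 = c.base
  int6 : s.int 6 = c.base + n * q
  int7 : s.int 7 = 32
  zero : s.real (c.Q + 1) = 0
  one : s.real (c.Q + 2) = 1
  half : s.real (c.Q + 3) = 1 / 2
  eta : s.real (c.Q + 4) = c.η
  thr : s.real (c.Q + 5) = 1 / ((q : ℝ) + 1)
  rr : s.real (c.Q + 6) = c.r
  ll : s.real (c.Q + 7) = c.L
  nn : s.real (c.Q + 8) = c.N
  tab : ∀ j : Fin (q ^ q ^ k), s.real (1 + j) = c.P ((opEquiv q k).symm j)
  inp : ∀ (i : Fin n) (a : Fin q), s.real (c.base + (i * q + a)) = c.w i a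

theorem row_lt (i : Fin n) (a : Fin q) : (i : ℕ) * q + a < n * q := by
  have h1 := i.2
  have h2 := a.2
  calc (i : ℕ) * q + a < i * q + q := by omega
    _ = (i + 1) * q := by ring
    _ ≤ n * q := Nat.mul_le_mul_right _ h1

/-- Frame rule. Working code touches integer cells only from 8 on. Its real cells are the
accumulator and counters Q+11 to Q+14, scratch cells, two row registers of length q from Q+20, and
the working array after the relocated input. -/
theorem Env.same {c : Params q k n} {s s' : Store} {I R : ℕ → Prop} (hE : Env c s) (h : Same I R s s')
    (hI : ∀ a, I a → 8 ≤ a) (hR : ∀ a, R a → c.Q + 11 ≤ a ∧ (a < c.base ∨ c.base + n * q ≤ a)) :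
    Env c s' := by
  have hi : ∀ a, a < 8 → s'.int a = s.int a := fun a ha => h.1 a fun h => by
    have := hI a h; omega
  have hr : ∀ a, a < c.Q + 11 → s'.real a = s.real a := fun a ha => h.2 a fun h => by
    have := (hR a h).1; omega
  constructor
  · rw [hi _ (by omega)]; exact hE.int0
  · rw [hi _ (by omega)]; exact hE.int1
  · rw [hi _ (by omega)]; exact hE.int3
  · rw [hi _ (by omega)]; exact hE.int5
  · rw [hi _ (by omega)]; exact hE.int6
  · rw [hi _ (by omega)]; exact hE.int7
  · rw [hr _ (by omega)]; exact hE.zero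
  · rw [hr _ (by omega)]; exact hE.one
  · rw [hr _ (by omega)]; exact hE.half
  · rw [hr _ (by omega)]; exact hE.eta
  · rw [hr _ (by omega)]; exact hE.thr
  · rw [hr _ (by omega)]; exact hE.rr
  · rw [hr _ (by omega)]; exact hE.ll
  · rw [hr _ (by omega)]; exact hE.nn
  · intro j; rw [hr _ (by have : (j : ℕ) < c.Q := j.2; omega)]; exact hE.tab j
  · intro i a
    rw [h.2 _ fun hc => ?_]; · exact hE.inp i a
    have := (hR _ hc).2
    have := row_lt i a
    omega

/-! ### Drawing a random number -/

/-- Do nothing. -/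
def skip : Program := .instr (.constInt (.dir 1) 1)

/-- Draw a random number with `L` binary digits into real cell `Q + 15`. -/
def drawProg (Q : ℕ) : Program :=
  .seq (block [.constReal (.dir (Q + 15)) 0, .addReal (.dir (Q + 14)) (.dir (Q + 7)) (.dir (Q + 1))])
    (.loop (.ltReal (.dir (Q + 1)) (.dir (Q + 14)))
      (.seq (.instr (.subReal (.dir (Q + 14)) (.dir (Q + 14)) (.dir (Q + 2))))
        (.seq (.instr (.flip (.dir 11)))
          (.seq (.branch (.ltInt (.dir 3) (.dir 11))
            (.instr (.addReal (.dir (Q + 15)) (.dir (Q + 15)) (.dir (Q + 2)))) skip)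
            (.instr (.mulReal (.dir (Q + 15)) (.dir (Q + 15)) (.dir (Q + 3))))))))

/-- Cell Q+14 counts the bits still to be drawn. One pass maps u to (u+b)/2, which is `dyStep`, so
the loop realises `dyadic`. -/
theorem drawProg_spec {O : Oracle} {c : Params q k n} {s : Store} (hE : Env c s) :
    Spec O (drawProg c.Q) (c.L * 9 + 6) s (dyadic c.L) fun u s' =>
      s'.real (c.Q + 15) = u ∧ Same (fun a => a = 11) (fun a => a = c.Q + 14 ∨ a = c.Q + 15) s s' := by
  set S : Store → Prop := fun s' =>
    Same (fun a => a = 11) (fun a => a = c.Q + 14 ∨ a = c.Q + 15) s s' with hS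
  have hES : ∀ {s'}, S s' → Env c s' := fun h =>
    hE.same h (by intro a h; omega) (by intro a h; rw [Params.base]; omega)
  refine Spec.mono (DSpec.seq_spec (R := fun s' => s'.real (c.Q + 15) = 0 ∧
    s'.real (c.Q + 14) = c.L ∧ S s') (T₂ := c.L * (8 + 1) + 1)
    (DSpec.block (by simp) (by simp [Instr.IsDet]) ?_) fun s₁ hs₁ =>
    Spec.loop (κ := fun _ => dyStep) (I := fun j u s' => s'.real (c.Q + 15) = u ∧
      s'.real (c.Q + 14) = j ∧ S s') ?_ ?_ c.L 0 s₁ hs₁) ?_ ?_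
  · exact ⟨by simp [Instr.det], by simp [Instr.det, hE.zero, hE.ll],
      (Same.refl.setReal (Or.inr rfl)).setReal (Or.inl rfl)⟩
  · rintro u s' ⟨-, h1, h2⟩
    simp [Test.holds, h1, (hES h2).zero]
  · rintro j u s₂ ⟨h1, h2, h3⟩
    refine ⟨by simp [Test.holds, h2, (hES h3).zero]; positivity, ?_⟩
    refine Spec.mono (T₁ := 1 + (1 + (2 + 1 + 1) + 1) + 1)
      (DSpec.seq_spec (R := fun s' => s'.real (c.Q + 15) = u ∧ s'.real (c.Q + 14) = j ∧ S s')
      (DSpec.instr (by trivial) ?_) fun s₃ hs₃ => ?_) (by omega) fun _ _ h => h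
    · exact ⟨by simp [Instr.det, h1], by simp [Instr.det, h2, (hES h3).one], h3.setReal (Or.inl rfl)⟩
    · obtain ⟨h4, h5, h6⟩ := hs₃
      refine Spec.map (U := PMF.uniformOfFintype (Fin 2))
        (Post := fun (b : Fin 2) s' => s'.real (c.Q + 15) = (u + (b.val : ℝ)) / 2 ∧
          s'.real (c.Q + 14) = j ∧ S s') (fun b : Fin 2 => (u + (b.val : ℝ)) / 2) ?_ fun _ _ h => h
      refine Spec.seq_dspec (T₁ := 1) (T₂ := 2 + 1 + 1)
        (R := fun (b : Fin 2) s' => s' = s₃.setInt (.dir 11) (b : ℕ))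
        (Spec.flip fun b => rfl) fun b s₄ hs₄ => ?_
      subst hs₄
      have hs4 : S (s₃.setInt (.dir 11) b) := h6.setInt rfl
      refine DSpec.seq (R := fun s' => s'.real (c.Q + 15) = u + (b.val : ℝ) ∧
        s'.real (c.Q + 14) = j ∧ S s') (DSpec.branch (fun ht => DSpec.instr (by trivial) ?_)
        fun ht => ?_) fun s₅ hs₅ => DSpec.instr (by trivial) ?_
      · have hb : b.val = 1 := by
          simp [Test.holds, (hES h6).int3] at ht
          omega
        exact ⟨by simp [Instr.det, h4, (hES h6).one, hb], by simp [Instr.det, h5],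
          hs4.setReal (Or.inr rfl)⟩
      · have hb : b.val = 0 := by
          simp [Test.holds, (hES h6).int3] at ht
          omega
        exact DSpec.skip (hES hs4).int1 ⟨by simp [h4, hb], by simp [h5], hs4⟩
      · obtain ⟨h7, h8, h9⟩ := hs₅
        exact ⟨by simp [Instr.det, h7, (hES h9).half]; ring, by simp [Instr.det, h8],
          h9.setReal (Or.inr rfl)⟩
  · simp; omega
  · rintro u s' ⟨h1, -, h2⟩
    exact ⟨h1, h2⟩

end RealRAM

namespace RealRAM

variable {q k n : ℕ} {O : Oracle} {c : Params q k n} {s : Store}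

/-! ### Selecting one of several programs at random -/

/-- Run `act j` for the first `j` such that the sum of the cells `cell, …, cell + j` exceeds the
contents of cell `Q + 15`. -/
def selProg (Q cell : ℕ) (act : ℕ → Program) : ℕ → ℕ → Program
  | 0, _ => skip
  | m + 1, j => .seq (.instr (.subReal (.dir (Q + 15)) (.dir (Q + 15)) (.dir (cell + j))))
      (.branch (.ltReal (.dir (Q + 15)) (.dir (Q + 1))) (act j) (selProg Q cell act m (j + 1)))

/-- Cell Q+15 holds u minus the weights already passed. It first becomes negative at the interval
into which u falls. -/
theorem selProg_spec {Q cell m T : ℕ} {act : ℕ → Program} {v : Fin m → ℝ} (hv : ∀ a, 0 ≤ v a)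
    {u : ℝ} {a : Fin m} (ha : Falls v u a) {Post : Store → Prop} (s₀ : Store)
    (h0 : s₀.real (Q + 1) = 0) (hcell : ∀ a : Fin m, s₀.real (cell + a) = v a)
    (hdisj : ∀ a : Fin m, cell + a ≠ Q + 15)
    (hact : ∀ s', Same (fun _ => False) (fun b => b = Q + 15) s₀ s' → DSpec O (act a) T s' Post)
    (l j : ℕ) (hj : j ≤ a) (hl : l + j = m) (s : Store)
    (hs : Same (fun _ => False) (fun b => b = Q + 15) s₀ s) (hu : s.real (Q + 15) = u - preSum v j) :
    DSpec O (selProg Q cell act l j) (T + 3 * l) s Post := by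
  induction l generalizing j s with
  | zero => have := a.2; omega
  | succ l ih =>
    have hjm : j < m := by omega
    refine DSpec.mono (T₁ := 1 + (T + 3 * l + 1) + 1) (DSpec.seq (R := fun s' =>
      Same (fun _ => False) (fun b => b = Q + 15) s₀ s' ∧ s'.real (Q + 15) = u - preSum v (j + 1))
      (DSpec.instr (by trivial) ?_) ?_) (by omega) fun _ h => h
    · refine ⟨hs.setReal rfl, ?_⟩
      have h1 := preSum_succ v ⟨j, hjm⟩
      have h2 := hs.2 (cell + j) (hdisj ⟨j, hjm⟩)
      have h3 := hcell ⟨j, hjm⟩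
      simp only at h1 h3
      simp [Instr.det, hu, h1, h2, h3]
      ring
    · rintro s' ⟨h1, h2⟩
      have hz : s'.real (Q + 1) = 0 := (h1.2 _ (by omega)).trans h0
      refine DSpec.branch (fun ht => ?_) fun ht => ?_
      · simp [Test.holds, h2, hz] at ht
        have : j = a := by
          by_contra hne
          have := preSum_mono hv (show j + 1 ≤ a by omega)
          linarith [ha.1]
        rw [this]
        exact (hact s' h1).mono (by omega) fun _ h => h
      · simp [Test.holds, h2, hz] at ht
        refine ih (j + 1) ?_ (by omega) s' h1 h2
        by_contra hne
        have : j = a := by omega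
        rw [this] at ht
        linarith [ha.2]

theorem drawSel_spec (hE : Env c s) {cell m T : ℕ} {act : ℕ → Program} {v : Fin m → ℝ}
    (hv : v ∈ stdSimplex ℝ (Fin m)) (hcell : ∀ a : Fin m, s.real (cell + a) = v a)
    (hdisj : ∀ a : Fin m, cell + a < c.Q + 14 ∨ c.Q + 15 < cell + a) {Post : Fin m → Store → Prop}
    (hact : ∀ (a : Fin m) s', Same (fun b => b = 11) (fun b => b = c.Q + 14 ∨ b = c.Q + 15) s s' →
      DSpec O (act a) T s' (Post a)) :
    Spec O (.seq (drawProg c.Q) (selProg c.Q cell act m 0)) (c.L * 9 + 7 + T + 3 * m) s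
      (selLaw v c.L) fun o s' => ∃ a, o = some a ∧ Post a s' := by
  refine Spec.mono (T₁ := c.L * 9 + 6 + (T + 3 * m) + 1) (Spec.map (U := dyadic c.L)
    (Post := fun u s' => ∃ a, sel v u = some a ∧ Post a s') (sel v)
    (Spec.seq_dspec (Post := fun u s' => ∃ a, sel v u = some a ∧ Post a s')
      (drawProg_spec hE).support ?_) fun _ _ h => h) (by omega) fun _ _ h => h
  rintro u s' ⟨hu, h1, h2⟩
  have hu := dyadic_mem hu
  obtain ⟨a, ha⟩ := exists_falls (v := v) hu.1 (by rw [hv.2]; exact hu.2)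
  refine DSpec.mono (selProg_spec hv.1 ha s' ((h2.2 _ (by omega)).trans hE.zero)
    (fun b => (h2.2 _ ?_).trans (hcell b)) (fun b => ?_) (fun s₁ hs₁ => hact a s₁ ?_) m 0 (by omega)
    (by omega) s' Same.refl (by rw [preSum_zero, h1, sub_zero])) le_rfl
    fun s'' hs'' => ⟨a, sel_eq hv.1 ha, hs''⟩
  · have := hdisj b; omega
  · have := hdisj b; omega
  · exact h2.trans hs₁ (by tauto) (by tauto)

/-! ### The rows of the working array -/

/-- Copy the row at the pointer in integer cell `9` to the cells `reg, reg + 1, …`. -/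
def loadRow (q Q reg : ℕ) : Program :=
  seqs (List.ofFn fun a : Fin q => .seq (.instr (.addReal (.dir (reg + a)) (.ind 9) (.dir (Q + 1))))
    (.instr (.addInt (.dir 9) (.dir 9) (.dir 1))))

/-- A copy is an addition of the zero cell Q+1. Once a row sits in a fixed register, the code for
one row uses direct addresses only and can be unrolled over the q letters. -/
theorem loadRow_spec (hE : Env c s) {ptr reg : ℕ} {v : Fin q → ℝ} (hp : s.int 9 = ptr)
    (hr : c.Q + 20 ≤ reg) (hr' : reg + q ≤ c.base) (hb : c.base ≤ ptr)
    (hv : ∀ a : Fin q, s.real (ptr + a) = v a) :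
    DSpec O (loadRow q c.Q reg) (q * 4 + 1) s fun s' => s'.int 9 = ptr + q ∧
      (∀ a : Fin q, s'.real (reg + a) = v a) ∧
      Same (fun a => a = 9) (fun a => reg ≤ a ∧ a < reg + q) s s' := by
  have hES : ∀ {s'}, Same (fun a => a = 9) (fun a => reg ≤ a ∧ a < reg + q) s s' → Env c s' :=
    fun h => hE.same h (by intro a h; omega) (by intro a h; omega)
  refine DSpec.mono (DSpec.seqs (T := 3) (I := fun j s' => s'.int 9 = ptr + j ∧
    (∀ a : Fin q, a < j → s'.real (reg + a) = v a) ∧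
      Same (fun a => a = 9) (fun a => reg ≤ a ∧ a < reg + q) s s')
    (fun j s' h => (hES h.2.2).int1) ?_ ⟨by simpa using hp, by simp, Same.refl⟩) le_rfl
    fun s' h => ⟨h.1, fun a => h.2.1 a a.2, h.2.2⟩
  rintro j s' ⟨h1, h2, h3⟩
  refine DSpec.seq (T₁ := 1) (T₂ := 1) (R := fun s' => s'.int 9 = ptr + j ∧
    (∀ a : Fin q, (a : ℕ) < j + 1 → s'.real (reg + a) = v a) ∧
      Same (fun a => a = 9) (fun a => reg ≤ a ∧ a < reg + q) s s')
    (DSpec.instr (by trivial) ⟨?_, ?_, h3.setReal ?_⟩) ?_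
  · simpa [Instr.det] using h1
  · intro a ha
    have hj := j.2
    by_cases haj : a = j
    · subst haj
      simp [Instr.det, h1, (hES h3).zero]
      rw [h3.2 _ (by omega), hv]
    · have : (a : ℕ) ≠ j := fun h => haj (Fin.ext h)
      simp [Instr.det, this]
      exact h2 a (by omega)
  · have := j.2
    simp
  · rintro s₁ ⟨h4, h5, h6⟩
    refine DSpec.instr (by trivial) ⟨?_, fun a ha => by simpa [Instr.det] using h5 a ha, h6.setInt rfl⟩
    simp [Instr.det, h4, (hES h6).int1]; omega

/-- Copy the second row register to the row at the pointer in integer cell `10`. -/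
def storeRow (q Q : ℕ) : Program :=
  seqs (List.ofFn fun a : Fin q =>
    .seq (.instr (.addReal (.ind 10) (.dir (Q + 20 + q + a)) (.dir (Q + 1))))
      (.instr (.addInt (.dir 10) (.dir 10) (.dir 1))))

theorem storeRow_spec (hE : Env c s) {ptr : ℕ} {v : Fin q → ℝ} (hp : s.int 10 = ptr)
    (hb : c.base + n * q ≤ ptr) (hv : ∀ a : Fin q, s.real (c.Q + 20 + q + a) = v a) :
    DSpec O (storeRow q c.Q) (q * 4 + 1) s fun s' => s'.int 10 = ptr + q ∧
      (∀ a : Fin q, s'.real (ptr + a) = v a) ∧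
      Same (fun a => a = 10) (fun a => ptr ≤ a ∧ a < ptr + q) s s' := by
  have hB : c.base = c.Q + 20 + 2 * q + n * q := rfl
  have hES : ∀ {s'}, Same (fun a => a = 10) (fun a => ptr ≤ a ∧ a < ptr + q) s s' → Env c s' :=
    fun h => hE.same h (by intro a h; omega) (by intro a h; omega)
  refine DSpec.mono (DSpec.seqs (T := 3) (I := fun j s' => s'.int 10 = ptr + j ∧
    (∀ a : Fin q, a < j → s'.real (ptr + a) = v a) ∧
      Same (fun a => a = 10) (fun a => ptr ≤ a ∧ a < ptr + q) s s')
    (fun j s' h => (hES h.2.2).int1) ?_ ⟨by simpa using hp, by simp, Same.refl⟩) le_rfl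
    fun s' h => ⟨h.1, fun a => h.2.1 a a.2, h.2.2⟩
  rintro j s' ⟨h1, h2, h3⟩
  refine DSpec.seq (T₁ := 1) (T₂ := 1) (R := fun s' => s'.int 10 = ptr + j ∧
    (∀ a : Fin q, (a : ℕ) < j + 1 → s'.real (ptr + a) = v a) ∧
      Same (fun a => a = 10) (fun a => ptr ≤ a ∧ a < ptr + q) s s')
    (DSpec.instr (by trivial) ⟨?_, ?_, h3.setReal ?_⟩) ?_
  · simpa [Instr.det] using h1
  · intro a ha
    have hj := j.2
    by_cases haj : a = j
    · subst haj
      simp [Instr.det, h1, (hES h3).zero]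
      rw [h3.2 _ (by omega), hv]
    · have : (a : ℕ) ≠ j := fun h => haj (Fin.ext h)
      simp [Instr.det, this, h1]
      exact h2 a (by omega)
  · have := j.2
    simp [h1]
  · rintro s₁ ⟨h4, h5, h6⟩
    refine DSpec.instr (by trivial) ⟨?_, fun a ha => by simpa [Instr.det] using h5 a ha, h6.setInt rfl⟩
    simp [Instr.det, h4, (hES h6).int1]; omega

end RealRAM

namespace RealRAM

variable {q k n : ℕ} {O : Oracle} {c : Params q k n} {s : Store}

/-! ### One step of the path on a row register -/

/-- Set the light entries of the row register to zero and collect their mass. -/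
def cutRow (q Q : ℕ) : Program :=
  seqs (List.ofFn fun a : Fin q => .branch (.ltReal (.dir (Q + 20 + a)) (.dir (Q + 4)))
    (.seq (.instr (.addReal (.dir (Q + 17)) (.dir (Q + 17)) (.dir (Q + 20 + a))))
      (.instr (.constReal (.dir (Q + 20 + a)) 0))) skip)

/-- Give the collected mass to the first heavy entry of the row register. -/
def fillRow (q Q : ℕ) : Program :=
  seqs (List.ofFn fun a : Fin q => .branch (.ltReal (.dir (Q + 20 + a)) (.dir (Q + 5))) skip
    (.seq (.instr (.addReal (.dir (Q + 20 + a)) (.dir (Q + 20 + a)) (.dir (Q + 17))))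
      (.instr (.constReal (.dir (Q + 17)) 0))))

theorem cutRow_spec (hE : Env c s) {v : Fin q → ℝ} (hv : ∀ a : Fin q, s.real (c.Q + 20 + a) = v a)
    (h0 : s.real (c.Q + 17) = 0) :
    DSpec O (cutRow q c.Q) (q * 5 + 1) s fun s' => s'.real (c.Q + 17) = lightMass c.η v ∧
      (∀ a : Fin q, s'.real (c.Q + 20 + a) = if v a < c.η then 0 else v a) ∧
      Same (fun _ => False) (fun a => c.Q + 17 ≤ a ∧ a < c.Q + 20 + q) s s' := by
  have hB : c.base = c.Q + 20 + 2 * q + n * q := rfl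
  have hES : ∀ {s'}, Same (fun _ => False) (fun a => c.Q + 17 ≤ a ∧ a < c.Q + 20 + q) s s' →
    Env c s' := fun h => hE.same h (fun _ h => h.elim) (by intro a h; omega)
  refine DSpec.mono (DSpec.seqs (T := 4)
    (I := fun j s' => s'.real (c.Q + 17) = preSum (fun a => if v a < c.η then v a else 0) j ∧
    (∀ a : Fin q, s'.real (c.Q + 20 + a) = if (a : ℕ) < j ∧ v a < c.η then 0 else v a) ∧
      Same (fun _ => False) (fun a => c.Q + 17 ≤ a ∧ a < c.Q + 20 + q) s s')
    (fun j s' h => (hES h.2.2).int1) ?_ ⟨by rw [h0, preSum_zero], by simpa using hv, Same.refl⟩) le_rfl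
    fun s' h => ⟨by rw [h.1, preSum_last]; rfl, fun a => by simp [h.2.1 a], h.2.2⟩
  rintro j s' ⟨h1, h2, h3⟩
  have hj := j.2
  have h2j := h2 j
  simp only [lt_irrefl, false_and, if_false] at h2j
  refine DSpec.branch (fun ht => ?_) fun ht => ?_
  · have hvj : v j < c.η := by simpa [Test.holds, h2j, (hES h3).eta] using ht
    refine DSpec.seq (T₁ := 1) (T₂ := 1) (R := fun s' =>
      s'.real (c.Q + 17) = preSum (fun a => if v a < c.η then v a else 0) (j + 1) ∧
      (∀ a : Fin q, s'.real (c.Q + 20 + a) = if (a : ℕ) < j ∧ v a < c.η then 0 else v a) ∧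
      Same (fun _ => False) (fun a => c.Q + 17 ≤ a ∧ a < c.Q + 20 + q) s s')
      (DSpec.instr (by trivial) ⟨?_, fun a => ?_, h3.setReal ?_⟩) ?_
    · rw [preSum_succ]; simp [Instr.det, h1, h2j, hvj]
    · simpa [Instr.det, show c.Q + 20 + (a : ℕ) ≠ c.Q + 17 by omega] using h2 a
    · simp; omega
    · rintro s₁ ⟨h4, h5, h6⟩
      refine DSpec.instr (by trivial) ⟨?_, fun a => ?_, h6.setReal ?_⟩
      · simpa [Instr.det, show c.Q + 17 ≠ c.Q + 20 + (j : ℕ) by omega] using h4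
      · by_cases haj : a = j
        · subst haj; simp [Instr.det, hvj]
        · have : (a : ℕ) ≠ j := fun h => haj (Fin.ext h)
          simp [Instr.det, this, h5, show (a : ℕ) < j + 1 ↔ (a : ℕ) < j by omega]
      · simp; omega
  · have hvj : ¬ v j < c.η := by simpa [Test.holds, h2j, (hES h3).eta] using ht
    refine (DSpec.skip (hES h3).int1 ⟨?_, fun a => ?_, h3⟩).mono (by omega) fun _ h => h
    · rw [preSum_succ, h1]; simp [hvj]
    · rw [h2]
      by_cases haj : a = j
      · subst haj; simp [hvj]
      · have : (a : ℕ) ≠ j := fun h => haj (Fin.ext h)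
        simp [show (a : ℕ) < j + 1 ↔ (a : ℕ) < j by omega]

/-- The first heavy entry empties cell Q+17, so later heavy entries receive 0. The invariant says
that the mass is still there exactly when no heavy letter has been met. -/
theorem fillRow_spec (hE : Env c s) (hη : 0 < c.η) (hη' : c.η ≤ 1 / ((q : ℝ) + 1)) {v : Fin q → ℝ}
    (hv : ∀ a : Fin q, s.real (c.Q + 20 + a) = if v a < c.η then 0 else v a)
    (h0 : s.real (c.Q + 17) = lightMass c.η v) :
    DSpec O (fillRow q c.Q) (q * 5 + 1) s fun s' =>
      (∀ a : Fin q, s'.real (c.Q + 20 + a) = killRow c.η v a) ∧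
      Same (fun _ => False) (fun a => c.Q + 17 ≤ a ∧ a < c.Q + 20 + q) s s' := by
  classical
  have hB : c.base = c.Q + 20 + 2 * q + n * q := rfl
  have hES : ∀ {s'}, Same (fun _ => False) (fun a => c.Q + 17 ≤ a ∧ a < c.Q + 20 + q) s s' →
    Env c s' := fun h => hE.same h (fun _ h => h.elim) (by intro a h; omega)
  -- Clearing the light entries does not change which entries pass the heavy threshold, because η ≤
  -- 1/(q+1).
  have hthr : ∀ a, (if v a < c.η then 0 else v a) < 1 / ((q : ℝ) + 1) ↔ v a < 1 / ((q : ℝ) + 1) := by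
    intro a
    split_ifs with h
    · exact iff_of_true (hη.trans_le hη') (h.trans_le hη')
    · exact Iff.rfl
  refine DSpec.mono (DSpec.seqs (T := 4) (I := fun j s' =>
    s'.real (c.Q + 17) = (if ∀ b : Fin q, (b : ℕ) < j → v b < 1 / ((q : ℝ) + 1) then
      lightMass c.η v else 0) ∧
    (∀ a : Fin q, s'.real (c.Q + 20 + a) =
      if (a : ℕ) < j then killRow c.η v a else if v a < c.η then 0 else v a) ∧
      Same (fun _ => False) (fun a => c.Q + 17 ≤ a ∧ a < c.Q + 20 + q) s s')
    (fun j s' h => (hES h.2.2).int1) ?_ ⟨by simpa using h0, by simpa using hv, Same.refl⟩) le_rfl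
    fun s' h => ⟨fun a => by simp [h.2.1 a], h.2.2⟩
  rintro j s' ⟨h1, h2, h3⟩
  have hj := j.2
  have h2j := h2 j
  simp only [lt_irrefl, if_false] at h2j
  have hnext : (∀ b : Fin q, (b : ℕ) < j + 1 → v b < 1 / ((q : ℝ) + 1)) ↔
      (∀ b : Fin q, (b : ℕ) < j → v b < 1 / ((q : ℝ) + 1)) ∧ v j < 1 / ((q : ℝ) + 1) := by
    refine ⟨fun h => ⟨fun b hb => h b (by omega), h j (by omega)⟩, fun h b hb => ?_⟩
    by_cases hbj : b = j
    · subst hbj; exact h.2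
    · have : (b : ℕ) ≠ j := fun h => hbj (Fin.ext h)
      exact h.1 b (by omega)
  refine DSpec.branch (fun ht => ?_) fun ht => ?_
  · have hvj : v j < 1 / ((q : ℝ) + 1) := by
      rw [← hthr]; simpa only [Test.holds, getReal_eq, loc_dir, h2j, (hES h3).thr] using ht
    refine (DSpec.skip (hES h3).int1 ⟨?_, fun a => ?_, h3⟩).mono (by omega) fun _ h => h
    · rw [h1]; simp only [hnext, hvj, and_true]
    · rw [h2]
      by_cases haj : a = j
      · subst haj
        have : ¬ FirstHeavy v a := fun h => absurd hvj (not_lt.2 h.1)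
        simp [killRow, this]
      · have : (a : ℕ) ≠ j := fun h => haj (Fin.ext h)
        simp [show (a : ℕ) < j + 1 ↔ (a : ℕ) < j by omega]
  · have hvj : ¬ v j < 1 / ((q : ℝ) + 1) := by
      rw [← hthr]; simpa only [Test.holds, getReal_eq, loc_dir, h2j, (hES h3).thr] using ht
    refine DSpec.seq (T₁ := 1) (T₂ := 1) (R := fun s' =>
      (∀ a : Fin q, s'.real (c.Q + 20 + a) =
        if (a : ℕ) < j + 1 then killRow c.η v a else if v a < c.η then 0 else v a) ∧
      Same (fun _ => False) (fun a => c.Q + 17 ≤ a ∧ a < c.Q + 20 + q) s s')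
      (DSpec.instr (by trivial) ⟨fun a => ?_, h3.setReal ?_⟩) ?_
    · by_cases haj : a = j
      · subst haj
        have : FirstHeavy v a ↔ ∀ b : Fin q, (b : ℕ) < a → v b < 1 / ((q : ℝ) + 1) :=
          ⟨fun h b hb => h.2 b hb, fun h => ⟨not_lt.1 hvj, fun b hb => h b hb⟩⟩
        simp only [Instr.det, setReal_real, loc_dir, getReal_eq, h2j, h1, killRow, this, if_true,
          Nat.lt_succ_self]
      · have : (a : ℕ) ≠ j := fun h => haj (Fin.ext h)
        simp [Instr.det, this, h2, show (a : ℕ) < j + 1 ↔ (a : ℕ) < j by omega]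
    · simp; omega
    · rintro s₁ ⟨h5, h6⟩
      refine DSpec.instr (by trivial) ⟨?_, fun a => ?_, h6.setReal ?_⟩
      · rw [if_neg (by rw [hnext]; exact fun h => hvj h.2)]
        simp [Instr.det]
      · simpa [Instr.det, show c.Q + 20 + (a : ℕ) ≠ c.Q + 17 by omega] using h5 a
      · simp; omega

/-- Multiply out the weight of the tuple `x` and add it to the entry of its value. -/
def termProg (Q : ℕ) (p : Operation q k) (x : Fin k → Fin q) : Program :=
  .seq (.instr (.constReal (.dir (Q + 16)) 1))
    (.seq (seqs (List.ofFn fun j : Fin k =>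
      .instr (.mulReal (.dir (Q + 16)) (.dir (Q + 16)) (.dir (Q + 20 + x j)))))
      (.instr (.addReal (.dir (Q + 20 + q + p x)) (.dir (Q + 20 + q + p x)) (.dir (Q + 16)))))

/-- Set the second row register to the law of the operation applied to independent letters. -/
def meanRow (Q : ℕ) (p : Operation q k) : Program :=
  .seq (seqs (List.ofFn fun a : Fin q => .instr (.constReal (.dir (Q + 20 + q + a)) 0)))
    (seqs ((Finset.univ : Finset (Fin k → Fin q)).toList.map (termProg Q p)))

theorem termProg_spec (hE : Env c s) (p : Operation q k) (x : Fin k → Fin q) {v u : Fin q → ℝ}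
    (hv : ∀ a : Fin q, s.real (c.Q + 20 + a) = v a)
    (hu : ∀ a : Fin q, s.real (c.Q + 20 + q + a) = u a) :
    DSpec O (termProg c.Q p x) (k * 2 + 5) s fun s' =>
      (∀ a : Fin q, s'.real (c.Q + 20 + q + a) = u a + if p x = a then powLaw k v x else 0) ∧
      Same (fun _ => False)
        (fun a => a = c.Q + 16 ∨ (c.Q + 20 + q ≤ a ∧ a < c.Q + 20 + 2 * q)) s s' := by
  have hB : c.base = c.Q + 20 + 2 * q + n * q := rfl
  have hS : ∀ {s'}, Same (fun _ => False) (fun a => a = c.Q + 16) s s' → Env c s' := fun h =>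
    hE.same h (fun _ h => h.elim) (by intro a h; omega)
  refine DSpec.mono (DSpec.seq (T₁ := 1) (T₂ := k * (1 + 1) + 1 + 1 + 1) (R := fun s' =>
    s'.real (c.Q + 16) = 1 ∧ Same (fun _ => False) (fun a => a = c.Q + 16) s s')
    (DSpec.instr (by trivial) ⟨by simp [Instr.det], Same.refl.setReal rfl⟩) fun s₁ h₁ =>
    DSpec.seq (DSpec.seqs (I := fun j s' => s'.real (c.Q + 16) = ∏ i : Fin k with i.val < j, v (x i) ∧
      Same (fun _ => False) (fun a => a = c.Q + 16) s s') (fun j s' h => (hS h.2).int1) ?_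
      ⟨?_, h₁.2⟩) fun s₂ h₂ => DSpec.instr (by trivial) ?_) (by omega) fun _ h => h
  · rintro j s' ⟨h1, h2⟩
    refine DSpec.instr (by trivial) ⟨?_, h2.setReal rfl⟩
    have : (Finset.univ.filter fun i : Fin k => i.val < (j : ℕ) + 1) =
        insert j (Finset.univ.filter fun i : Fin k => i.val < (j : ℕ)) := by
      ext i; simp [Fin.ext_iff]; omega
    rw [this, Finset.prod_insert (by simp)]
    simp [Instr.det, h1, mul_comm]
    left
    rw [h2.2 _ (by omega), hv]
  · simpa using h₁.1
  · have h3 : s₂.real (c.Q + 16) = powLaw k v x := by simpa [powLaw] using h₂.1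
    refine ⟨fun a => ?_, (h₂.2.mono (by tauto) (by tauto)).setReal ?_⟩
    · have h4 : s₂.real (c.Q + 20 + q + a) = u a := (h₂.2.2 _ (by omega)).trans (hu a)
      by_cases hpa : p x = a
      · subst hpa
        simp [Instr.det, h3, h4]
      · have : (a : ℕ) ≠ p x := fun h => hpa (Fin.ext h.symm)
        simp [Instr.det, h4, hpa, this]
    · have := (p x).2
      simp; omega

/-- The sum over all q^k tuples is unrolled in the program text; its length depends on q and k only.
-/
theorem meanRow_spec (hE : Env c s) (p : Operation q k) {v : Fin q → ℝ}
    (hv : ∀ a : Fin q, s.real (c.Q + 20 + a) = v a) :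
    DSpec O (meanRow c.Q p) (q * 2 + q ^ k * (k * 2 + 6) + 3) s fun s' =>
      (∀ a : Fin q, s'.real (c.Q + 20 + q + a) = opRow p v a) ∧
      Same (fun _ => False)
        (fun a => a = c.Q + 16 ∨ (c.Q + 20 + q ≤ a ∧ a < c.Q + 20 + 2 * q)) s s' := by
  have hB : c.base = c.Q + 20 + 2 * q + n * q := rfl
  set S : Store → Prop := fun s' => Same (fun _ => False)
    (fun a => a = c.Q + 16 ∨ (c.Q + 20 + q ≤ a ∧ a < c.Q + 20 + 2 * q)) s s' with hS
  have hES : ∀ {s'}, S s' → Env c s' := fun h =>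
    hE.same h (fun _ h => h.elim) (by intro a h; omega)
  have hcard : ((Finset.univ : Finset (Fin k → Fin q)).toList).length = q ^ k := by simp
  refine DSpec.mono (DSpec.seq (DSpec.seqs (T := 1) (I := fun j s' =>
    (∀ a : Fin q, (a : ℕ) < j → s'.real (c.Q + 20 + q + a) = 0) ∧ S s')
    (fun j s' h => (hES h.2).int1) ?_ ⟨by simp, Same.refl⟩) fun s₁ h₁ =>
    DSpec.seqs_list (T := k * 2 + 5) (I := fun l s' => (∀ a : Fin q, s'.real (c.Q + 20 + q + a) =
      (l.map fun x => if p x = a then powLaw k v x else 0).sum) ∧ S s')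
      (fun j s' h => (hES h.2).int1) ?_ _ [] ?_) ?_ ?_
  · rintro j s' ⟨h1, h2⟩
    have := j.2
    refine DSpec.instr (by trivial) ⟨fun a ha => ?_, h2.setReal ?_⟩
    · by_cases haj : a = j
      · subst haj; simp [Instr.det]
      · have : (a : ℕ) ≠ j := fun h => haj (Fin.ext h)
        simp [Instr.det, this]
        exact h1 a (by omega)
    · simp; omega
  · rintro l x s' ⟨h1, h2⟩
    refine (termProg_spec (hES h2) p x (fun a => (h2.2 _ (by have := a.2; omega)).trans (hv a)) h1).mono
      le_rfl fun s'' h => ⟨fun a => ?_, h2.trans h.2 (by tauto) (by tauto)⟩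
    rw [h.1 a]; simp
  · exact ⟨fun a => by simpa using h₁.1 a a.2, h₁.2⟩
  · rw [hcard]; exact le_of_eq (by ring)
  · rintro s' ⟨h1, h2⟩
    refine ⟨fun a => ?_, h2⟩
    rw [h1 a, List.nil_append, Finset.sum_map_toList, opRow, push, Finset.sum_filter]

/-- Apply the operation `p` to one row of the working array. -/
def rowProg (Q : ℕ) (p : Operation q k) : Program :=
  .seq (loadRow q Q (Q + 20)) (.seq (.instr (.constReal (.dir (Q + 17)) 0)) (.seq (cutRow q Q)
    (.seq (fillRow q Q) (.seq (meanRow Q p) (storeRow q Q)))))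

/-- Running time of `rowProg`. -/
def rowCost (q k : ℕ) : ℕ := q * 20 + q ^ k * (k * 2 + 6) + 13

theorem rowProg_spec (hE : Env c s) (hη : 0 < c.η) (hη' : c.η ≤ 1 / ((q : ℝ) + 1))
    (p : Operation q k) {ptr : ℕ} {v : Fin q → ℝ} (hp : s.int 9 = ptr) (hp' : s.int 10 = ptr)
    (hb : c.base + n * q ≤ ptr) (hv : ∀ a : Fin q, s.real (ptr + a) = v a) :
    DSpec O (rowProg c.Q p) (rowCost q k) s fun s' => s'.int 9 = ptr + q ∧ s'.int 10 = ptr + q ∧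
      (∀ a : Fin q, s'.real (ptr + a) = opRow p (killRow c.η v) a) ∧
      Same (fun a => a = 9 ∨ a = 10)
        (fun a => c.Q + 14 ≤ a ∧ a < c.Q + 20 + 2 * q ∨ ptr ≤ a ∧ a < ptr + q) s s' := by
  have hB : c.base = c.Q + 20 + 2 * q + n * q := rfl
  have hES : ∀ {s'}, Same (fun a => a = 9 ∨ a = 10)
      (fun a => c.Q + 14 ≤ a ∧ a < c.Q + 20 + 2 * q) s s' → Env c s' :=
    fun h => hE.same h (by intro a h; omega) (by intro a h; omega)
  set S : Store → Prop := fun s' => s'.int 9 = ptr + q ∧ s'.int 10 = ptr ∧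
    Same (fun a => a = 9 ∨ a = 10) (fun a => c.Q + 14 ≤ a ∧ a < c.Q + 20 + 2 * q) s s' with hS
  have hSS : ∀ {s₁ s₂ : Store} {R : ℕ → Prop}, S s₁ → Same (fun _ => False) R s₁ s₂ →
      (∀ a, R a → c.Q + 14 ≤ a ∧ a < c.Q + 20 + 2 * q) → S s₂ := fun h1 h2 hR =>
    ⟨(h2.1 _ id).trans h1.1, (h2.1 _ id).trans h1.2.1,
      h1.2.2.trans h2 (fun a h => h.elim id False.elim) fun a h => h.elim id (hR a)⟩
  refine DSpec.mono (DSpec.seq (loadRow_spec hE hp le_rfl (by omega) (by omega) hv) fun s₁ h₁ => DSpec.seq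
    (R := fun s' => (∀ a : Fin q, s'.real (c.Q + 20 + a) = v a) ∧ s'.real (c.Q + 17) = 0 ∧ S s')
    (DSpec.instr (by trivial) ?_) fun s₂ h₂ =>
    DSpec.seq (cutRow_spec (hES h₂.2.2.2.2) h₂.1 h₂.2.1) fun s₃ h₃ => ?_)
    (T₁ := q * 4 + 1 + (1 + (q * 5 + 1 + (q * 5 + 1 + (q * 2 + q ^ k * (k * 2 + 6) + 3 +
      (q * 4 + 1) + 1) + 1) + 1) + 1) + 1)
    (by rw [rowCost]; omega) fun _ h => h
  · have hs : S s₁ := ⟨h₁.1, (h₁.2.2.1 _ (by omega)).trans hp',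
      h₁.2.2.mono (by tauto) (by intro a h; omega)⟩
    refine ⟨fun a => ?_, by simp [Instr.det], hSS hs (Same.refl.setReal (R := fun a => a = c.Q + 17) rfl)
      (by intro a h; omega)⟩
    simpa [Instr.det, show c.Q + 20 + (a : ℕ) ≠ c.Q + 17 by omega] using h₁.2.1 a
  · have hs₃ : S s₃ := hSS h₂.2.2 h₃.2.2 (by intro a h; omega)
    refine DSpec.seq (fillRow_spec (hES hs₃.2.2) hη hη' h₃.2.1 h₃.1) fun s₄ h₄ => ?_
    have hs₄ : S s₄ := hSS hs₃ h₄.2 (by intro a h; omega)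
    refine DSpec.seq (meanRow_spec (hES hs₄.2.2) p h₄.1) fun s₅ h₅ => ?_
    have hs₅ : S s₅ := hSS hs₄ h₅.2 (by intro a h; omega)
    refine (storeRow_spec (hES hs₅.2.2) hs₅.2.1 hb h₅.1).mono le_rfl fun s₆ h₆ =>
      ⟨(h₆.2.2.1 _ (by omega)).trans hs₅.1, h₆.1, fun a => ?_,
        hs₅.2.2.trans h₆.2.2 (by tauto) (by tauto)⟩
    rw [h₆.2.1 a]

end RealRAM

namespace RealRAM

variable {q k n : ℕ} {O : Oracle} {c : Params q k n} {s : Store}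

/-! ### The random path -/

/-- The working array holds `w'`. -/
def Work (c : Params q k n) (w' : Fin n → Fin q → ℝ) (s : Store) : Prop :=
  ∀ (i : Fin n) (a : Fin q), s.real (c.base + n * q + (i * q + a)) = w' i a

/-- The real cells that are changed by a step of the path. -/
def Params.Scratch (c : Params q k n) (a : ℕ) : Prop :=
  c.Q + 14 ≤ a ∧ a < c.base ∨ c.base + n * q ≤ a

theorem Work.same {w' : Fin n → Fin q → ℝ} {s' : Store} {I R : ℕ → Prop} (hw : Work c w' s)
    (h : Same I R s s') (hR : ∀ a, R a → a < c.base + n * q) : Work c w' s' := fun i a => by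
  rw [h.2 _ fun hc => by have := hR _ hc; omega]; exact hw i a

theorem row_disjoint {i i' : ℕ} (h : i ≠ i') (a : Fin q) :
    i' * q + a < i * q ∨ i * q + q ≤ i' * q + a := by
  have ha := a.2
  rcases Nat.lt_or_gt_of_ne h with h | h
  · have := Nat.mul_le_mul_right q (Nat.succ_le_of_lt h)
    rw [Nat.succ_mul] at this
    omega
  · have := Nat.mul_le_mul_right q (Nat.succ_le_of_lt h)
    rw [Nat.succ_mul] at this
    omega

/-- Set the counter in integer cell `8` to zero and the pointers in the integer cells `9` and `10`
to the numbers in the cells `a` and `6`. -/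
def rowsProg (a : ℕ) (body : Program) : Program :=
  .seq (block [.addInt (.dir 9) (.dir a) (.dir 3), .addInt (.dir 10) (.dir 6) (.dir 3),
    .addInt (.dir 8) (.dir 3) (.dir 3)])
    (.loop (.ltInt (.dir 8) (.dir 0)) (.seq body (.instr (.addInt (.dir 8) (.dir 8) (.dir 1)))))

/-- Copying the input and applying an operation share this loop over the n rows. In the invariant
the rows below the counter already hold w₁ and the others still hold w₀. -/
theorem rowsProg_spec (hE : Env c s) {a src : ℕ} (hsrc : s.int a = src) (ha : a = 5 ∨ a = 6)
    {T : ℕ} {body : Program} {w₀ w₁ : Fin n → Fin q → ℝ} (hw₀ : Work c w₀ s)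
    (hbody : ∀ (i : Fin n) (s₁ : Store), Same (fun a => 8 ≤ a ∧ a < 32) c.Scratch s s₁ →
      s₁.int 9 = src + i * q → s₁.int 10 = c.base + n * q + i * q →
      (∀ a : Fin q, s₁.real (c.base + n * q + i * q + a) = w₀ i a) →
      DSpec O body T s₁ fun s₂ => s₂.int 9 = src + i * q + q ∧
        s₂.int 10 = c.base + n * q + i * q + q ∧
        (∀ a : Fin q, s₂.real (c.base + n * q + i * q + a) = w₁ i a) ∧
        Same (fun a => a = 9 ∨ a = 10) (fun a => c.Q + 14 ≤ a ∧ a < c.Q + 20 + 2 * q ∨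
          c.base + n * q + i * q ≤ a ∧ a < c.base + n * q + i * q + q) s₁ s₂) :
    DSpec O (rowsProg a body) (n * (T + 3) + 8) s fun s' =>
      Work c w₁ s' ∧ Same (fun a => 8 ≤ a ∧ a < 32) c.Scratch s s' := by
  have hB : c.base = c.Q + 20 + 2 * q + n * q := rfl
  have hES : ∀ {s'}, Same (fun a => 8 ≤ a ∧ a < 32) c.Scratch s s' → Env c s' := fun h =>
    hE.same h (by intro a h; omega) (by intro a h; rw [Params.Scratch] at h; omega)
  set I : ℕ → Store → Prop := fun j s' => s'.int 8 + j = n ∧ s'.int 9 = src + s'.int 8 * q ∧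
    s'.int 10 = c.base + n * q + s'.int 8 * q ∧
    (∀ (i : Fin n) (a : Fin q), s'.real (c.base + n * q + (i * q + a)) =
      if (i : ℕ) < s'.int 8 then w₁ i a else w₀ i a) ∧
    Same (fun a => 8 ≤ a ∧ a < 32) c.Scratch s s' with hI
  refine DSpec.mono (DSpec.seq (R := I n) (DSpec.block (by simp) (by simp [Instr.IsDet]) ?_)
    fun s₁ h₁ => DSpec.loop (T := T + 2) (I := I) ?_ ?_ n s₁ h₁)
    (by simp only [List.length_cons, List.length_nil]; ring_nf; omega) ?_
  · refine ⟨?_, ?_, ?_, ?_, ?_⟩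
    · simp [Instr.det, hE.int3]
    · rcases ha with rfl | rfl <;> simp [Instr.det, hE.int3, hsrc]
    · simp [Instr.det, hE.int3, hE.int6]
    · intro i a
      simpa [Instr.det, hE.int3] using hw₀ i a
    · exact ((Same.refl.setInt (by simp)).setInt (by simp)).setInt (by simp)
  · rintro s' ⟨h1, -, -, -, h5⟩
    simp [Test.holds, (hES h5).int0]; omega
  · rintro j s' ⟨h1, h2, h3, h4, h5⟩
    refine ⟨by simp [Test.holds, (hES h5).int0]; omega, ?_⟩
    have hlt : s'.int 8 < n := by omega
    set i : Fin n := ⟨s'.int 8, hlt⟩ with hi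
    have hi' : (i : ℕ) = s'.int 8 := rfl
    refine DSpec.mono (DSpec.seq (T₂ := 1) (hbody i s' h5 h2 h3 fun a => ?_) fun s₂ h₂ =>
      DSpec.instr (by trivial) ?_) (by omega) fun _ h => h
    · rw [add_assoc, h4, if_neg (by omega)]
    · obtain ⟨h6, h7, h8, h9⟩ := h₂
      have h10 : s₂.int 8 = s'.int 8 := h9.1 _ (by omega)
      have h11 : Same (fun a => 8 ≤ a ∧ a < 32) c.Scratch s s₂ := by
        refine h5.trans h9 (by intro a h; omega) ?_
        intro a h
        rw [Params.Scratch] at *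
        omega
      refine ⟨?_, ?_, ?_, ?_, h11.setInt (by simp)⟩
      · simp [Instr.det, h10, (hES h11).int1]; omega
      · simp [Instr.det, h10, (hES h11).int1, h6, hi']; ring
      · simp [Instr.det, h10, (hES h11).int1, h7, hi']; ring
      · intro i' a'
        simp only [Instr.det, setInt_real, setInt_int, loc_dir, getInt_eq, if_true, h10, (hES h11).int1]
        by_cases hii : i' = i
        · subst hii
          rw [if_pos (by omega), ← add_assoc, h8]
        · have hne : (i : ℕ) ≠ i' := fun h => hii (Fin.ext h.symm)
          have := row_disjoint hne a'
          rw [h9.2 _ (by omega), h4]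
          simp only [show (i' : ℕ) < s'.int 8 + 1 ↔ (i' : ℕ) < s'.int 8 by omega]
  · rintro s' ⟨h1, h2, h3, h4, h5⟩
    exact ⟨fun i a => by rw [h4, if_pos (by have := i.2; omega)], h5⟩

/-- Apply the operation `p` to the working array. -/
def applyProg (Q : ℕ) (p : Operation q k) : Program := rowsProg 6 (rowProg Q p)

theorem applyProg_spec (hE : Env c s) (hη : 0 < c.η) (hη' : c.η ≤ 1 / ((q : ℝ) + 1))
    (p : Operation q k) {w' : Fin n → Fin q → ℝ} (hw : Work c w' s) :
    DSpec O (applyProg c.Q p) (n * (rowCost q k + 3) + 8) s fun s' =>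
      Work c (stepMarg c.η p w') s' ∧ Same (fun a => 8 ≤ a ∧ a < 32) c.Scratch s s' := by
  refine rowsProg_spec hE hE.int6 (Or.inr rfl) hw fun i s₁ h₁ h2 h3 h4 => ?_
  exact rowProg_spec (hE.same h₁ (by intro a h; omega)
    (by intro a h; rw [Params.Scratch] at h; have : c.base = c.Q + 20 + 2 * q + n * q := rfl; omega))
    hη hη' p h2 h3 (by omega) h4

/-- Copy the input to the working array. -/
def copyProg (q Q : ℕ) : Program := rowsProg 5 (.seq (loadRow q Q (Q + 20 + q)) (storeRow q Q))

theorem copyProg_spec (hE : Env c s) :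
    DSpec O (copyProg q c.Q) (n * (q * 8 + 6) + 8) s fun s' =>
      Work c c.w s' ∧ Same (fun a => 8 ≤ a ∧ a < 32) c.Scratch s s' := by
  have hB : c.base = c.Q + 20 + 2 * q + n * q := rfl
  refine DSpec.mono (rowsProg_spec (T := q * 4 + 1 + (q * 4 + 1) + 1)
    (w₀ := fun i a => s.real (c.base + n * q + (i * q + a))) hE hE.int5 (Or.inl rfl)
    (fun i a => rfl) fun i s₁ h₁ h2 h3 h4 => ?_) (by ring_nf; rfl) fun _ h => h
  have hE₁ : Env c s₁ := hE.same h₁ (by intro a h; omega)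
    (by intro a h; rw [Params.Scratch] at h; omega)
  refine DSpec.seq (loadRow_spec (v := c.w i) hE₁ h2 (by omega) (by omega) (by omega) fun a => ?_)
    fun s₂ h₂ => ?_
  · rw [add_assoc]; exact hE₁.inp i a
  · refine (storeRow_spec (hE₁.same h₂.2.2 (by intro a h; omega) (by intro a h; omega))
      ((h₂.2.2.1 _ (by omega)).trans h3) (by omega) h₂.2.1).mono le_rfl fun s₃ h₃ =>
      ⟨(h₃.2.2.1 _ (by omega)).trans h₂.1, h₃.1, h₃.2.1,
        h₂.2.2.trans h₃.2.2 (by tauto) (by intro a h; omega)⟩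

/-- Apply a random operation to the working array. -/
def stepProg (q k Q : ℕ) : Program :=
  .seq (drawProg Q) (selProg Q 1 (fun j => if h : j < q ^ q ^ k then
    applyProg Q ((opEquiv q k).symm ⟨j, h⟩) else skip) (q ^ q ^ k) 0)

/-- Running time of `stepProg`. -/
def stepCost (q k n L : ℕ) : ℕ := L * 9 + 15 + n * (rowCost q k + 3) + 3 * q ^ q ^ k

/-- The simplex condition is carried along because every later draw from a row requires weights that
sum to 1. -/
theorem stepProg_spec (hE : Env c s) (hP : c.P ∈ stdSimplex ℝ (Operation q k)) (hη : 0 < c.η)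
    (hη' : c.η ≤ 1 / ((q : ℝ) + 1)) {w' : Fin n → Fin q → ℝ} (hw : Work c w' s)
    (hm : ∀ i, w' i ∈ stdSimplex ℝ (Fin q)) :
    Spec O (stepProg q k c.Q) (stepCost q k n c.L) s (opKernel c.P c.η c.L w') fun w'' s' =>
      (∀ i, w'' i ∈ stdSimplex ℝ (Fin q)) ∧ Work c w'' s' ∧ Same (fun a => 8 ≤ a ∧ a < 32) c.Scratch s s' := by
  have hB : c.base = c.Q + 20 + 2 * q + n * q := rfl
  refine Spec.map (Post := fun o s' => ∃ j, o = some j ∧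
    (Work c (stepMarg c.η ((opEquiv q k).symm j) w') s' ∧
      Same (fun a => 8 ≤ a ∧ a < 32) c.Scratch s s'))
    (fun o : Option (Fin (q ^ q ^ k)) => o.elim w' fun j => stepMarg c.η ((opEquiv q k).symm j) w') ?_ ?_
  · refine Spec.mono (drawSel_spec (T := n * (rowCost q k + 3) + 8) (m := q ^ q ^ k) (cell := 1)
      (v := fun j => c.P ((opEquiv q k).symm j)) hE ⟨fun j => hP.1 _, ?_⟩ hE.tab ?_ ?_)
      (by rw [stepCost]; omega) fun _ _ h => h
    · exact (Equiv.sum_comp (opEquiv q k).symm c.P).trans hP.2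
    · intro j
      have : (j : ℕ) < c.Q := j.2
      omega
    · intro j s₁ h₁
      have hE₁ : Env c s₁ := hE.same h₁ (by intro a h; omega) (by intro a h; omega)
      rw [dif_pos j.2]
      refine (applyProg_spec hE₁ hη hη' _ (hw.same h₁ (by intro a h; omega))).mono le_rfl fun s₂ h₂ =>
        ⟨h₂.1, h₁.trans h₂.2 (by intro a h; omega) ?_⟩
      intro a h
      rw [Params.Scratch] at *
      omega
  · rintro _ s' ⟨j, rfl, h⟩
    exact ⟨stepMarg_mem _ hm, h⟩

/-- Apply random operations to the working array. -/
def pathProg (q k Q : ℕ) : Program :=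
  .seq (.instr (.addReal (.dir (Q + 13)) (.dir (Q + 6)) (.dir (Q + 1))))
    (.loop (.ltReal (.dir (Q + 1)) (.dir (Q + 13)))
      (.seq (.instr (.subReal (.dir (Q + 13)) (.dir (Q + 13)) (.dir (Q + 2))))
        (stepProg q k Q)))

theorem pathProg_spec (hE : Env c s) (hP : c.P ∈ stdSimplex ℝ (Operation q k)) (hη : 0 < c.η)
    (hη' : c.η ≤ 1 / ((q : ℝ) + 1)) {w' : Fin n → Fin q → ℝ} (hw : Work c w' s)
    (hm : ∀ i, w' i ∈ stdSimplex ℝ (Fin q)) :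
    Spec O (pathProg q k c.Q) (c.r * (stepCost q k n c.L + 3) + 3) s
      (iterK (fun _ => opKernel c.P c.η c.L) c.r w') fun w'' s' =>
      (∀ i, w'' i ∈ stdSimplex ℝ (Fin q)) ∧ Work c w'' s' ∧ Same (fun a => 8 ≤ a ∧ a < 32) (fun a => a = c.Q + 13 ∨ c.Scratch a) s s' := by
  have hB : c.base = c.Q + 20 + 2 * q + n * q := rfl
  set S : Store → Prop := fun s' =>
    Same (fun a => 8 ≤ a ∧ a < 32) (fun a => a = c.Q + 13 ∨ c.Scratch a) s s' with hS
  have hES : ∀ {s'}, S s' → Env c s' := fun h =>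
    hE.same h (by intro a h; omega) (by intro a h; rw [Params.Scratch] at h; omega)
  refine Spec.mono (DSpec.seq_spec (T₁ := 1)
    (R := fun s' => s'.real (c.Q + 13) = c.r ∧ (∀ i, w' i ∈ stdSimplex ℝ (Fin q)) ∧ Work c w' s' ∧ S s')
    (DSpec.instr (by trivial) ?_) fun s₁ h₁ =>
    Spec.loop (T := stepCost q k n c.L + 2) (κ := fun _ => opKernel c.P c.η c.L)
      (I := fun j w'' s' => s'.real (c.Q + 13) = j ∧
        (∀ i, w'' i ∈ stdSimplex ℝ (Fin q)) ∧ Work c w'' s' ∧ S s') ?_ ?_ c.r w' s₁ h₁) ?_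
      fun w'' s' h => h.2
  · exact ⟨by simp [Instr.det, hE.rr, hE.zero], hm,
      hw.same (Same.refl.setReal (I := fun _ => False) (R := fun a => a = c.Q + 13) rfl)
        (by intro a h; omega), Same.refl.setReal (Or.inl rfl)⟩
  · rintro w'' s' ⟨h1, -, -, h2⟩
    simp [Test.holds, h1, (hES h2).zero]
  · rintro j w'' s' ⟨h1, h1', h2, h3⟩
    refine ⟨by simp [Test.holds, h1, (hES h3).zero]; positivity, ?_⟩
    refine Spec.mono (DSpec.seq_spec (T₁ := 1) (R := fun s' => s'.real (c.Q + 13) = j ∧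
      (∀ i, w'' i ∈ stdSimplex ℝ (Fin q)) ∧ Work c w'' s' ∧ S s') (DSpec.instr (by trivial) ⟨by simp [Instr.det, h1, (hES h3).one], h1',
      h2.same (Same.refl.setReal (I := fun _ => False) (R := fun a => a = c.Q + 13) rfl)
        (by intro a h; omega), h3.setReal (Or.inl rfl)⟩) fun s₂ h₂ =>
      (stepProg_spec (hES h₂.2.2.2) hP hη hη' h₂.2.2.1 h₂.2.1).mono le_rfl fun w₃ s₃ h₃ => ?_) (by omega)
      fun _ _ h => h
    exact ⟨(h₃.2.2.2 _ (by rw [Params.Scratch]; omega)).trans h₂.1, h₃.1, h₃.2.1,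
      h₂.2.2.2.trans h₃.2.2 (by tauto) (by tauto)⟩
  · ring_nf; omega

end RealRAM

namespace RealRAM

variable {q k n : ℕ} {O : Oracle} {c : Params q k n} {s : Store}

/-! ### Sampling an assignment and querying the oracle -/

/-- Sample one letter for every row of the working array. -/
def letterProg (q Q : ℕ) : Program :=
  .seq (block [.addInt (.dir 9) (.dir 6) (.dir 3), .addInt (.dir 12) (.dir 7) (.dir 3),
    .addInt (.dir 8) (.dir 3) (.dir 3)])
    (.loop (.ltInt (.dir 8) (.dir 0)) (.seq (loadRow q Q (Q + 20))
      (.seq (.seq (drawProg Q) (selProg Q (Q + 20) (fun a => .instr (.constInt (.ind 12) a)) q 0))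
        (block [.addInt (.dir 12) (.dir 12) (.dir 1), .addInt (.dir 8) (.dir 8) (.dir 1)]))))

/-- Running time of `letterProg`. -/
def letterCost (q n L : ℕ) : ℕ := n * (L * 9 + q * 7 + 16) + 8

/-- The assignment x₀ is a placeholder: the invariant speaks only of the letters already written,
and all n of them are written in the end. -/
theorem letterProg_spec (hE : Env c s) {w' : Fin n → Fin q → ℝ} (hw : Work c w' s)
    (hm : ∀ i, w' i ∈ stdSimplex ℝ (Fin q)) (x₀ : Fin n → Fin q) :
    Spec O (letterProg q c.Q) (letterCost q n c.L) s (assignLaw w' c.L x₀) fun x s' =>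
      (∀ i : Fin n, s'.int (32 + i) = x i) ∧
        Same (fun a => 8 ≤ a) (fun a => c.Q + 14 ≤ a ∧ a < c.base) s s' := by
  have hB : c.base = c.Q + 20 + 2 * q + n * q := rfl
  set S : Store → Prop := fun s' =>
    Same (fun a => 8 ≤ a) (fun a => c.Q + 14 ≤ a ∧ a < c.base) s s' with hS
  have hES : ∀ {s'}, S s' → Env c s' := fun h =>
    hE.same h (by intro a h; omega) (by intro a h; omega)
  set I : ℕ → (Fin n → Fin q) → Store → Prop := fun j x s' => s'.int 8 + j = n ∧
    s'.int 9 = c.base + n * q + s'.int 8 * q ∧ s'.int 12 = 32 + s'.int 8 ∧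
    (∀ i : Fin n, (i : ℕ) < s'.int 8 → s'.int (32 + i) = x i) ∧ S s' with hI
  refine Spec.mono (DSpec.seq_spec (R := I n x₀) (DSpec.block (by simp) (by simp [Instr.IsDet]) ?_)
    fun s₁ h₁ => Spec.loop (T := q * 4 + 1 + (c.L * 9 + 7 + 1 + 3 * q + 4 + 1) + 1)
      (κ := letterKernel w' c.L) (I := I) ?_ ?_ n x₀ s₁ h₁)
    (by simp only [List.length_cons, List.length_nil, letterCost]; ring_nf; omega) ?_
  · refine ⟨?_, ?_, ?_, ?_, ?_⟩
    · simp [Instr.det, hE.int3]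
    · simp [Instr.det, hE.int3, hE.int6]
    · simp [Instr.det, hE.int3, hE.int7]
    · simp [Instr.det, hE.int3]
    · exact ((Same.refl.setInt (by simp)).setInt (by simp)).setInt (by simp)
  · rintro x s' ⟨h1, -, -, -, h5⟩
    simp [Test.holds, (hES h5).int0]; omega
  · rintro j x s₁ ⟨h1, h2, h3, h4, h5⟩
    refine ⟨by simp [Test.holds, (hES h5).int0]; omega, ?_⟩
    have hlt : n - 1 - j < n := by omega
    -- `letterKernel` counts the letters that remain, the machine counts rows upwards; this converts
    -- one into the other.
    have h8 : s₁.int 8 = n - 1 - j := by omega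
    rw [letterKernel, dif_pos hlt]
    set i : Fin n := ⟨n - 1 - j, hlt⟩ with hi
    have hi' : s₁.int 8 = i := h8
    refine Spec.map (Post := fun o s' => ∃ a, o = some a ∧ I j (Function.update x i a) s')
      (fun o : Option (Fin q) => o.elim x (Function.update x i)) ?_ ?_
    · refine DSpec.seq_spec (loadRow_spec (v := w' i) (hES h5) h2 le_rfl (by omega) (by omega) fun a => ?_)
        fun s₂ h₂ => ?_
      · have hr : s₁.real (c.base + n * q + (i * q + a)) = w' i a := by
          have := row_lt i a
          rw [h5.2 _ (by omega)]; exact hw i a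
        rw [hi', ← hr]; congr 1; ring
      · have hs₂ : S s₂ := h5.trans h₂.2.2 (by intro a h; omega) (by intro a h; omega)
        have h28 : s₂.int 8 = i := (h₂.2.2.1 _ (by omega)).trans hi'
        have h29 : s₂.int 9 = c.base + n * q + (i + 1) * q := by rw [h₂.1, hi']; ring
        have h212 : s₂.int 12 = 32 + i := (h₂.2.2.1 _ (by omega)).trans (by rw [h3, hi'])
        have h232 : ∀ i' : Fin n, (i' : ℕ) < i → s₂.int (32 + i') = x i' := fun i' h =>
          (h₂.2.2.1 _ (by omega)).trans (h4 i' (by omega))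
        refine Spec.seq_dspec (Post := fun o s' => ∃ a, o = some a ∧ I j (Function.update x i a) s')
          (drawSel_spec (T := 1) (v := w' i) (hES hs₂) (hm i) h₂.2.1 (fun a => by omega)
          (Post := fun a s' => s'.int 8 = i ∧ s'.int 9 = c.base + n * q + (i + 1) * q ∧
            s'.int 12 = 32 + i ∧ (∀ i' : Fin n, (i' : ℕ) < i → s'.int (32 + i') = x i') ∧
            s'.int (32 + i) = a ∧ S s') fun a s₃ h₃ => DSpec.instr (by trivial) ?_) ?_
        · have h312 : s₃.int 12 = 32 + i := (h₃.1 _ (by omega)).trans h212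
          refine ⟨?_, ?_, ?_, fun i' h => ?_, ?_, ?_⟩
          · simp [Instr.det, h312, h₃.1, h28]; omega
          · simp [Instr.det, h312, h₃.1, h29]; omega
          · simp [Instr.det, h312]; omega
          · simp [Instr.det, h312, show (i' : ℕ) ≠ i by omega]
            rw [h₃.1 _ (by omega), h232 i' h]
          · simp [Instr.det, h312]
          · exact (hs₂.trans (I := fun a => 8 ≤ a) (R := fun a => c.Q + 14 ≤ a ∧ a < c.base) h₃
              (by intro a h; omega) (by intro a h; omega)).setInt (by simp [h312]; omega)
        · rintro _ s₃ ⟨a, rfl, h31, h32, h33, h34, h35, h36⟩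
          refine DSpec.block (by simp) (by simp [Instr.IsDet]) ⟨a, rfl, ?_, ?_, ?_, fun i' => ?_,
            (h36.setInt (by simp)).setInt (by simp)⟩
          · simp [Instr.det, h31, (hES h36).int1]; omega
          · simp [Instr.det, h31, (hES h36).int1, h32]
          · simp [Instr.det, h31, (hES h36).int1, h33]; omega
          · intro h
            simp [Instr.det, h31, (hES h36).int1] at h ⊢
            by_cases hii : i' = i
            · subst hii; simp [h35]
              exact (if_neg (by omega)).trans (if_neg (by omega))
            · have : (i' : ℕ) ≠ i := fun h => hii (Fin.ext h)
              simp [Function.update_of_ne hii, ← h34 i' (by omega)]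
              exact (if_neg (by omega)).trans (if_neg (by omega))
    · rintro _ s' ⟨a, rfl, h⟩
      exact h
  · rintro x s' ⟨h1, h2, h3, h4, h5⟩
    exact ⟨fun i => h4 i (by have := i.2; omega), h5⟩

/-- Sample an assignment, query the oracle at it, and add the answer to the accumulator. -/
def sampleProg (q k Q : ℕ) : Program :=
  .seq (copyProg q Q) (.seq (pathProg q k Q) (.seq (letterProg q Q)
    (block [.query (.dir (Q + 16)) (.dir 7), .addReal (.dir (Q + 11)) (.dir (Q + 11)) (.dir (Q + 16))])))

/-- Running time of `sampleProg`. -/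
def sampleCost (q k n L r : ℕ) : ℕ :=
  n * (q * 8 + 6) + r * (stepCost q k n L + 3) + letterCost q n L + 18

theorem sampleProg_spec {f : (Fin n → Fin q) → ℝ} (hE : Env c s)
    (hP : c.P ∈ stdSimplex ℝ (Operation q k)) (hη : 0 < c.η) (hη' : c.η ≤ 1 / ((q : ℝ) + 1))
    (hw : ∀ i, c.w i ∈ stdSimplex ℝ (Fin q)) (x₀ : Fin n → Fin q) {S : ℝ}
    (hS : s.real (c.Q + 11) = S) :
    Spec (valueOracle f) (sampleProg q k c.Q) (sampleCost q k n c.L c.r) s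
      (addK (sampleLaw c.P c.η c.L c.r c.w x₀) f S) fun S' s' => s'.real (c.Q + 11) = S' ∧
        Same (fun a => 8 ≤ a) (fun a => a = c.Q + 11 ∨ a = c.Q + 13 ∨ c.Scratch a) s s' := by
  have hB : c.base = c.Q + 20 + 2 * q + n * q := rfl
  set G : Store → Prop := fun s' =>
    Same (fun a => 8 ≤ a) (fun a => a = c.Q + 13 ∨ c.Scratch a) s s' with hG
  have hEG : ∀ {s'}, G s' → Env c s' := fun h =>
    hE.same h (by intro a h; omega) (by intro a h; rw [Params.Scratch] at h; omega)
  refine Spec.map (Post := fun x s' => s'.real (c.Q + 11) = S + f x ∧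
    Same (fun a => 8 ≤ a) (fun a => a = c.Q + 11 ∨ a = c.Q + 13 ∨ c.Scratch a) s s')
    (fun x => S + f x) ?_ fun _ _ h => h
  refine Spec.mono (DSpec.seq_spec (copyProg_spec hE) fun s₁ h₁ => ?_)
    (T₁ := n * (q * 8 + 6) + 8 + (c.r * (stepCost q k n c.L + 3) + 3 +
      (letterCost q n c.L + 4 + 1) + 1) + 1) (by rw [sampleCost]; omega) fun _ _ h => h
  have hG₁ : G s₁ := h₁.2.mono (by intro a h; omega) (by tauto)
  refine Spec.seq (R := fun w' s' => (∀ i, w' i ∈ stdSimplex ℝ (Fin q)) ∧ Work c w' s' ∧ G s')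
    ((pathProg_spec (hEG hG₁) hP hη hη' h₁.1 hw).mono le_rfl fun w' s' h => ⟨h.1, h.2.1,
      hG₁.trans h.2.2 (by intro a h; omega) (by tauto)⟩) fun w' s₂ h₂ => ?_
  refine Spec.seq_dspec (Post := fun x s' => s'.real (c.Q + 11) = S + f x ∧
    Same (fun a => 8 ≤ a) (fun a => a = c.Q + 11 ∨ a = c.Q + 13 ∨ c.Scratch a) s s')
    (letterProg_spec (hEG h₂.2.2) h₂.2.1 h₂.1 x₀) fun x s₃ h₃ => ?_
  have hG₃ : G s₃ := h₂.2.2.trans h₃.2 (by tauto)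
    (by intro a h; simp only [Params.Scratch] at *; omega)
  refine DSpec.block (by simp) (by simp [Instr.IsDet]) ⟨?_, Same.setReal (Same.setReal
    (hG₃.mono (by tauto) (by tauto)) (by simp [Params.Scratch]; omega)) (by simp)⟩
  have h4 : s₃.real (c.Q + 11) = S := (hG₃.2 _ (by simp [Params.Scratch]; omega)).trans hS
  -- All letters written are below q, so the oracle answers with f and not with its default 0.
  have h5 : valueOracle f (fun i => s₃.int (32 + i)) = f x := by
    have : ∀ i : Fin n, s₃.int (32 + i) < q := fun i => by rw [h₃.1]; exact (x i).2
    rw [valueOracle, dif_pos this]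
    congr 1; funext i; exact Fin.ext (h₃.1 i)
  simp [Instr.det, h4, (hEG hG₃).int7, h5]

/-- Average the answers of `N` samples; the result is left in real cell `0`. -/
def averageProg (q k Q : ℕ) : Program :=
  .seq (block [.constReal (.dir (Q + 11)) 0, .addReal (.dir (Q + 12)) (.dir (Q + 8)) (.dir (Q + 1))])
    (.seq (.loop (.ltReal (.dir (Q + 1)) (.dir (Q + 12)))
      (.seq (.instr (.subReal (.dir (Q + 12)) (.dir (Q + 12)) (.dir (Q + 2)))) (sampleProg q k Q)))
      (.instr (.divReal (.dir 0) (.dir (Q + 11)) (.dir (Q + 8)))))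

theorem averageProg_spec {f : (Fin n → Fin q) → ℝ} (hE : Env c s)
    (hP : c.P ∈ stdSimplex ℝ (Operation q k)) (hη : 0 < c.η) (hη' : c.η ≤ 1 / ((q : ℝ) + 1))
    (hw : ∀ i, c.w i ∈ stdSimplex ℝ (Fin q)) (x₀ : Fin n → Fin q) :
    Spec (valueOracle f) (averageProg q k c.Q) (c.N * (sampleCost q k n c.L c.r + 3) + 8) s
      (iterK (fun _ => addK (sampleLaw c.P c.η c.L c.r c.w x₀) f) c.N 0)
      fun S s' => s'.real 0 = S / c.N := by
  have hB : c.base = c.Q + 20 + 2 * q + n * q := rfl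
  set G : Store → Prop := fun s' => Same (fun a => 8 ≤ a)
    (fun a => a = c.Q + 11 ∨ a = c.Q + 12 ∨ a = c.Q + 13 ∨ c.Scratch a) s s' with hG
  have hEG : ∀ {s'}, G s' → Env c s' := fun h =>
    hE.same h (by intro a h; omega) (by intro a h; rw [Params.Scratch] at h; omega)
  refine Spec.mono (DSpec.seq_spec (R := fun s' => s'.real (c.Q + 11) = 0 ∧
    s'.real (c.Q + 12) = c.N ∧ G s') (DSpec.block (by simp) (by simp [Instr.IsDet]) ?_)
    fun s₁ h₁ => Spec.seq_dspec (T₂ := 1) (Post := fun S s' => s'.real 0 = S / c.N)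
    (Spec.loop (T := sampleCost q k n c.L c.r + 2)
      (κ := fun _ => addK (sampleLaw c.P c.η c.L c.r c.w x₀) f)
      (I := fun j S s' => s'.real (c.Q + 11) = S ∧ s'.real (c.Q + 12) = j ∧ G s')
      ?_ ?_ c.N 0 s₁ h₁) fun S s₂ h₂ => DSpec.instr (by trivial) ?_)
    (by simp only [List.length_cons, List.length_nil]; ring_nf; omega) fun _ _ h => h
  · exact ⟨by simp [Instr.det], by simp [Instr.det, hE.zero, hE.nn],
      (Same.refl.setReal (by simp)).setReal (by simp)⟩
  · rintro S s' ⟨-, h1, h2⟩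
    simp [Test.holds, h1, (hEG h2).zero]
  · rintro j S s' ⟨h1, h2, h3⟩
    refine ⟨by simp [Test.holds, h2, (hEG h3).zero]; positivity, ?_⟩
    refine Spec.mono (DSpec.seq_spec (T₁ := 1) (R := fun s' => s'.real (c.Q + 11) = S ∧
      s'.real (c.Q + 12) = j ∧ G s') (DSpec.instr (by trivial) ⟨by simpa [Instr.det] using h1,
      by simp [Instr.det, h2, (hEG h3).one], h3.setReal (by simp)⟩) fun s₂ h₂ =>
      (sampleProg_spec (hEG h₂.2.2) hP hη hη' hw x₀ h₂.1).mono le_rfl fun S' s₃ h₃ => ?_) (by omega)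
      fun _ _ h => h
    exact ⟨h₃.1, (h₃.2.2 _ (by simp [Params.Scratch]; omega)).trans h₂.2.1,
      h₂.2.2.trans h₃.2 (by tauto) (by tauto)⟩
  · simp [Instr.det, h₂.1, (hEG h₂.2.2).nn]

end RealRAM

namespace RealRAM

variable {q k n : ℕ} {O : Oracle} {s : Store}

/-! ### Reading the input and computing the parameters -/

section Load

variable {ε : ℝ} {P : Operation q k → ℝ} {w : Fin n → Fin q → ℝ}

theorem load_real_tab (j : Fin (q ^ q ^ k)) :
    (load n (realInput ε P w)).real (1 + j) = P ((opEquiv q k).symm j) := by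
  have h := j.2
  simp [load, realInput, List.getD_eq_getElem?_getD, add_comm 1 (j : ℕ), List.getElem?_append, h]

theorem load_real_inp (i : Fin n) (a : Fin q) :
    (load n (realInput ε P w)).real (q ^ q ^ k + 1 + (i * q + a)) = w i a := by
  have h := row_lt i a
  have h1 : ((⟨i * q + a, h⟩ : Fin (n * q)).divNat) = i := by
    ext
    simp only [Fin.coe_divNat]
    rw [Nat.mul_comm, Nat.mul_add_div (Nat.pos_of_ne_zero fun h => by have := a.2; omega),
      Nat.div_eq_of_lt a.2, add_zero]
  have h2 : ((⟨i * q + a, h⟩ : Fin (n * q)).modNat) = a := by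
    ext
    simp only [Fin.coe_modNat]
    rw [Nat.mul_comm, Nat.mul_add_mod, Nat.mod_eq_of_lt a.2]
  simp only [load, realInput, List.getD_eq_getElem?_getD]
  rw [List.getElem?_append_right (by simp)]
  simp only [List.length_append, List.length_cons, List.length_nil, List.length_ofFn]
  rw [show q ^ q ^ k + 1 + (i * q + a) - (0 + 1 + q ^ q ^ k) = i * q + a by omega]
  simp [h, h1, h2]

theorem load_real_of_le {a : ℕ} (ha : q ^ q ^ k + 1 + n * q ≤ a) :
    (load n (realInput ε P w)).real a = 0 := by
  simp only [load, realInput, List.getD_eq_getElem?_getD]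
  rw [List.getElem?_eq_none (by simp; omega)]
  rfl

end Load

/-- The input has been read: the integer constants are in place and the table of marginals has been
moved. -/
structure Ready (ε : ℝ) (P : Operation q k → ℝ) (w : Fin n → Fin q → ℝ) (base : ℕ) (s : Store) :
    Prop where
  int0 : s.int 0 = n
  int1 : s.int 1 = 1
  int3 : s.int 3 = 0
  int5 : s.int 5 = base
  int6 : s.int 6 = base + n * q
  int7 : s.int 7 = 32
  eps : s.real 0 = ε
  tab : ∀ j : Fin (q ^ q ^ k), s.real (1 + j) = P ((opEquiv q k).symm j)
  inp : ∀ (i : Fin n) (a : Fin q), s.real (base + (i * q + a)) = w i a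

theorem Ready.same {ε : ℝ} {P : Operation q k → ℝ} {w : Fin n → Fin q → ℝ} {base : ℕ} {s s' : Store}
    {I R : ℕ → Prop} (hE : Ready ε P w base s) (h : Same I R s s')
    (hI : ∀ a, I a → 8 ≤ a) (hR : ∀ a, R a → q ^ q ^ k + 1 ≤ a ∧ a < base) :
    Ready ε P w base s' := by
  have hi : ∀ a, a < 8 → s'.int a = s.int a := fun a ha => h.1 a fun h => by
    have := hI a h; omega
  constructor
  · rw [hi _ (by omega)]; exact hE.int0
  · rw [hi _ (by omega)]; exact hE.int1
  · rw [hi _ (by omega)]; exact hE.int3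
  · rw [hi _ (by omega)]; exact hE.int5
  · rw [hi _ (by omega)]; exact hE.int6
  · rw [hi _ (by omega)]; exact hE.int7
  · rw [h.2 _ fun h => by have := (hR _ h).1; omega]; exact hE.eps
  · intro j; rw [h.2 _ fun h => by have := (hR _ h).1; have := j.2; omega]; exact hE.tab j
  · intro i a
    rw [h.2 _ fun hc => by have := (hR _ hc).2; omega]; exact hE.inp i a

/-- Set up the integer constants and move the table of marginals out of the way. -/
def readProg (q Q : ℕ) : Program :=
  .seq (block [.constInt (.dir 1) 1, .constInt (.dir 2) q, .constInt (.dir 7) 32])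
    (.seq (.loop (.ltInt (.dir 8) (.dir 0)) (block [.addInt (.dir 4) (.dir 4) (.dir 2),
      .addInt (.dir 8) (.dir 8) (.dir 1)]))
    (.seq (block [.constInt (.dir 5) (Q + 20 + 2 * q), .addInt (.dir 5) (.dir 5) (.dir 4),
      .addInt (.dir 6) (.dir 5) (.dir 4), .addInt (.dir 9) (.dir 5) (.dir 3),
      .constInt (.dir 10) (Q + 1)])
    (.loop (.ltInt (.dir 9) (.dir 6)) (block [.addReal (.ind 9) (.ind 10) (.ind 6),
      .addInt (.dir 9) (.dir 9) (.dir 1), .addInt (.dir 10) (.dir 10) (.dir 1)]))))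

/-- Running time of `readProg`. -/
def readCost (q n : ℕ) : ℕ := n * 5 + n * q * 7 + 21

/-- The input marginals begin at real cell Q+1, where the constants and registers are to go, so they
are first moved to a region disjoint from both. The product nq is obtained by n additions of q. -/
theorem readProg_spec {ε : ℝ} {P : Operation q k → ℝ} {w : Fin n → Fin q → ℝ} :
    DSpec O (readProg q (q ^ q ^ k)) (readCost q n) (load n (realInput ε P w))
      (Ready ε P w (q ^ q ^ k + 20 + 2 * q + n * q)) := by
  set s₀ := load n (realInput ε P w) with hs₀
  set Q := q ^ q ^ k with hQ
  set B := Q + 20 + 2 * q + n * q with hB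
  have h0 : s₀.int 0 = n := rfl
  have hz : ∀ a, a ≠ 0 → s₀.int a = 0 := fun a ha => if_neg ha
  -- This cell lies beyond the input and serves as the zero operand of the copy, before the real
  -- constants exist.
  have hbig : s₀.real (B + n * q) = 0 := load_real_of_le (by omega)
  refine DSpec.mono (DSpec.seq (R := fun s => s.int 0 = n ∧ s.int 1 = 1 ∧ s.int 2 = q ∧ s.int 3 = 0 ∧
      s.int 7 = 32 ∧ s.int 8 + n = n ∧ s.int 4 = s.int 8 * q ∧ s.real = s₀.real)
    (DSpec.block (by simp) (by simp [Instr.IsDet]) ?_) fun s₁ h₁ => DSpec.seq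
    (DSpec.loop (T := 4) (I := fun j s => s.int 0 = n ∧ s.int 1 = 1 ∧ s.int 2 = q ∧ s.int 3 = 0 ∧
      s.int 7 = 32 ∧ s.int 8 + j = n ∧ s.int 4 = s.int 8 * q ∧ s.real = s₀.real) ?_ ?_ n s₁ h₁)
    fun s₂ h₂ => ?_) (T₁ := 2 * 3 + (n * (4 + 1) + 1 + (2 * 5 + (n * q * (6 + 1) + 1) + 1) + 1) + 1)
    (by rw [readCost]; omega) fun _ h => h
  · refine ⟨?_, ?_, ?_, ?_, ?_, ?_, ?_, rfl⟩ <;> simp [Instr.det, h0, hz]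
  · rintro s ⟨h1, -, -, -, -, h2, -⟩
    simp [Test.holds]; omega
  · rintro j s ⟨h1, h2, h3, h4, h5, h6, h7, h8⟩
    refine ⟨by simp [Test.holds]; omega, DSpec.block (by simp) (by simp [Instr.IsDet]) ?_⟩
    refine ⟨?_, ?_, ?_, ?_, ?_, ?_, ?_, h8⟩ <;> simp [Instr.det, h1, h2, h3, h4, h5, h7]
    · omega
    · ring
  · obtain ⟨h1, h2, h3, h4, h5, h6, h7, h8⟩ := h₂
    have h9 : s₂.int 4 = n * q := by rw [h7, show s₂.int 8 = n by omega]
    refine DSpec.mono (DSpec.seq (T₁ := 2 * 5) (T₂ := n * q * (6 + 1) + 1)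
      (R := fun s => s.int 0 = n ∧ s.int 1 = 1 ∧ s.int 3 = 0 ∧ s.int 5 = B ∧ s.int 6 = B + n * q ∧
        s.int 7 = 32 ∧ s.int 9 = B ∧ s.int 10 = Q + 1 ∧ s.real = s₀.real)
      (DSpec.block (by simp) (by simp [Instr.IsDet]) ?_) fun s₃ h₃ =>
      DSpec.loop (T := 6) (I := fun j s => s.int 0 = n ∧ s.int 1 = 1 ∧ s.int 3 = 0 ∧ s.int 5 = B ∧
        s.int 6 = B + n * q ∧ s.int 7 = 32 ∧ s.int 9 + j = B + n * q ∧
        s.int 10 + B = s.int 9 + (Q + 1) ∧ B ≤ s.int 9 ∧ s.real (B + n * q) = 0 ∧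
        (∀ a, a < B → s.real a = s₀.real a) ∧
        ∀ m, B + m < s.int 9 → s.real (B + m) = s₀.real (Q + 1 + m)) ?_ ?_ (n * q) s₃ ?_)
        le_rfl ?_
    · refine ⟨?_, ?_, ?_, ?_, ?_, ?_, ?_, ?_, h8⟩ <;>
        simp [Instr.det, h1, h2, h4, h5, h9, hB]
    · rintro s ⟨g1, g2, g3, g4, g5, g6, g7, g8, g9, g10, g11, g12⟩
      simp [Test.holds]; omega
    · rintro j s ⟨g1, g2, g3, g4, g5, g6, g7, g8, g9, g10, g11, g12⟩
      refine ⟨by simp [Test.holds]; omega, DSpec.block (by simp) (by simp [Instr.IsDet]) ?_⟩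
      have g13 : B + n * q ≠ s.int 9 := by omega
      refine ⟨?_, ?_, ?_, ?_, ?_, ?_, ?_, ?_, ?_, ?_, fun a ha => ?_, fun m hm => ?_⟩
      · simpa [Instr.det] using g1
      · simpa [Instr.det] using g2
      · simpa [Instr.det] using g3
      · simpa [Instr.det] using g4
      · simpa [Instr.det] using g5
      · simpa [Instr.det] using g6
      · simp [Instr.det, g2]; omega
      · simp [Instr.det, g2]; omega
      · simp [Instr.det, g2]; omega
      · simpa [Instr.det, g13] using g10
      · simpa [Instr.det, show a ≠ s.int 9 by omega] using g11 a ha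
      · simp [Instr.det, g2] at hm ⊢
        by_cases hm' : B + m = s.int 9
        · refine (if_pos hm').trans ?_
          rw [g5, g10, add_zero, show s.int 10 = Q + 1 + m by omega]
          exact g11 _ (by omega)
        · exact (if_neg hm').trans (g12 m (by omega))
    · obtain ⟨g1, g2, g3, g4, g5, g6, g7, g8, g9⟩ := h₃
      exact ⟨g1, g2, g3, g4, g5, g6, by omega, by omega, by omega, by rw [g9]; exact hbig,
        fun a _ => by rw [g9], fun m hm => by omega⟩
    · rintro s ⟨g1, g2, g3, g4, g5, g6, g7, g8, g9, g10, g11, g12⟩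
      refine ⟨g1, g2, g3, g4, g5, g6, ?_, fun j => ?_, fun i a => ?_⟩
      · rw [g11 _ (by omega)]; rfl
      · have := j.2
        rw [g11 _ (by omega)]; exact load_real_tab j
      · have := row_lt i a
        rw [g12 _ (by omega)]; exact load_real_inp i a

/-- Compute the real constants and the parameters, for operations of arity `k + 2`. -/
def paramProg (q k Q : ℕ) : Program :=
  .seq (block [.constReal (.dir (Q + 1)) 0, .constReal (.dir (Q + 2)) 1,
      .constReal (.dir (Q + 3)) (1 / 2), .constReal (.dir (Q + 5)) (1 / ((q : ℚ) + 1)),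
      .constReal (.dir (Q + 18)) 1, .constReal (.dir (Q + 19)) 0, .constInt (.dir 8) 0])
    (.seq (.loop (.ltInt (.dir 8) (.dir 0)) (block [.addReal (.dir (Q + 18)) (.dir (Q + 18)) (.dir (Q + 2)),
      .addInt (.dir 8) (.dir 8) (.dir 1)]))
    (.seq (.loop (.ltReal (.dir (Q + 19)) (.dir (Q + 2)))
      (block [.addReal (.dir (Q + 19)) (.dir (Q + 19)) (.dir 0),
        .addReal (.dir (Q + 18)) (.dir (Q + 18)) (.dir (Q + 2))]))
    (.seq (block [.constReal (.dir (Q + 16)) (32 * ((q : ℚ) + 1) ^ 2),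
      .mulReal (.dir (Q + 16)) (.dir (Q + 16)) (.dir (Q + 18)),
      .mulReal (.dir (Q + 16)) (.dir (Q + 16)) (.dir (Q + 18)),
      .divReal (.dir (Q + 4)) (.dir (Q + 2)) (.dir (Q + 16)),
      .constReal (.dir (Q + 6)) (131072 * ((q : ℚ) + 1) ^ 2),
      .mulReal (.dir (Q + 6)) (.dir (Q + 6)) (.dir (Q + 18)),
      .mulReal (.dir (Q + 6)) (.dir (Q + 6)) (.dir (Q + 18)),
      .mulReal (.dir (Q + 6)) (.dir (Q + 6)) (.dir (Q + 18)),
      .mulReal (.dir (Q + 6)) (.dir (Q + 6)) (.dir (Q + 18)),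
      .mulReal (.dir (Q + 6)) (.dir (Q + 6)) (.dir (Q + 18))])
    (.seq (seqs (List.ofFn fun _ : Fin (k + 2) =>
      .instr (.mulReal (.dir (Q + 6)) (.dir (Q + 6)) (.dir (Q + 16)))))
    (block [.constReal (.dir (Q + 7)) ((q : ℚ) ^ q ^ (k + 2)),
      .mulReal (.dir (Q + 7)) (.dir (Q + 7)) (.dir (Q + 6)),
      .constReal (.dir (Q + 17)) ((q : ℚ) + 1),
      .mulReal (.dir (Q + 17)) (.dir (Q + 17)) (.dir (Q + 18)),
      .addReal (.dir (Q + 7)) (.dir (Q + 7)) (.dir (Q + 17)),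
      .mulReal (.dir (Q + 7)) (.dir (Q + 7)) (.dir (Q + 18)),
      .constReal (.dir (Q + 17)) 64,
      .mulReal (.dir (Q + 7)) (.dir (Q + 7)) (.dir (Q + 17)),
      .constReal (.dir (Q + 8)) 192,
      .mulReal (.dir (Q + 8)) (.dir (Q + 8)) (.dir (Q + 18)),
      .mulReal (.dir (Q + 8)) (.dir (Q + 8)) (.dir (Q + 18)),
      .mulReal (.dir (Q + 8)) (.dir (Q + 8)) (.dir (Q + 18))])))))

/-- The accuracy parameter computed from the input. -/
def parS (n : ℕ) (ε : ℝ) : ℕ := 1 + n + ⌈1 / ε⌉₊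

/-- The parameters computed from the input. -/
def params (P : Operation q (k + 2) → ℝ) (w : Fin n → Fin q → ℝ) (s : ℕ) : Params q (k + 2) n where
  L := parL q k s
  r := parR q k s
  N := parN s
  η := 1 / parT q s
  P := P
  w := w

/-- Running time of `paramProg`. -/
def paramCost (k n m : ℕ) : ℕ := n * 5 + m * 5 + k * 2 + 70

/-- The ceiling of 1/ε is found by adding ε to itself until the sum reaches 1, which takes exactly
that many passes. Each pass also raises cell Q+18, which ends up holding s. -/
theorem paramProg_spec {ε : ℝ} (hε : 0 < ε) {P : Operation q (k + 2) → ℝ} {w : Fin n → Fin q → ℝ}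
    (hR : Ready ε P w (q ^ q ^ (k + 2) + 20 + 2 * q + n * q) s) :
    DSpec O (paramProg q k (q ^ q ^ (k + 2))) (paramCost k n ⌈1 / ε⌉₊) s
      (Env (params P w (parS n ε))) := by
  set Q := q ^ q ^ (k + 2) with hQ
  set σ := parS n ε with hσ
  set G : Store → Prop := fun s' => Same (fun a => a = 8) (fun a => Q + 1 ≤ a ∧ a < Q + 20) s s' ∧
    s'.real (Q + 1) = 0 ∧ s'.real (Q + 2) = 1 ∧ s'.real (Q + 3) = 1 / 2 ∧
    s'.real (Q + 5) = 1 / ((q : ℝ) + 1) with hG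
  have hRG : ∀ {s'}, G s' → Ready ε P w (Q + 20 + 2 * q + n * q) s' := fun h =>
    hR.same h.1 (by intro a h; omega) (by intro a h; omega)
  have hm : 1 ≤ (⌈1 / ε⌉₊ : ℝ) * ε := by
    have := Nat.le_ceil (1 / ε)
    rwa [div_le_iff₀ hε] at this
  have hσ' : (σ : ℝ) = 1 + n + ⌈1 / ε⌉₊ := by rw [hσ, parS]; push_cast; ring
  refine DSpec.mono (DSpec.seq (R := fun s => G s ∧ s.int 8 + n = n ∧ s.real (Q + 18) = 1 + s.int 8 ∧
      s.real (Q + 19) = 0) (DSpec.block (by simp) (by simp [Instr.IsDet]) ?_) fun s₁ h₁ => DSpec.seq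
    (DSpec.loop (T := 4) (I := fun j s => G s ∧ s.int 8 + j = n ∧ s.real (Q + 18) = 1 + s.int 8 ∧
      s.real (Q + 19) = 0) ?_ ?_ n s₁ h₁) fun s₂ h₂ => DSpec.seq
    (DSpec.loop (T := 4) (I := fun j s => G s ∧ s.real (Q + 18) = 1 + n + (⌈1 / ε⌉₊ - j) ∧
      s.real (Q + 19) = (⌈1 / ε⌉₊ - j) * ε) ?_ ?_ ⌈1 / ε⌉₊ s₂ ?_) fun s₃ h₃ => DSpec.seq
    (R := fun s => G s ∧ s.real (Q + 18) = σ ∧ s.real (Q + 16) = parT q σ ∧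
      s.real (Q + 4) = 1 / parT q σ ∧ s.real (Q + 6) = 131072 * ((q : ℝ) + 1) ^ 2 * σ ^ 5)
    (DSpec.block (by simp) (by simp [Instr.IsDet]) ?_) fun s₄ h₄ => DSpec.seq
    (DSpec.seqs (T := 1) (I := fun j s => G s ∧ s.real (Q + 18) = σ ∧ s.real (Q + 16) = parT q σ ∧
      s.real (Q + 4) = 1 / parT q σ ∧
      s.real (Q + 6) = 131072 * ((q : ℝ) + 1) ^ 2 * σ ^ 5 * (parT q σ : ℝ) ^ j)
      (fun j s h => (hRG h.1).int1) ?_ ?_) fun s₅ h₅ =>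
    DSpec.mono (Post := fun s => G s ∧ s.real (Q + 4) = 1 / parT q σ ∧ s.real (Q + 6) = parR q k σ ∧
      s.real (Q + 7) = parL q k σ ∧ s.real (Q + 8) = parN σ)
      (DSpec.block (by simp) (by simp [Instr.IsDet]) ?_) le_rfl ?_)
    (by simp only [List.length_cons, List.length_nil, paramCost]; omega) fun _ h => h
  · refine ⟨⟨?_, ?_, ?_, ?_, ?_⟩, ?_, ?_, ?_⟩
    · refine Same.setInt ?_ (by simp)
      iterate 6 refine Same.setReal ?_ (by simp)
      exact Same.refl
    all_goals simp [Instr.det]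
  · rintro s ⟨h1, h2, -⟩
    simp [Test.holds, (hRG h1).int0]; omega
  · rintro j s ⟨h1, h2, h3, h4⟩
    have g := h1
    obtain ⟨h5, h6, h7, h8, h9⟩ := h1
    refine ⟨by simp [Test.holds, (hRG g).int0]; omega, DSpec.block (by simp) (by simp [Instr.IsDet])
      ⟨⟨(h5.setReal (by simp)).setInt (by simp), ?_, ?_, ?_, ?_⟩, ?_, ?_, ?_⟩⟩
    · simpa [Instr.det] using h6
    · simpa [Instr.det] using h7
    · simpa [Instr.det] using h8
    · simpa [Instr.det] using h9
    · simp [Instr.det, (hRG g).int1]; omega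
    · simp [Instr.det, (hRG g).int1, h3, h7]; ring
    · simpa [Instr.det] using h4
  · rintro s ⟨⟨-, -, h1, -⟩, -, h2⟩
    simp [Test.holds, h1, h2]
    simpa using hm
  · rintro j s ⟨g, h3, h4⟩
    have g' := g
    obtain ⟨h5, h6, h7, h8, h9⟩ := g
    refine ⟨?_, DSpec.block (by simp) (by simp [Instr.IsDet])
      ⟨⟨(h5.setReal (by simp)).setReal (by simp), ?_, ?_, ?_, ?_⟩, ?_, ?_⟩⟩
    · have h10 : (⌈1 / ε⌉₊ : ℝ) < 1 / ε + 1 := Nat.ceil_lt_add_one (by positivity)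
      have h11 : 1 / ε * ε = 1 := by field_simp
      simp only [Test.holds, getReal_eq, loc_dir, h4, h7]
      push_cast
      nlinarith [Nat.cast_nonneg (α := ℝ) j]
    · simpa [Instr.det] using h6
    · simpa [Instr.det] using h7
    · simpa [Instr.det] using h8
    · simpa [Instr.det] using h9
    · simp [Instr.det, h3, h7]; ring
    · simp [Instr.det, h4, (hRG g').eps]; ring
  · obtain ⟨g, h2, h3, h4⟩ := h₂
    refine ⟨g, ?_, ?_⟩
    · rw [h3, show s₂.int 8 = n by omega]; ring
    · rw [h4]; ring
  · obtain ⟨⟨h5, h6, h7, h8, h9⟩, h3, h4⟩ := h₃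
    have h10 : s₃.real (Q + 18) = σ := by rw [h3, hσ']; push_cast; ring
    have h11 : (parT q σ : ℝ) = 32 * ((q : ℝ) + 1) ^ 2 * σ * σ := by rw [parT]; push_cast; ring
    refine ⟨⟨?_, ?_, ?_, ?_, ?_⟩, ?_, ?_, ?_, ?_⟩
    · iterate 10 refine Same.setReal ?_ (by simp)
      exact h5
    · simpa [Instr.det] using h6
    · simpa [Instr.det] using h7
    · simpa [Instr.det] using h8
    · simpa [Instr.det] using h9
    · simpa [Instr.det] using h10
    · simp [Instr.det, h10, h11]
    · simp [Instr.det, h10, h11, h7]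
    · simp [Instr.det, h10]; ring
  · rintro j s ⟨⟨h5, h6, h7, h8, h9⟩, h1, h2, h3, h4⟩
    refine DSpec.instr (by trivial) ⟨⟨h5.setReal (by simp), ?_, ?_, ?_, ?_⟩, ?_, ?_, ?_, ?_⟩
    · simpa [Instr.det] using h6
    · simpa [Instr.det] using h7
    · simpa [Instr.det] using h8
    · simpa [Instr.det] using h9
    · simpa [Instr.det] using h1
    · simpa [Instr.det] using h2
    · simpa [Instr.det] using h3
    · simp [Instr.det, h2, h4]; ring
  · simpa using h₄
  · obtain ⟨⟨h5, h6, h7, h8, h9⟩, h1, h2, h3, h4⟩ := h₅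
    have h10 : (parR q k σ : ℝ) = 131072 * ((q : ℝ) + 1) ^ 2 * σ ^ 5 * (parT q σ : ℝ) ^ (k + 2) := by
      rw [parR]; push_cast; ring
    refine ⟨⟨?_, ?_, ?_, ?_, ?_⟩, ?_, ?_, ?_, ?_⟩
    · iterate 12 refine Same.setReal ?_ (by simp)
      exact h5
    · simpa [Instr.det] using h6
    · simpa [Instr.det] using h7
    · simpa [Instr.det] using h8
    · simpa [Instr.det] using h9
    · simpa [Instr.det] using h3
    · rw [h10]; simpa [Instr.det] using h4
    · rw [← h10] at h4
      simp [Instr.det, h1, h4, parL]; ring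
    · simp [Instr.det, h1, parN]; ring
  · rintro s ⟨g, h1, h2, h3, h4⟩
    have hr := hRG g
    obtain ⟨-, h6, h7, h8, h9⟩ := g
    exact ⟨hr.int0, hr.int1, hr.int3, hr.int5, hr.int6, hr.int7, h6, h7, h8, h1, h9, h2, h3, h4,
      hr.tab, hr.inp⟩

end RealRAM

namespace RealRAM

variable {q k n : ℕ}

/-! ### Polynomial bounds -/

/-- The function is bounded by a polynomial in the sum of its arguments. -/
def PolyBdd (F : ℕ → ℕ → ℕ) : Prop := ∃ C d : ℕ, ∀ n m, F n m ≤ C * (n + m + 1) ^ d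

theorem PolyBdd.const (c : ℕ) : PolyBdd fun _ _ => c := ⟨c, 0, fun n m => by simp⟩

theorem PolyBdd.left : PolyBdd fun n _ => n := ⟨1, 1, fun n m => by simp; omega⟩

theorem PolyBdd.right : PolyBdd fun _ m => m := ⟨1, 1, fun n m => by simp; omega⟩

theorem PolyBdd.add {F F' : ℕ → ℕ → ℕ} (h : PolyBdd F) (h' : PolyBdd F') :
    PolyBdd fun n m => F n m + F' n m := by
  obtain ⟨C, d, h⟩ := h
  obtain ⟨C', d', h'⟩ := h'
  refine ⟨C + C', d + d', fun n m => ?_⟩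
  have h1 : (n + m + 1) ^ d ≤ (n + m + 1) ^ (d + d') := Nat.pow_le_pow_right (by omega) (by omega)
  have h2 : (n + m + 1) ^ d' ≤ (n + m + 1) ^ (d + d') := Nat.pow_le_pow_right (by omega) (by omega)
  rw [add_mul]
  exact add_le_add ((h n m).trans (Nat.mul_le_mul_left _ h1))
    ((h' n m).trans (Nat.mul_le_mul_left _ h2))

theorem PolyBdd.mul {F F' : ℕ → ℕ → ℕ} (h : PolyBdd F) (h' : PolyBdd F') :
    PolyBdd fun n m => F n m * F' n m := by
  obtain ⟨C, d, h⟩ := h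
  obtain ⟨C', d', h'⟩ := h'
  refine ⟨C * C', d + d', fun n m => (Nat.mul_le_mul (h n m) (h' n m)).trans (le_of_eq (by ring))⟩

theorem PolyBdd.pow {F : ℕ → ℕ → ℕ} (h : PolyBdd F) (e : ℕ) : PolyBdd fun n m => F n m ^ e := by
  induction e with
  | zero => simpa using PolyBdd.const 1
  | succ e ih => simpa only [pow_succ] using ih.mul h

/-! ### The algorithm -/

/-- The algorithm, for operations of arity `k + 2`. -/
def evalProg (q k : ℕ) : Program :=
  .seq (readProg q (q ^ q ^ (k + 2))) (.seq (paramProg q k (q ^ q ^ (k + 2)))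
    (averageProg q (k + 2) (q ^ q ^ (k + 2))))

/-- Running time of `evalProg`. -/
def evalCost (q k n m : ℕ) : ℕ :=
  readCost q n + (paramCost k n m + (parN (1 + n + m) * (sampleCost q (k + 2) n
    (parL q k (1 + n + m)) (parR q k (1 + n + m)) + 3) + 8) + 1) + 1

theorem evalProg_spec {ε : ℝ} (hε : 0 < ε) {P : Operation q (k + 2) → ℝ} {w : Fin n → Fin q → ℝ}
    {f : (Fin n → Fin q) → ℝ} (hP : P ∈ stdSimplex ℝ (Operation q (k + 2)))
    (hw : ∀ i, w i ∈ stdSimplex ℝ (Fin q)) (x₀ : Fin n → Fin q) :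
    Spec (valueOracle f) (evalProg q k) (evalCost q k n ⌈1 / ε⌉₊) (load n (realInput ε P w))
      (iterK (fun _ => addK (sampleLaw P (1 / parT q (parS n ε)) (parL q k (parS n ε))
        (parR q k (parS n ε)) w x₀) f) (parN (parS n ε)) 0)
      fun S s => s.real 0 = S / parN (parS n ε) := by
  have hs : 1 ≤ parS n ε := by rw [parS]; omega
  have hT : q + 1 ≤ parT q (parS n ε) := by
    rw [parT]
    calc q + 1 = 1 * (q + 1) ^ 1 * 1 * 1 := by ring
      _ ≤ 32 * (q + 1) ^ 2 * parS n ε * parS n ε := by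
        gcongr
        · omega
        · omega
        · omega
  have hT0 : (0 : ℝ) < parT q (parS n ε) := by exact_mod_cast (Nat.succ_pos q).trans_le hT
  refine DSpec.seq_spec readProg_spec fun s₁ h₁ => DSpec.seq_spec (paramProg_spec hε h₁)
    fun s₂ h₂ => averageProg_spec (c := params P w (parS n ε)) h₂ hP (one_div_pos.2 hT0) ?_ hw x₀
  exact one_div_le_one_div_of_le (by positivity) (by exact_mod_cast hT)

/-- The towers in q and k are constants here; everything else is built from n and s by sums,
products and fixed powers. -/
theorem polyBdd_evalCost (q k : ℕ) : PolyBdd (evalCost q k) := by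
  have hs : PolyBdd fun n m => 1 + n + m := ((PolyBdd.const 1).add PolyBdd.left).add PolyBdd.right
  have hc := PolyBdd.const
  have hl := PolyBdd.left
  have hT : PolyBdd fun n m => parT q (1 + n + m) := ((hc _).mul hs).mul hs
  have hR : PolyBdd fun n m => parR q k (1 + n + m) := ((hc _).mul (hs.pow 5)).mul (hT.pow _)
  have hL : PolyBdd fun n m => parL q k (1 + n + m) :=
    ((hc 64).mul hs).mul ((hR.mul (hc _)).add (hs.mul (hc _)))
  have hN : PolyBdd fun n m => parN (1 + n + m) := (hc 192).mul (hs.pow 3)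
  have hstep : PolyBdd fun n m => stepCost q (k + 2) n (parL q k (1 + n + m)) :=
    (((hL.mul (hc 9)).add (hc 15)).add (hl.mul (hc _))).add (hc _)
  have hletter : PolyBdd fun n m => letterCost q n (parL q k (1 + n + m)) :=
    (hl.mul (((hL.mul (hc 9)).add (hc _)).add (hc 16))).add (hc 8)
  have hsample : PolyBdd fun n m => sampleCost q (k + 2) n (parL q k (1 + n + m))
      (parR q k (1 + n + m)) :=
    (((hl.mul (hc _)).add (hR.mul (hstep.add (hc 3)))).add hletter).add (hc 18)
  have hread : PolyBdd fun n _ => readCost q n :=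
    ((hl.mul (hc 5)).add ((hl.mul (hc q)).mul (hc 7))).add (hc 21)
  have hparam : PolyBdd fun n m => paramCost k n m :=
    (((hl.mul (hc 5)).add (PolyBdd.right.mul (hc 5))).add (hc (k * 2))).add (hc 70)
  exact (hread.add ((hparam.add ((hN.mul (hsample.add (hc 3))).add (hc 8))).add (hc 1))).add (hc 1)

end RealRAM

end

/-! ### Assembly: running time and accuracy -/

theorem mainTheorem3 (q k : ℕ) (hk : 2 ≤ k) :
    ∃ (M : RealRAM.Program) (C d : ℕ),
      ∀ (n : ℕ) (f : (Fin n → Fin q) → ℝ) (P : Operation q k → ℝ),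
        IsFractionalPolymorphism P f → IsTransitiveSymmetric P → IsMeasurePreserving P →
        ∀ (ε : ℝ), 0 < ε →
        ∀ (w : Fin n → Fin q → ℝ), (∀ i, w i ∈ stdSimplex ℝ (Fin q)) →
          ∃ T : ℕ, (T : ℝ) ≤ C * (n + 1 / ε + 1) ^ d ∧
            (∀ c ∈ (RealRAM.runOn M (valueOracle f) n (realInput ε P w) T).support,
              c.todo = []) ∧
            (1 : ℝ≥0∞) - (1 / 2) ^ (n + 2) ≤
              (RealRAM.runOn M (valueOracle f) n (realInput ε P w) T).toOuterMeasure
                {c | |c.output - convexExtension f w| ≤ ε * ‖f‖} := by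
  obtain ⟨k, rfl⟩ : ∃ k', k = k' + 2 := ⟨k - 2, by omega⟩
  obtain ⟨C, d, hCd⟩ := RealRAM.polyBdd_evalCost q k
  -- The factor 2^d absorbs the passage from ⌈1/ε⌉ to 1/ε.
  refine ⟨RealRAM.evalProg q k, C * 2 ^ d, d, fun n f P hP ht hm ε hε w hw => ?_⟩
  refine ⟨RealRAM.evalCost q k n ⌈1 / ε⌉₊, ?_, ?_⟩
  · have h1 : (⌈1 / ε⌉₊ : ℝ) < 1 / ε + 1 := Nat.ceil_lt_add_one (by positivity)
    have h2 : (0 : ℝ) < 1 / ε := by positivity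
    have h3 : ((n : ℝ) + ⌈1 / ε⌉₊ + 1) ≤ 2 * (n + 1 / ε + 1) := by
      have := Nat.cast_nonneg (α := ℝ) n
      linarith
    calc (RealRAM.evalCost q k n ⌈1 / ε⌉₊ : ℝ) ≤ C * ((n : ℝ) + ⌈1 / ε⌉₊ + 1) ^ d := by
          exact_mod_cast hCd n ⌈1 / ε⌉₊
      _ ≤ C * (2 * (n + 1 / ε + 1)) ^ d := by gcongr
      _ = ((C * 2 ^ d : ℕ) : ℝ) * (n + 1 / ε + 1) ^ d := by push_cast; rw [mul_pow]; ring
  · have hx : ∀ i, Nonempty (Fin q) := fun i => by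
      by_contra h
      rw [not_nonempty_iff] at h
      simpa using (hw i).2
    have hs : n + 1 ≤ RealRAM.parS n ε := by rw [RealRAM.parS]; omega
    have hsε : 1 / (RealRAM.parS n ε : ℝ) ≤ ε := by
      rw [one_div_le (by exact_mod_cast (Nat.succ_pos n).trans_le hs) hε]
      refine (Nat.le_ceil _).trans ?_
      rw [RealRAM.parS]
      exact_mod_cast Nat.le_add_left _ _
    refine RealRAM.runOn_of_spec (RealRAM.evalProg_spec hε hP.1 hw fun i => (hx i).some)
      {v | |v - convexExtension f w| ≤ ε * ‖f‖}
      (fun S => ¬ |S / RealRAM.parN (RealRAM.parS n ε) - convexExtension f w| ≤ ε * ‖f‖) (fun S s h hS => ?_)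
      (RealRAM.sampleLaw_accurate hP ht hm hw _ hs hsε)
    rw [h]
    exact not_not.1 hS
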